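/- Let $B:\mathbb{R}^2\to\mathbb{R}$ satisfy $B\in L^p_{\rm loc}(\mathbb{R}^2)$ for some $p>2$ and $|B(x)|=\mathcal{O}(|x|^{-\tau})$ as $|x|\to\infty$ for some $\tau>2$, and let $A=(A_1,A_2)\in L^\infty(\mathbb{R}^2;\mathbb{R}^2)$ satisfy $\partial_1A_2-\partial_2A_1=B$ in the sense of distributions. Put $$\alpha=\frac1{2\pi}\int_{\mathbb{R}^2}B\,dx,\qquad h(x)=-\frac1{2\pi}\int_{\mathbb{R}^2}B(y)\log|x-y|\,dy,\qquad \mu_\alpha=\min_{m\in\mathbb{Z}}|m-\alpha| .$$ For $\rho>0$ let $g_+(\rho;r)=1$ if $r\le\rho$ and $g_+(\rho;r)=\rho^{-\alpha}r^{\alpha}$ if $r>\rho$, let $g_-=1/g_+$, and $$k_\pm(\rho)=\inf_{x\in\mathbb{R}^2}\frac{e^{\mp h(x)}}{g_\pm(\rho;|x|)},\qquad K_\pm(\rho)=\sup_{x\in\mathbb{R}^2}\frac{e^{\mp h(x)}}{g_\pm(\rho;|x|)},\qquad \beta_\pm(B;\rho)=\Big(\frac{k_\pm(\rho)}{K_\pm(\rho)}\Big)^2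 ,$$ $$\mathrm{w}_\pm(\rho;x)=\beta_\pm(B;\rho)\cdot\begin{cases}\dfrac{\mu_\alpha^2}{\rho^2+|x|^2}, & \alpha\notin\mathbb{Z},\\[2ex] \dfrac{|\alpha|}{4|\alpha|+\pi}\,\dfrac{1}{\rho^2+|x|^2\big(1+\log^2(|x|/\rho)\big)}, & \alpha\in\mathbb{Z}.\end{cases}$$ Let $\mathcal W(\rho;x)=\begin{pmatrix}\mathrm{w}_+(\rho;x)&0\\0&0\end{pmatrix}$ if $\alpha\ge0$ and $\mathcal W(\rho;x)=\begin{pmatrix}0&0\\0&\mathrm{w}_-(\rho;x)\end{pmatrix}$ if $\alpha\le0$ (both are zero if $\alpha=0$). Then the integrals defining $\alpha$ and $h(x)$, $x\in\mathbb{R}^2$, converge absolutely, $0<k_\pm(\rho)\le K_\pm(\rho)<\infty$ for every $\rho>0$, and for every $\rho>0$ the Pauli operator $P(A)=\begin{pmatrix}(i\nabla+A)^2+B&0\\0&(i\nabla+A)^2-B\end{pmatrix}$ satisfies $$P(A)\ \ge\ \mathcal W(\rho;\cdot)$$ in the sense of quadratic forms on $H^1(\mathbb{R}^2;\mathbb{C}^2)$.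 That is, for every $u=(u_+,u_-)\in H^1(\mathbb{R}^2;\mathbb{C}^2)$ the integrands below are integrable and $$\int_{\mathbb{R}^2}\Big(|(i\nabla+A)u_+|^2+B|u_+|^2+|(i\nabla+A)u_-|^2-B|u_-|^2\Big)dx\ \ge\ \int_{\mathbb{R}^2}\langle u,\mathcal W(\rho;x)u\rangle_{\mathbb{C}^2}\,dx .$$ -/

import Mathlib

open MeasureTheory Set Filter
open scoped ENNReal ContDiff

noncomputable section

namespace PauliHardy

/-- The Euclidean plane. -/
abbrev Plane : Type := EuclideanSpace ℝ (Fin 2)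

/-- The space of spinors, i.e. complex two-vectors; index `0` is spin up and `1` is spin down. -/
abbrev Spinor : Type := EuclideanSpace ℂ (Fin 2)

/-- Real-valued smooth compactly supported test functions on the plane. -/
structure IsTest (φ : Plane → ℝ) : Prop where
  smooth : ContDiff ℝ ∞ φ
  compact : HasCompactSupport φ

/-- The classical partial derivative of a differentiable function in the `j`-th direction. -/
def partialDeriv (j : Fin 2) (φ : Plane → ℝ) (x : Plane) : ℝ :=
  fderiv ℝ φ x (EuclideanSpace.single j 1)

/-- `u ∈ H¹(ℝ²; F)` with weak partial derivatives `D 0`, `D 1`: the function and its weak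
partial derivatives are square integrable. -/
structure IsH1 {F : Type*} [NormedAddCommGroup F] [NormedSpace ℝ F]
    (u : Plane → F) (D : Fin 2 → Plane → F) : Prop where
  memLp : MemLp u 2 volume
  memLp_deriv : ∀ j, MemLp (D j) 2 volume
  weakDeriv : ∀ j, ∀ φ : Plane → ℝ, IsTest φ →
    ∫ x, partialDeriv j φ x • u x = - ∫ x, φ x • D j x

/-- The standing assumption on the magnetic field: `B ∈ L^p_loc` for some `p > 2`, and
`B(x) = O(|x|^{-τ})` at infinity for some `τ > 2` (almost everywhere, since `B` is an
`L^p_loc` function). -/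
structure IsAdmissibleField (B : Plane → ℝ) : Prop where
  locLp : ∃ p : ℝ≥0∞, 2 < p ∧ ∀ K : Set Plane, IsCompact K → MemLp B p (volume.restrict K)
  decay : ∃ τ : ℝ, 2 < τ ∧ ∃ C R : ℝ, ∀ᵐ x : Plane, R ≤ ‖x‖ → |B x| ≤ C * ‖x‖ ^ (-τ)

/-- `∂₁ A₂ - ∂₂ A₁ = B` in the sense of distributions. -/
def HasDistribCurl (A : Plane → Plane) (B : Plane → ℝ) : Prop :=
  ∀ φ : Plane → ℝ, IsTest φ →
    ∫ x, (A x 0 * partialDeriv 1 φ x - A x 1 * partialDeriv 0 φ x) = ∫ x, B x * φ x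

/-- The normalized flux `α = (2π)⁻¹ ∫ B`. -/
def flux (B : Plane → ℝ) : ℝ := (2 * Real.pi)⁻¹ * ∫ x, B x

/-- The superpotential `h(x) = -(2π)⁻¹ ∫ B(y) log |x - y| dy`. -/
def superpotential (B : Plane → ℝ) (x : Plane) : ℝ :=
  -(2 * Real.pi)⁻¹ * ∫ y, B y * Real.log ‖x - y‖

/-- The comparison profile `g₊(ρ; r)`: `1` for `r ≤ ρ` and `ρ^{-α} r^α` for `r > ρ`. -/
def gPlus (α ρ r : ℝ) : ℝ := if r ≤ ρ then 1 else ρ ^ (-α) * r ^ α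

/-- The comparison profile `g₋ = 1 / g₊`. -/
def gMinus (α ρ r : ℝ) : ℝ := 1 / gPlus α ρ r

/-- The quotient `e^{-h(x)} / g₊(ρ; |x|)`. -/
def ratioPlus (B : Plane → ℝ) (ρ : ℝ) (x : Plane) : ℝ :=
  Real.exp (-superpotential B x) / gPlus (flux B) ρ ‖x‖

/-- The quotient `e^{h(x)} / g₋(ρ; |x|)`. -/
def ratioMinus (B : Plane → ℝ) (ρ : ℝ) (x : Plane) : ℝ :=
  Real.exp (superpotential B x) / gMinus (flux B) ρ ‖x‖

/-- `k₊(ρ)`, the infimum of `e^{-h} / g₊`. -/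
def kPlus (B : Plane → ℝ) (ρ : ℝ) : ℝ := ⨅ x, ratioPlus B ρ x

/-- `K₊(ρ)`, the supremum of `e^{-h} / g₊`. -/
def bigKPlus (B : Plane → ℝ) (ρ : ℝ) : ℝ := ⨆ x, ratioPlus B ρ x

/-- `k₋(ρ)`, the infimum of `e^{h} / g₋`. -/
def kMinus (B : Plane → ℝ) (ρ : ℝ) : ℝ := ⨅ x, ratioMinus B ρ x

/-- `K₋(ρ)`, the supremum of `e^{h} / g₋`. -/
def bigKMinus (B : Plane → ℝ) (ρ : ℝ) : ℝ := ⨆ x, ratioMinus B ρ x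

/-- `β₊(B; ρ) = (k₊ / K₊)²`. -/
def betaPlus (B : Plane → ℝ) (ρ : ℝ) : ℝ := (kPlus B ρ / bigKPlus B ρ) ^ 2

/-- `β₋(B; ρ) = (k₋ / K₋)²`. -/
def betaMinus (B : Plane → ℝ) (ρ : ℝ) : ℝ := (kMinus B ρ / bigKMinus B ρ) ^ 2

/-- `μ_α`, the distance from `α` to the integers. -/
def distToInt (α : ℝ) : ℝ := ⨅ m : ℤ, |(m : ℝ) - α|

open Classical in
/-- The common radial factor of the Hardy weights: for non-integer flux it is
`μ_α² / (ρ² + r²)`, and for integer flux it is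
`|α| / (4|α| + π) · 1 / (ρ² + r² (1 + log² (r/ρ)))`. -/
def hardyProfile (α ρ r : ℝ) : ℝ :=
  if ∃ m : ℤ, (m : ℝ) = α then
    |α| / (4 * |α| + Real.pi) * (1 / (ρ ^ 2 + r ^ 2 * (1 + Real.log (r / ρ) ^ 2)))
  else distToInt α ^ 2 / (ρ ^ 2 + r ^ 2)

/-- The Hardy weight `w₊(ρ; x)`. -/
def wPlus (B : Plane → ℝ) (ρ : ℝ) (x : Plane) : ℝ :=
  betaPlus B ρ * hardyProfile (flux B) ρ ‖x‖

/-- The Hardy weight `w₋(ρ; x)`. -/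
def wMinus (B : Plane → ℝ) (ρ : ℝ) (x : Plane) : ℝ :=
  betaMinus B ρ * hardyProfile (flux B) ρ ‖x‖

/-- The density `|(i∇ + A) v|² + s B |v|²` of the quadratic form of the scalar operator
`(i∇ + A)² + s B`, where `D` is the weak gradient of `v`. -/
def scalarDensity (s : ℝ) (A : Plane → Plane) (B : Plane → ℝ)
    (v : Plane → ℂ) (D : Fin 2 → Plane → ℂ) (x : Plane) : ℝ :=
  (∑ j, ‖Complex.I * D j x + (A x j : ℂ) * v x‖ ^ 2) + s * B x * ‖v x‖ ^ 2

/-- The density of the quadratic form of the Pauli operator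
`P(A) = diag ((i∇ + A)² + B, (i∇ + A)² - B)`. -/
def pauliDensity (A : Plane → Plane) (B : Plane → ℝ)
    (u : Plane → Spinor) (D : Fin 2 → Plane → Spinor) (x : Plane) : ℝ :=
  scalarDensity 1 A B (fun y => u y 0) (fun j y => D j y 0) x
    + scalarDensity (-1) A B (fun y => u y 1) (fun j y => D j y 1) x

/-- The density `⟨u(x), W(x) u(x)⟩` of the quadratic form of a matrix-valued potential. -/
def weightDensity (W : Plane → Matrix (Fin 2) (Fin 2) ℝ) (u : Plane → Spinor) (x : Plane) : ℝ :=
  (∑ i, ∑ k, (starRingEnd ℂ) (u x i) * (W x i k : ℂ) * u x k).re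

/-- `P(A) ≥ W` in the sense of quadratic forms on `H¹(ℝ²; ℂ²)`: both forms are finite on the
whole of `H¹(ℝ²; ℂ²)`, and the one of `P(A)` dominates. -/
def PauliGE (A : Plane → Plane) (B : Plane → ℝ)
    (W : Plane → Matrix (Fin 2) (Fin 2) ℝ) : Prop :=
  ∀ (u : Plane → Spinor) (D : Fin 2 → Plane → Spinor), IsH1 u D →
    Integrable (pauliDensity A B u D) ∧ Integrable (weightDensity W u) ∧
      ∫ x, weightDensity W u x ≤ ∫ x, pauliDensity A B u D x

end PauliHardy

end

/-! On smooth compactly supported `u` the spin-up form is a perfect square: up to a term that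
integrates to zero, `|(i∇ + A)u|² + B|u|²` is `|(∂₁ - i∂₂)u - i(A₁ - iA₂)u|²`
(`integral_formDensity`). If `-Δh = B` with smooth data, the Poincaré lemma gives a complex
potential `Ψ` with real part `h` and `(∂₁ - i∂₂)Ψ = -i(A₁ - iA₂)` (`exists_complex_potential`).
Setting `f = e^Ψ u` turns the form into `∫ e^{-2h} |(∂₁ - i∂₂)f|²`, while `|u|² = e^{-2h}|f|²`.
Replacing `e^{-h}` by the radial profile `g₊` costs exactly `(k₊/K₊)²` (`hardy_of_ground_state`).

What remains is a Hardy inequality for `∂₁ - i∂₂` with weight `g₊²`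
(`lintegral_hardyProfile_le_dz`). In polar coordinates the angular mode `m` sees the operator `F' +
(m/r)F`. Any subsolution `q` of a Riccati equation gives a lower bound by completing the square; the
factor `r^{2α}` shifts `m` to `m - α` outside the radius `ρ`. The subsolutions on the two sides need
only satisfy a one-sided jump condition at `ρ` (`mode_hardy`). For `m ≠ α` a constant `q` works
outside. The resonant mode `m = α`, which occurs only for integer flux, needs the critical
logarithmic solution, and this produces the logarithm in the weight.

The constants `k₊`, `K₊` are positive and finite because `h + α log(1 + |x|)` is bounded
(`exists_abs_superpotential_add_le`).

Rough data are handled by mollifying `A`, `B` and `h` with the same kernel. This preserves both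
`curl A = B` and `-Δh = B`, the latter because `log |x|` is `2π` times the fundamental solution, and
the comparison constants converge since `log g₊` is Lipschitz. The inequality then passes to bounded
`A` on test functions (`hardy_test`), and to `H¹` because a field in `L²` is form-bounded by
Ladyzhenskaya's inequality. The spin-down form is the spin-up form of `(-A, -B)` after complex
conjugation, so one sign of the flux suffices; the component without weight contributes a
nonnegative form. -/

noncomputable section

namespace PauliHardy

/-! ### One-dimensional weighted Hardy inequalities -/

/-- Completing the square against a weight and integrating. -/
theorem integral_add_boundary_le {F F' : ℝ → ℂ} {w p p' v : ℝ → ℝ} {m a b : ℝ} (ha : 0 < a)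
    (hab : a ≤ b) (hF : ∀ r ∈ Icc a b, HasDerivAt F (F' r) r) (hF' : ContinuousOn F' (Icc a b))
    (hp : ∀ r ∈ Icc a b, HasDerivAt p (p' r) r) (hp' : ContinuousOn p' (Icc a b))
    (hw : ContinuousOn w (Icc a b)) (hw0 : ∀ r ∈ Icc a b, 0 < w r)
    (hv : ContinuousOn v (Icc a b))
    (h : ∀ r ∈ Icc a b, v r ≤ -p' r + 2 * p r * m / r - p r ^ 2 / w r) :
    (∫ r in a..b, v r * ‖F r‖ ^ 2) + (p b * ‖F b‖ ^ 2 - p a * ‖F a‖ ^ 2)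
      ≤ ∫ r in a..b, w r * ‖F' r + (m / r : ℝ) • F r‖ ^ 2 := by
  have hu : uIcc a b = Icc a b := uIcc_of_le hab
  have cF : ContinuousOn F (Icc a b) := fun r hr => (hF r hr).continuousAt.continuousWithinAt
  have cp : ContinuousOn p (Icc a b) := fun r hr => (hp r hr).continuousAt.continuousWithinAt
  have cm : ContinuousOn (fun r : ℝ => m / r) (Icc a b) :=
    continuousOn_const.div continuousOn_id fun r hr => (ha.trans_le hr.1).ne'
  have c1 : ContinuousOn (fun r => v r * ‖F r‖ ^ 2) (Icc a b) := hv.mul (cF.norm.pow 2)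
  have c2 : ContinuousOn (fun r => w r * ‖F' r + (m / r : ℝ) • F r‖ ^ 2) (Icc a b) :=
    hw.mul ((hF'.add (cm.smul cF)).norm.pow 2)
  have c3 : ContinuousOn
      (fun r => p' r * ‖F r‖ ^ 2 + p r * (2 * inner ℝ (F r) (F' r))) (Icc a b) :=
    (hp'.mul (cF.norm.pow 2)).add (cp.mul (continuousOn_const.mul (cF.inner hF')))
  -- The boundary terms become the integral of `(p‖F‖²)'`, which reduces the claim to a pointwise
  -- one.
  have key := intervalIntegral.integral_eq_sub_of_hasDerivAt
    (f := fun r => p r * ‖F r‖ ^ 2)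
    (f' := fun r => p' r * ‖F r‖ ^ 2 + p r * (2 * inner ℝ (F r) (F' r))) (a := a) (b := b)
    (fun r hr => (hp r (hu ▸ hr)).mul (hF r (hu ▸ hr)).norm_sq)
    (c3.mono hu.le).intervalIntegrable
  rw [← key, ← intervalIntegral.integral_add (c1.mono hu.le).intervalIntegrable
    (c3.mono hu.le).intervalIntegrable]
  refine intervalIntegral.integral_mono_on hab ((c1.add c3).mono hu.le).intervalIntegrable
    (c2.mono hu.le).intervalIntegrable fun r hr => ?_
  have hw := hw0 r hr
  have hr0 : r ≠ 0 := (ha.trans_le hr.1).ne'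
  set X := F' r + (m / r : ℝ) • F r with hX
  have e1 : inner ℝ (F r) (F' r) = inner ℝ X (F r) - m / r * ‖F r‖ ^ 2 := by
    rw [hX, inner_add_left, real_inner_smul_left, real_inner_self_eq_norm_sq,
      real_inner_comm]; ring
  -- Expanding this square and dividing by `w` bounds `w‖X‖²` below. Substituting `F' = X - (m/r)F`
  -- in the derivative of `‖F‖²` leaves exactly the coefficient in `h`.
  have e2 : 0 ≤ ‖w r • X - p r • F r‖ ^ 2 := sq_nonneg _
  rw [norm_sub_sq_real, norm_smul, norm_smul, real_inner_smul_left, real_inner_smul_right,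
    mul_pow, mul_pow, Real.norm_eq_abs, Real.norm_eq_abs, sq_abs, sq_abs] at e2
  have e3 : 0 ≤ w r * ‖X‖ ^ 2 - 2 * p r * inner ℝ X (F r) + p r ^ 2 / w r * ‖F r‖ ^ 2 := by
    have : w r * ‖X‖ ^ 2 - 2 * p r * inner ℝ X (F r) + p r ^ 2 / w r * ‖F r‖ ^ 2
      = (w r ^ 2 * ‖X‖ ^ 2 - 2 * (w r * (p r * inner ℝ X (F r))) + p r ^ 2 * ‖F r‖ ^ 2) / w r := by
      field_simp
    rw [this]; positivity
  have e4 := mul_le_mul_of_nonneg_right (h r hr) (sq_nonneg ‖F r‖)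
  rw [e1]
  have e5 : (-p' r + 2 * p r * m / r - p r ^ 2 / w r) * ‖F r‖ ^ 2
    = -p' r * ‖F r‖ ^ 2 + 2 * p r * (m / r * ‖F r‖ ^ 2) - p r ^ 2 / w r * ‖F r‖ ^ 2 := by ring
  rw [e5] at e4
  linarith

theorem lintegral_Ioc_ofReal {φ : ℝ → ℝ} {a b : ℝ} (hab : a ≤ b) (hφ : ContinuousOn φ (Icc a b))
    (h0 : ∀ r ∈ Icc a b, 0 ≤ φ r) :
    ∫⁻ r in Ioc a b, ENNReal.ofReal (φ r) = ENNReal.ofReal (∫ r in a..b, φ r) := by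
  rw [intervalIntegral.integral_of_le hab, ofReal_integral_eq_lintegral_ofReal]
  · exact (hφ.integrableOn_Icc).mono_set Ioc_subset_Icc_self
  · filter_upwards [self_mem_ae_restrict measurableSet_Ioc] with r hr
    exact h0 r (Ioc_subset_Icc_self hr)

theorem iUnion_Ioc_inv_nat : (⋃ n : ℕ, Ioc ((n : ℝ) + 1)⁻¹ (n : ℝ)) = Ioi 0 := by
  ext r
  simp only [mem_iUnion, mem_Ioc, mem_Ioi]
  refine ⟨fun ⟨n, h, _⟩ => lt_trans (by positivity) h, fun h => ?_⟩
  obtain ⟨n, hn⟩ := exists_nat_gt (max r r⁻¹)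
  refine ⟨n, ?_, (le_max_left _ _).trans hn.le⟩
  rw [inv_lt_comm₀ (by positivity) h]
  linarith [le_max_right r r⁻¹]

/-- Monotone convergence. The coefficient `m/r` is singular at the origin, so estimates are made on
`(δ, R]`; `e δ` stands for the boundary term left at the inner end. -/
theorem lintegral_Ioi_le_of_forall_Ioc {f : ℝ → ℝ≥0∞} {C : ℝ≥0∞} {e : ℝ → ℝ≥0∞} {ρ : ℝ}
    (hρ : 0 < ρ)
    (he : Tendsto e (nhdsWithin 0 (Ioi 0)) (nhds 0))
    (h : ∀ δ R, 0 < δ → δ < ρ → ρ < R → ∫⁻ r in Ioc δ R, f r ≤ C + e δ) :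
    ∫⁻ r in Ioi 0, f r ≤ C := by
  have hm : Monotone fun n : ℕ => Ioc ((n : ℝ) + 1)⁻¹ (n : ℝ) := by
    intro i j hij
    have : (i : ℝ) ≤ j := by exact_mod_cast hij
    exact Ioc_subset_Ioc (by gcongr) this
  have ht : Tendsto (fun n : ℕ => ((n : ℝ) + 1)⁻¹) atTop (nhdsWithin 0 (Ioi 0)) := by
    refine tendsto_nhdsWithin_iff.2 ⟨?_, Eventually.of_forall fun n => by
      simp only [mem_Ioi]; positivity⟩
    simpa using tendsto_one_div_add_atTop_nhds_zero_nat (𝕜 := ℝ)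
  rw [← iUnion_Ioc_inv_nat, setLIntegral_iUnion_of_directed _ hm.directed_le]
  have hm' : Monotone fun n : ℕ => ∫⁻ r in Ioc ((n : ℝ) + 1)⁻¹ (n : ℝ), f r :=
    fun i j hij => lintegral_mono_set (hm hij)
  have h2 : Tendsto (fun n : ℕ => C + e ((n : ℝ) + 1)⁻¹) atTop (nhds C) := by
    simpa using (tendsto_const_nhds (x := C)).add (he.comp ht)
  refine le_of_tendsto_of_tendsto (tendsto_atTop_iSup hm') h2 ?_
  obtain ⟨N, hN⟩ := exists_nat_gt (max ρ ρ⁻¹)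
  filter_upwards [eventually_ge_atTop N] with n hn
  have hn' : (N : ℝ) ≤ n := by exact_mod_cast hn
  refine h _ _ (by positivity) ?_ (by linarith [le_max_left ρ ρ⁻¹])
  rw [inv_lt_comm₀ (by positivity) hρ]
  linarith [le_max_right ρ ρ⁻¹]

theorem gPlus_eq_of_ge {α ρ r : ℝ} (hρ : 0 < ρ) (h : ρ ≤ r) :
    gPlus α ρ r = ρ ^ (-α) * r ^ α := by
  rcases h.eq_or_lt with rfl | h
  · rw [gPlus, if_pos le_rfl, ← Real.rpow_add hρ]; simp
  · rw [gPlus, if_neg (not_le.2 h)]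

theorem gPlus_pos {α ρ r : ℝ} (hρ : 0 < ρ) : 0 < gPlus α ρ r := by
  unfold gPlus
  split_ifs with h
  · exact one_pos
  · have : 0 < r := hρ.trans (not_le.1 h)
    positivity

/-- Hardy inequality for a single angular mode with the weight `g₊² r dr`, given
subsolutions `q₁`, `q₂` of the Riccati equations inside and outside of the radius `ρ`. -/
theorem mode_hardy {F F' : ℝ → ℂ} {V q₁ q₁' q₂ q₂' : ℝ → ℝ} {m α ρ R₀ : ℝ} (hρ : 0 < ρ)
    (hF : ∀ r, 0 < r → HasDerivAt F (F' r) r) (hF' : ContinuousOn F' (Ioi 0))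
    (hR : ∀ r, R₀ ≤ r → F r = 0)
    (hV : ContinuousOn V (Ioi 0)) (hV0 : ∀ r, 0 < r → 0 ≤ V r)
    (hq₁ : ∀ r, 0 < r → HasDerivAt q₁ (q₁' r) r) (hq₁' : ContinuousOn q₁' (Ioi 0))
    (hq₂ : ∀ r, 0 < r → ρ ≤ r → HasDerivAt q₂ (q₂' r) r) (hq₂' : ContinuousOn q₂' (Ici ρ))
    (h₁ : ∀ r, 0 < r → r ≤ ρ → V r * r ≤ -q₁' r + 2 * m * q₁ r / r - q₁ r ^ 2 / r)
    (h₂ : ∀ r, ρ ≤ r → V r * r ≤ -q₂' r + 2 * (m - α) * q₂ r / r - q₂ r ^ 2 / r)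
    (hjump : q₂ ρ ≤ q₁ ρ)
    (hzero : Tendsto (fun r => q₁ r * ‖F r‖ ^ 2) (nhdsWithin 0 (Ioi 0)) (nhds 0)) :
    ∫⁻ r in Ioi 0, ENNReal.ofReal (V r * gPlus α ρ r ^ 2 * r * ‖F r‖ ^ 2) ≤
      ∫⁻ r in Ioi 0, ENNReal.ofReal
        (gPlus α ρ r ^ 2 * r * ‖F' r + (m / r : ℝ) • F r‖ ^ 2) := by
  refine lintegral_Ioi_le_of_forall_Ioc
    (e := fun δ => ENNReal.ofReal (q₁ δ * ‖F δ‖ ^ 2)) hρ ?_ ?_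
  · simpa using ENNReal.tendsto_ofReal hzero
  intro δ R' hδ hδρ hρR'
  -- Enlarging the interval makes `F` vanish at its outer end, so no boundary term remains there.
  set R := max R' R₀
  have hρR : ρ ≤ R := hρR'.le.trans (le_max_left _ _)
  have sub1 : Icc δ ρ ⊆ Ioi 0 := fun r hr => hδ.trans_le hr.1
  have sub2 : Icc ρ R ⊆ Ioi 0 := fun r hr => hρ.trans_le hr.1
  have cF : ContinuousOn F (Ioi 0) := fun r hr => (hF r hr).continuousAt.continuousWithinAt
  have cm : ContinuousOn (fun r : ℝ => m / r) (Ioi 0) :=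
    continuousOn_const.div continuousOn_id fun r hr => (mem_Ioi.1 hr).ne'
  have cX : ContinuousOn (fun r => ‖F' r + (m / r : ℝ) • F r‖ ^ 2) (Ioi 0) :=
    (hF'.add (cm.smul cF)).norm.pow 2
  set G : ℝ → ℝ := fun r => ρ ^ (-α) * r ^ α with hG
  have hGd : ∀ r, 0 < r → HasDerivAt G (G r * (α / r)) r := by
    intro r hr
    have := (Real.hasDerivAt_rpow_const (x := r) (p := α) (Or.inl hr.ne')).const_mul (ρ ^ (-α))
    refine this.congr_deriv ?_
    rw [Real.rpow_sub_one hr.ne', hG]; ring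
  have cG : ContinuousOn G (Ioi 0) := fun r hr => (hGd r hr).continuousAt.continuousWithinAt
  have G0 : ∀ r, 0 < r → 0 < G r := fun r hr => by simp only [hG]; positivity
  have Gρ : G ρ = 1 := by simp only [hG]; rw [← Real.rpow_add hρ]; simp
  have cq2 : ContinuousOn q₂ (Icc ρ R) := fun r hr =>
    (hq₂ r (sub2 hr) hr.1).continuousAt.continuousWithinAt
  have I1 := integral_add_boundary_le (F := F) (F' := F') (w := fun r => r) (p := q₁) (p' := q₁')
    (v := fun r => V r * r) (m := m) hδ hδρ.le (fun r hr => hF r (sub1 hr)) (hF'.mono sub1)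
    (fun r hr => hq₁ r (sub1 hr)) (hq₁'.mono sub1) continuousOn_id (fun r hr => sub1 hr)
    ((hV.mono sub1).mul continuousOn_id) (fun r hr => by
      refine (h₁ r (sub1 hr) hr.2).trans (le_of_eq ?_); ring)
  -- With `p = G² q₂`, the derivative of `G² = (r/ρ)^{2α}` contributes `2αG²q₂/r`. This replaces `m`
  -- by `m - α` in the Riccati inequality.
  have I2 := integral_add_boundary_le (F := F) (F' := F') (w := fun r => G r ^ 2 * r)
    (p := fun r => G r ^ 2 * q₂ r)
    (p' := fun r => G r ^ 2 * (2 * α * q₂ r / r) + G r ^ 2 * q₂' r)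
    (v := fun r => V r * G r ^ 2 * r) (m := m) hρ hρR (fun r hr => hF r (sub2 hr)) (hF'.mono sub2)
    (fun r hr => by
      have hr0 : r ≠ 0 := (sub2 hr).ne'
      have := ((hGd r (sub2 hr)).pow 2).mul (hq₂ r (sub2 hr) hr.1)
      refine this.congr_deriv ?_
      simp only [Pi.pow_apply, Nat.cast_ofNat]
      field_simp
      norm_num
      ring)
    (by
      have c1 := ((cG.mono sub2).pow 2)
      have c2 : ContinuousOn (fun r => 2 * α * q₂ r / r) (Icc ρ R) :=
        (continuousOn_const.mul cq2).div continuousOn_id fun r hr => (sub2 hr).ne'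
      exact (c1.mul c2).add (c1.mul (hq₂'.mono Icc_subset_Ici_self)))
    (((cG.mono sub2).pow 2).mul continuousOn_id)
    (fun r hr => mul_pos (pow_pos (G0 r (sub2 hr)) 2) (sub2 hr))
    (((hV.mono sub2).mul ((cG.mono sub2).pow 2)).mul continuousOn_id)
    (fun r hr => by
      have hr0 : r ≠ 0 := (sub2 hr).ne'
      have g0 : G r ≠ 0 := (G0 r (sub2 hr)).ne'
      have := mul_le_mul_of_nonneg_left (h₂ r hr.1) (sq_nonneg (G r))
      refine le_trans (le_of_eq (by ring)) (this.trans (le_of_eq ?_))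
      field_simp; ring)
  have FR : F R = 0 := hR R (le_max_right _ _)
  simp only [FR, Gρ, norm_zero] at I2
  have gin : ∀ r ∈ Ioc δ ρ, gPlus α ρ r = 1 := fun r hr => by rw [gPlus, if_pos hr.2]
  have gout : ∀ r ∈ Ioc ρ R, gPlus α ρ r = G r := fun r hr => gPlus_eq_of_ge hρ hr.1.le
  have un : Ioc δ ρ ∪ Ioc ρ R = Ioc δ R := Ioc_union_Ioc_eq_Ioc hδρ.le hρR
  have dj : Disjoint (Ioc δ ρ) (Ioc ρ R) := by
    rw [Set.disjoint_left]; rintro r hr hr'; exact absurd hr'.1 (not_lt.2 hr.2)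
  have A1 : ∫⁻ r in Ioc δ R', ENNReal.ofReal (V r * gPlus α ρ r ^ 2 * r * ‖F r‖ ^ 2)
      ≤ ENNReal.ofReal (∫ r in δ..ρ, V r * r * ‖F r‖ ^ 2)
        + ENNReal.ofReal (∫ r in ρ..R, V r * G r ^ 2 * r * ‖F r‖ ^ 2) := by
    refine (lintegral_mono_set (Ioc_subset_Ioc_right (le_max_left R' R₀))).trans ?_
    rw [← un, lintegral_union measurableSet_Ioc dj]
    refine le_of_eq (congrArg₂ _ ?_ ?_)
    · rw [← lintegral_Ioc_ofReal hδρ.le]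
      · exact setLIntegral_congr_fun measurableSet_Ioc fun r hr => by simp [gin r hr]
      · exact ((hV.mono sub1).mul continuousOn_id).mul (((cF.mono sub1).norm).pow 2)
      · exact fun r hr => mul_nonneg (mul_nonneg (hV0 r (sub1 hr)) (sub1 hr).le) (sq_nonneg _)
    · rw [← lintegral_Ioc_ofReal hρR]
      · exact setLIntegral_congr_fun measurableSet_Ioc fun r hr => by simp [gout r hr]
      · exact (((hV.mono sub2).mul ((cG.mono sub2).pow 2)).mul continuousOn_id).mul
          (((cF.mono sub2).norm).pow 2)
      · exact fun r hr => mul_nonneg (mul_nonneg (mul_nonneg (hV0 r (sub2 hr)) (sq_nonneg _))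
          (sub2 hr).le) (sq_nonneg _)
  have A2 : ENNReal.ofReal (∫ r in δ..ρ, r * ‖F' r + (m / r : ℝ) • F r‖ ^ 2)
        + ENNReal.ofReal (∫ r in ρ..R, G r ^ 2 * r * ‖F' r + (m / r : ℝ) • F r‖ ^ 2)
      ≤ ∫⁻ r in Ioi 0, ENNReal.ofReal
        (gPlus α ρ r ^ 2 * r * ‖F' r + (m / r : ℝ) • F r‖ ^ 2) := by
    refine le_trans ?_ (lintegral_mono_set (fun r (hr : r ∈ Ioc δ R) => hδ.trans hr.1))
    rw [← un, lintegral_union measurableSet_Ioc dj]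
    refine le_of_eq (congrArg₂ _ ?_ ?_)
    · rw [← lintegral_Ioc_ofReal hδρ.le]
      · exact setLIntegral_congr_fun measurableSet_Ioc fun r hr => by simp [gin r hr]
      · exact continuousOn_id.mul (cX.mono sub1)
      · exact fun r hr => mul_nonneg (sub1 hr).le (sq_nonneg _)
    · rw [← lintegral_Ioc_ofReal hρR]
      · exact setLIntegral_congr_fun measurableSet_Ioc fun r hr => by simp [gout r hr]
      · exact (((cG.mono sub2).pow 2).mul continuousOn_id).mul (cX.mono sub2)
      · exact fun r hr => mul_nonneg (mul_nonneg (sq_nonneg _) (sub2 hr).le) (sq_nonneg _)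
  have N1 : 0 ≤ ∫ r in δ..ρ, V r * r * ‖F r‖ ^ 2 := intervalIntegral.integral_nonneg hδρ.le
    fun r hr => mul_nonneg (mul_nonneg (hV0 r (sub1 hr)) (sub1 hr).le) (sq_nonneg _)
  have N2 : 0 ≤ ∫ r in ρ..R, V r * G r ^ 2 * r * ‖F r‖ ^ 2 := intervalIntegral.integral_nonneg hρR
    fun r hr => mul_nonneg (mul_nonneg (mul_nonneg (hV0 r (sub2 hr)) (sq_nonneg _))
          (sub2 hr).le) (sq_nonneg _)
  have N3 : 0 ≤ ∫ r in δ..ρ, r * ‖F' r + (m / r : ℝ) • F r‖ ^ 2 :=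
    intervalIntegral.integral_nonneg hδρ.le fun r hr => mul_nonneg (sub1 hr).le (sq_nonneg _)
  have N4 : 0 ≤ ∫ r in ρ..R, G r ^ 2 * r * ‖F' r + (m / r : ℝ) • F r‖ ^ 2 :=
    intervalIntegral.integral_nonneg hρR
      fun r hr => mul_nonneg (mul_nonneg (sq_nonneg _) (sub2 hr).le) (sq_nonneg _)
  refine A1.trans (le_trans ?_ (add_le_add_left A2 _))
  rw [← ENNReal.ofReal_add N1 N2, ← ENNReal.ofReal_add N3 N4]
  refine le_trans (ENNReal.ofReal_le_ofReal ?_) ENNReal.ofReal_add_le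
  -- The two boundary terms at `ρ` add up to `(q₁ ρ - q₂ ρ)‖F ρ‖² ≥ 0` and are discarded.
  have := mul_le_mul_of_nonneg_right hjump (sq_nonneg ‖F ρ‖)
  have e : (0:ℝ) ^ 2 = 0 := by norm_num
  simp only [e, mul_zero, one_pow, one_mul] at I2
  linarith

end PauliHardy
end

/-! ### Riccati subsolutions for the Hardy profile -/

noncomputable section

namespace PauliHardy

theorem distToInt_nonneg (α : ℝ) : 0 ≤ distToInt α := Real.iInf_nonneg fun _ => abs_nonneg _

theorem distToInt_le (α : ℝ) (m : ℤ) : distToInt α ≤ |(m : ℝ) - α| :=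
  ciInf_le ⟨0, by rintro _ ⟨m, rfl⟩; exact abs_nonneg _⟩ m

theorem distToInt_le_half (α : ℝ) : distToInt α ≤ 1 / 2 :=
  (distToInt_le α (round α)).trans (by rw [abs_sub_comm]; exact abs_sub_round α)

theorem hardyProfile_nonneg (α ρ r : ℝ) : 0 ≤ hardyProfile α ρ r := by
  unfold hardyProfile
  split_ifs
  · have := Real.pi_pos
    positivity
  · positivity

theorem hardyProfile_continuousOn {α ρ : ℝ} (hρ : 0 < ρ) :
    ContinuousOn (hardyProfile α ρ) (Ioi 0) := by
  unfold hardyProfile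
  split_ifs
  · refine continuousOn_const.mul (continuousOn_const.div ?_ fun r hr => ?_)
    · refine continuousOn_const.add ((continuousOn_id.pow 2).mul (continuousOn_const.add
        ((ContinuousOn.log (continuousOn_id.div_const _) fun r hr => ?_).pow 2)))
      exact (div_pos hr hρ).ne'
    · positivity
  · refine continuousOn_const.div (continuousOn_const.add (continuousOn_id.pow 2)) fun r hr => ?_
    positivity

theorem hardyProfile_measurable (α ρ : ℝ) : Measurable (hardyProfile α ρ) := by
  unfold hardyProfile
  split_ifs <;> fun_prop

theorem hardyProfile_mul_sq_le_of_int {α ρ r : ℝ} (h : ∃ m : ℤ, (m : ℝ) = α) (hρ : 0 < ρ) :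
    hardyProfile α ρ r * r ^ 2 ≤ 1 / 4 * (r ^ 2 / (ρ ^ 2 + r ^ 2)) := by
  rw [hardyProfile, if_pos h]
  have h1 : |α| / (4 * |α| + Real.pi) ≤ 1 / 4 := by
    have := Real.pi_pos
    rw [div_le_div_iff₀ (by positivity) (by norm_num)]
    linarith
  have h2 : 1 / (ρ ^ 2 + r ^ 2 * (1 + Real.log (r / ρ) ^ 2)) ≤ 1 / (ρ ^ 2 + r ^ 2) := by
    apply one_div_le_one_div_of_le (by positivity)
    nlinarith [mul_nonneg (sq_nonneg r) (sq_nonneg (Real.log (r / ρ)))]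
  calc _ ≤ 1 / 4 * (1 / (ρ ^ 2 + r ^ 2)) * r ^ 2 := by gcongr
    _ = _ := by ring

theorem hardyProfile_mul_sq_le_of_not_int {α ρ r : ℝ} (h : ¬ ∃ m : ℤ, (m : ℝ) = α) :
    hardyProfile α ρ r * r ^ 2 = distToInt α ^ 2 * (r ^ 2 / (ρ ^ 2 + r ^ 2)) := by
  rw [hardyProfile, if_neg h]; ring

/-- A constant subsolution equal to a nonzero integer `n` yields `n²/r`, so this crude bound settles
all such modes. -/
theorem hardyProfile_mul_sq_le_quarter {α ρ r : ℝ} (hρ : 0 < ρ) :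
    hardyProfile α ρ r * r ^ 2 ≤ 1 / 4 := by
  have h1 : r ^ 2 / (ρ ^ 2 + r ^ 2) ≤ 1 := by
    rw [div_le_one (by positivity)]; nlinarith
  by_cases h : ∃ m : ℤ, (m : ℝ) = α
  · exact (hardyProfile_mul_sq_le_of_int h hρ).trans (by linarith)
  · rw [hardyProfile_mul_sq_le_of_not_int h]
    have := distToInt_le_half α
    have h2 : distToInt α ^ 2 ≤ 1 / 4 := by nlinarith [distToInt_nonneg α]
    calc _ ≤ 1 / 4 * (1 : ℝ) := by gcongr
      _ = _ := by ring

/-- Outside the radius `ρ`: a bounded subsolution of the Riccati equation. -/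
theorem exists_riccati_outer {α ρ : ℝ} (hρ : 0 < ρ) (hα : 0 < α) (m : ℤ) :
    ∃ q q' : ℝ → ℝ, (∀ r, 0 < r → ρ ≤ r → HasDerivAt q (q' r) r) ∧ ContinuousOn q' (Ici ρ) ∧
      (∀ r, ρ ≤ r → hardyProfile α ρ r * r ≤
        -q' r + 2 * (m - α) * q r / r - q r ^ 2 / r) ∧ q ρ ≤ m ∧
      ((m : ℝ) ≠ α → q ρ = m - α) := by
  by_cases hm : (m : ℝ) = α
  -- At resonance the linear term vanishes, and `q = c/t` gives `(c - c²)/(t² r)`, largest at `c =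
  -- 1/2`. The additive constant in `t` makes `q ρ = α = m`, which matches the inner solution.
  · set t : ℝ → ℝ := fun r => Real.log (r / ρ) + 1 / (2 * α) with ht
    have t0 : ∀ r, ρ ≤ r → 0 < t r := fun r hr => by
      have : 0 ≤ Real.log (r / ρ) := Real.log_nonneg ((one_le_div hρ).2 hr)
      positivity
    have dt : ∀ r, 0 < r → HasDerivAt t (1 / r) r := fun r hr => by
      have := ((hasDerivAt_id r).div_const ρ).log (div_pos hr hρ).ne'
      refine (this.add_const (1 / (2 * α))).congr_deriv ?_
      simp only [id]; field_simp
    have ct : ContinuousOn t (Ici ρ) := fun r hr =>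
      (dt r (hρ.trans_le hr)).continuousAt.continuousWithinAt
    have tρ : 1 / (2 * t ρ) = α := by simp [ht, div_self hρ.ne']; field_simp
    refine ⟨fun r => 1 / (2 * t r), fun r => -(1 / r) / (2 * t r ^ 2), fun r hr hr' => ?_, ?_, ?_,
      ?_, fun h => absurd hm h⟩
    · have := (((dt r hr).const_mul 2).inv (by have := t0 r hr'; positivity))
      refine (this.congr_deriv ?_).congr_of_eventuallyEq
        (Eventually.of_forall fun x => by simp)
      have := (t0 r hr').ne'
      field_simp
    · refine ((continuousOn_const.div continuousOn_id fun r hr => ?_).neg).div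
        (continuousOn_const.mul (ct.pow 2)) fun r hr => ?_
      · exact (hρ.trans_le hr).ne'
      · have := t0 r hr; positivity
    · intro r hr
      have hr0 : 0 < r := hρ.trans_le hr
      have tp := t0 r hr
      have key : hardyProfile α ρ r * r ^ 2 ≤ 1 / (4 * t r ^ 2) := by
        rw [hardyProfile, if_pos ⟨m, hm⟩, abs_of_pos hα]
        have hpi := Real.pi_gt_three
        set l := Real.log (r / ρ) with hl
        have hα1 : 1 ≤ α := by
          have : (0 : ℝ) < m := hm ▸ hα
          have : 0 < m := by exact_mod_cast this
          rw [← hm]; exact_mod_cast this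
        have e : α / (4 * α + Real.pi) * (1 / (ρ ^ 2 + r ^ 2 * (1 + l ^ 2))) * r ^ 2
          = (α * r ^ 2) / ((4 * α + Real.pi) * (ρ ^ 2 + r ^ 2 * (1 + l ^ 2))) := by
          field_simp
        rw [e, div_le_div_iff₀ (by positivity) (by positivity), one_mul]
        -- Origin of the constant `α/(4α + π)`: after expansion one needs `4l + 1/α ≤ 4α + π(1 +
        -- l²)`, which follows from `α ≥ 1` (a positive integer) and `π > 3`.
        have c1 : α * (4 * t r ^ 2) ≤ (4 * α + Real.pi) * (1 + l ^ 2) := by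
          have e2 : t r = l + 1 / (2 * α) := rfl
          have e3 : α * (4 * t r ^ 2) = 4 * α * l ^ 2 + 4 * l + 1 / α := by
            rw [e2]; field_simp; ring
          have e4 : 1 / α ≤ 1 := by rw [div_le_one hα]; exact hα1
          rw [e3]
          nlinarith [sq_nonneg (l - 2 / 3), sq_nonneg l]
        calc α * r ^ 2 * (4 * t r ^ 2) = α * (4 * t r ^ 2) * r ^ 2 := by ring
          _ ≤ (4 * α + Real.pi) * (1 + l ^ 2) * r ^ 2 := by gcongr
          _ ≤ (4 * α + Real.pi) * (ρ ^ 2 + r ^ 2 * (1 + l ^ 2)) := by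
            rw [mul_assoc]; gcongr; nlinarith
      rw [hm, sub_self]
      have : -(-(1 / r) / (2 * t r ^ 2)) + 2 * 0 * (1 / (2 * t r)) / r - (1 / (2 * t r)) ^ 2 / r
        = 1 / (4 * t r ^ 2) / r := by field_simp; norm_num
      rw [this, le_div_iff₀ hr0]
      exact le_trans (le_of_eq (by ring)) key
    · simp only [tρ, hm, le_refl]
  -- The maximiser of `2(m - α)q - q²`.
  · refine ⟨fun _ => m - α, fun _ => 0, fun r _ _ => hasDerivAt_const _ _, continuousOn_const, ?_,
      by linarith, fun _ => rfl⟩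
    intro r hr
    have hr0 : 0 < r := hρ.trans_le hr
    have e : -0 + 2 * ((m : ℝ) - α) * (m - α) / r - (m - α) ^ 2 / r = (m - α) ^ 2 / r := by ring
    rw [e, le_div_iff₀ hr0, mul_assoc, ← pow_two]
    by_cases h : ∃ k : ℤ, (k : ℝ) = α
    · refine (hardyProfile_mul_sq_le_quarter hρ).trans ?_
      obtain ⟨k, rfl⟩ := h
      have h1 : m - k ≠ 0 := fun h => hm (by rw [sub_eq_zero.1 h])
      have h2 : (1 : ℤ) ≤ (m - k) ^ 2 := by
        have := sq_pos_of_ne_zero h1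
        omega
      have h3 : (1 : ℝ) ≤ ((m : ℝ) - k) ^ 2 := by exact_mod_cast h2
      linarith
    · rw [hardyProfile_mul_sq_le_of_not_int h]
      have h1 : r ^ 2 / (ρ ^ 2 + r ^ 2) ≤ 1 := by
        rw [div_le_one (by positivity)]; nlinarith
      have h2 := distToInt_le α m
      have h3 : distToInt α ^ 2 ≤ ((m : ℝ) - α) ^ 2 := by
        rw [← sq_abs ((m : ℝ) - α)]
        exact pow_le_pow_left₀ (distToInt_nonneg α) h2 2
      calc _ ≤ ((m : ℝ) - α) ^ 2 * (1 : ℝ) := by gcongr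
        _ = _ := by ring

/-- Inside the radius `ρ`: a subsolution of the Riccati equation. -/
theorem exists_riccati_inner {α ρ : ℝ} (hρ : 0 < ρ) (hα : 0 < α) (m : ℤ) :
    ∃ q q' : ℝ → ℝ, (∀ r, 0 < r → HasDerivAt q (q' r) r) ∧ ContinuousOn q' (Ioi 0) ∧
      (∀ r, 0 < r → r ≤ ρ → hardyProfile α ρ r * r ≤
        -q' r + 2 * m * q r / r - q r ^ 2 / r) ∧ (m ≠ 0 → q ρ = m) ∧ (m = 0 → -α ≤ q ρ) ∧
      Continuous q ∧ (m = 0 → q 0 = 0) := by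
  by_cases hm : m = 0
  -- For `m = 0` no constant works, and the gain comes from the derivative of `q = -κ r²/ρ²`. The
  -- jump condition at `ρ` against `q₂ ρ = -α` forces `κ ≤ α`. Non-integer flux allows `κ = μ_α`,
  -- since `μ_α² ≤ μ_α`; a positive integer flux is at least `1` and allows `κ = 1/2`.
  · obtain ⟨κ, hκα, hκ0, hκ1, hκ⟩ : ∃ κ : ℝ, κ ≤ α ∧ 0 ≤ κ ∧ κ ≤ 1 / 2 ∧
        ∀ r, hardyProfile α ρ r * r ^ 2 ≤ κ * (r ^ 2 / (ρ ^ 2 + r ^ 2)) := by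
      by_cases h : ∃ k : ℤ, (k : ℝ) = α
      · refine ⟨1 / 2, ?_, by norm_num, le_rfl, fun r => ?_⟩
        · obtain ⟨k, rfl⟩ := h
          have : 0 < k := by exact_mod_cast hα
          have : (1 : ℝ) ≤ k := by exact_mod_cast this
          linarith
        · refine (hardyProfile_mul_sq_le_of_int h hρ).trans ?_
          gcongr; norm_num
      · refine ⟨distToInt α, ?_, distToInt_nonneg α, distToInt_le_half α, fun r => ?_⟩
        · simpa [abs_of_pos hα] using distToInt_le α 0
        · rw [hardyProfile_mul_sq_le_of_not_int h]
          gcongr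
          nlinarith [distToInt_nonneg α, distToInt_le_half α]
    refine ⟨fun r => -κ * r ^ 2 / ρ ^ 2, fun r => -κ * (2 * r) / ρ ^ 2, fun r _ => ?_, ?_, ?_,
      fun h => absurd hm h, fun _ => ?_, by fun_prop, fun _ => by simp⟩
    · have := (((hasDerivAt_id r).pow 2).const_mul (-κ)).div_const (ρ ^ 2)
      refine this.congr_deriv ?_
      simp
    · fun_prop
    · intro r hr hrρ
      rw [hm]
      have e : -(-κ * (2 * r) / ρ ^ 2) + 2 * ((0 : ℤ) : ℝ) * (-κ * r ^ 2 / ρ ^ 2) / r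
          - (-κ * r ^ 2 / ρ ^ 2) ^ 2 / r
        = (κ * (r ^ 2 / ρ ^ 2) * (2 - κ * (r ^ 2 / ρ ^ 2))) / r := by
        push_cast; field_simp; ring
      rw [e, le_div_iff₀ hr, mul_assoc, ← pow_two]
      refine (hκ r).trans ?_
      have h1 : r ^ 2 / ρ ^ 2 ≤ 1 := by
        rw [div_le_one (by positivity)]; exact pow_le_pow_left₀ hr.le hrρ 2
      have h2 : r ^ 2 / (ρ ^ 2 + r ^ 2) ≤ r ^ 2 / ρ ^ 2 := by gcongr; nlinarith
      have h3 : 0 ≤ r ^ 2 / ρ ^ 2 := by positivity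
      have h4 : κ * (r ^ 2 / ρ ^ 2) ≤ 1 := by nlinarith
      calc _ ≤ κ * (r ^ 2 / ρ ^ 2) := by gcongr
        _ = κ * (r ^ 2 / ρ ^ 2) * 1 := by ring
        _ ≤ _ := by gcongr; linarith
    · have : -κ * ρ ^ 2 / ρ ^ 2 = -κ := by field_simp
      simp only [this]; linarith
  · refine ⟨fun _ => m, fun _ => 0, fun r _ => hasDerivAt_const _ _, continuousOn_const, ?_,
      fun _ => rfl, fun h => absurd h hm, continuous_const, fun h => absurd h hm⟩
    intro r hr _
    have e : -0 + 2 * (m : ℝ) * m / r - (m : ℝ) ^ 2 / r = (m : ℝ) ^ 2 / r := by ring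
    rw [e, le_div_iff₀ hr, mul_assoc, ← pow_two]
    refine (hardyProfile_mul_sq_le_quarter hρ).trans ?_
    have h2 : (1 : ℤ) ≤ m ^ 2 := by
      have := sq_pos_of_ne_zero hm
      omega
    have h3 : (1 : ℝ) ≤ (m : ℝ) ^ 2 := by exact_mod_cast h2
    linarith

/-- The Hardy inequality for a single angular mode with the weight of the Pauli operator. -/
theorem mode_hardy_hardyProfile {F F' : ℝ → ℂ} {α ρ R₀ M : ℝ} (hρ : 0 < ρ) (hα : 0 ≤ α) (m : ℤ)
    (hF : ∀ r, 0 < r → HasDerivAt F (F' r) r) (hF' : ContinuousOn F' (Ioi 0))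
    (hR : ∀ r, R₀ ≤ r → F r = 0) (hM : ∀ r, 0 < r → ‖F r‖ ≤ M)
    (hzero : m ≠ 0 → Tendsto F (nhdsWithin 0 (Ioi 0)) (nhds 0)) :
    ∫⁻ r in Ioi 0, ENNReal.ofReal (hardyProfile α ρ r * gPlus α ρ r ^ 2 * r * ‖F r‖ ^ 2) ≤
      ∫⁻ r in Ioi 0, ENNReal.ofReal
        (gPlus α ρ r ^ 2 * r * ‖F' r + ((m : ℝ) / r : ℝ) • F r‖ ^ 2) := by
  rcases hα.eq_or_lt with rfl | hα
  -- Zero flux falls in the integer case, where the factor `|α|` kills the profile.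
  · have : ∀ r, hardyProfile 0 ρ r = 0 := fun r => by
      rw [hardyProfile, if_pos ⟨0, by simp⟩]; simp
    simp [this]
  obtain ⟨q₁, q₁', a1, a2, a3, a4, a5, a6, a7⟩ := exists_riccati_inner hρ hα m
  obtain ⟨q₂, q₂', b1, b2, b3, b4, b6⟩ := exists_riccati_outer hρ hα m
  refine mode_hardy hρ hF hF' hR (hardyProfile_continuousOn hρ)
    (fun r _ => hardyProfile_nonneg _ _ _) a1 a2 b1 b2 a3 b3 ?_ ?_
  · by_cases hm : m = 0
    · rw [b6 (by rw [hm]; simpa using hα.ne)]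
      have := a5 hm
      rw [hm]; push_cast; linarith
    · rw [a4 hm]; exact b4
  -- The boundary term at the origin vanishes because of `q₁` when `m = 0` and because of `F`
  -- otherwise.
  · have hq : Tendsto q₁ (nhdsWithin 0 (Ioi 0)) (nhds (q₁ 0)) :=
      (a6.tendsto 0).mono_left nhdsWithin_le_nhds
    by_cases hm : m = 0
    · rw [a7 hm] at hq
      refine hq.zero_mul_isBoundedUnder_le ⟨M ^ 2, ?_⟩
      simp only [eventually_map]
      filter_upwards [self_mem_nhdsWithin] with r hr
      simp only [Function.comp, norm_pow, norm_norm]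
      exact pow_le_pow_left₀ (norm_nonneg _) (hM r hr) 2
    · simpa using hq.mul ((hzero hm).norm.pow 2)

end PauliHardy
end

noncomputable section

namespace PauliHardy

/-! ### Fourier coefficients on the circle -/

/-- The `m`-th Fourier coefficient of a function of the angle. -/
def circleCoeff (v : ℝ → ℂ) (m : ℤ) : ℂ :=
  ((2 * Real.pi)⁻¹ : ℝ) • ∫ θ in (-Real.pi)..Real.pi, Complex.exp (-(m * θ * Complex.I)) * v θ

theorem circleCoeff_eq_fourierCoeffOn (v : ℝ → ℂ) (m : ℤ) :
    circleCoeff v m = fourierCoeffOn (neg_lt_self Real.pi_pos) v m := by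
  rw [fourierCoeffOn_eq_integral, circleCoeff]
  have e : Real.pi - -Real.pi = 2 * Real.pi := by ring
  rw [e, one_div]
  congr 1
  refine intervalIntegral.integral_congr fun θ _ => ?_
  simp only [fourier_coe_apply, smul_eq_mul]
  congr 2
  have := Real.pi_pos.ne'
  push_cast
  field_simp

theorem hasSum_sq_circleCoeff {v : ℝ → ℂ} (hv : Continuous v) :
    HasSum (fun m => ‖circleCoeff v m‖ ^ 2)
      ((2 * Real.pi)⁻¹ * ∫ θ in (-Real.pi)..Real.pi, ‖v θ‖ ^ 2) := by
  have h : MemLp v 2 (volume.restrict (Ioc (-Real.pi) Real.pi)) := by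
    obtain ⟨C, hC⟩ := (isCompact_Icc (a := -Real.pi) (b := Real.pi)).exists_bound_of_continuousOn
      hv.continuousOn
    refine MemLp.of_bound hv.aestronglyMeasurable C ?_
    filter_upwards [self_mem_ae_restrict measurableSet_Ioc] with r hr
    exact hC r (Ioc_subset_Icc_self hr)
  have := hasSum_sq_fourierCoeffOn (neg_lt_self Real.pi_pos) h
  simp_rw [← circleCoeff_eq_fourierCoeffOn] at this
  have e : Real.pi - -Real.pi = 2 * Real.pi := by ring
  rwa [e] at this

/-- Parseval in `ℝ≥0∞`, so that the mode sum and the radial integral can be exchanged by Tonelli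
with no summability to check. -/
theorem tsum_ofReal_circleCoeff {v : ℝ → ℂ} (hv : Continuous v) {c : ℝ} (hc : 0 ≤ c) :
    ∑' m, ENNReal.ofReal (c * ‖circleCoeff v m‖ ^ 2) =
      ENNReal.ofReal (2 * Real.pi)⁻¹ *
        ∫⁻ θ in Ioc (-Real.pi) Real.pi, ENNReal.ofReal (c * ‖v θ‖ ^ 2) := by
  have h := (hasSum_sq_circleCoeff hv).mul_left c
  rw [← ENNReal.ofReal_tsum_of_nonneg (fun m => by positivity) h.summable, h.tsum_eq,
    lintegral_Ioc_ofReal (by linarith [Real.pi_pos]) (by fun_prop) (fun r _ => by positivity),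
    ← ENNReal.ofReal_mul (by have := Real.pi_pos; positivity),
    intervalIntegral.integral_const_mul]
  congr 1; ring

theorem circleCoeff_deriv {v v' : ℝ → ℂ} (hv : ∀ θ, HasDerivAt v (v' θ) θ) (hv' : Continuous v')
    (hper : v (-Real.pi) = v Real.pi) (m : ℤ) :
    circleCoeff v' m = Complex.I * m * circleCoeff v m := by
  have cv : Continuous v := continuous_iff_continuousAt.2 fun θ => (hv θ).continuousAt
  set e : ℝ → ℂ := fun θ => Complex.exp (-(m * θ * Complex.I)) with he
  have de : ∀ θ : ℝ, HasDerivAt e (-(m * Complex.I) * e θ) θ := fun θ => by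
    have h1 : HasDerivAt (fun θ : ℝ => -((m : ℂ) * θ * Complex.I)) (-(m * 1 * Complex.I)) θ :=
      (((Complex.ofRealCLM.hasDerivAt (x := θ)).const_mul (m : ℂ)).mul_const Complex.I).neg
    refine h1.cexp.congr_deriv ?_
    simp only [he]; ring
  have ce : Continuous e := continuous_iff_continuousAt.2 fun θ => (de θ).continuousAt
  have eper : e (-Real.pi) = e Real.pi := by
    simp only [he]
    rw [Complex.exp_eq_exp_iff_exists_int]
    exact ⟨m, by push_cast; ring⟩
  have key := intervalIntegral.integral_mul_deriv_eq_deriv_mul (a := -Real.pi) (b := Real.pi)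
    (fun θ _ => de θ) (fun θ _ => hv θ)
    ((continuous_const.mul ce).intervalIntegrable _ _) (hv'.intervalIntegrable _ _)
  rw [eper, hper, sub_self, zero_sub] at key
  simp only [circleCoeff]
  rw [key, ← intervalIntegral.integral_neg, mul_smul_comm,
    ← intervalIntegral.integral_const_mul]
  congr 1
  refine intervalIntegral.integral_congr fun θ _ => ?_
  simp only [he]; ring

theorem circleCoeff_sub_const_mul {v w : ℝ → ℂ} (hv : Continuous v) (hw : Continuous w) (c : ℂ)
    (m : ℤ) : circleCoeff (fun θ => v θ - c * w θ) m = circleCoeff v m - c * circleCoeff w m := by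
  simp only [circleCoeff]
  rw [mul_smul_comm, ← smul_sub, ← intervalIntegral.integral_const_mul,
    ← intervalIntegral.integral_sub]
  · congr 1
    refine intervalIntegral.integral_congr fun θ _ => ?_
    ring
  · exact Continuous.intervalIntegrable (by fun_prop) _ _
  · exact Continuous.intervalIntegrable (by fun_prop) _ _

theorem norm_circleCoeff_le {v : ℝ → ℂ} {M : ℝ} (hM : ∀ θ, ‖v θ‖ ≤ M) (m : ℤ) :
    ‖circleCoeff v m‖ ≤ M := by
  have h := intervalIntegral.norm_integral_le_of_norm_le_const (a := -Real.pi) (b := Real.pi)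
    (f := fun θ : ℝ => Complex.exp (-(m * θ * Complex.I)) * v θ) (C := M) fun θ _ => by
      rw [norm_mul, Complex.norm_exp]
      simpa using hM θ
  have hpi := Real.pi_pos
  rw [circleCoeff, norm_smul, Real.norm_of_nonneg (by positivity)]
  rw [show Real.pi - -Real.pi = 2 * Real.pi by ring, abs_of_pos (by positivity)] at h
  calc _ ≤ (2 * Real.pi)⁻¹ * (M * (2 * Real.pi)) := by gcongr
    _ = M := by field_simp

/-! ### Polar coordinates in the plane -/

/-- The point with polar coordinates `(r, θ)`. -/
def polarPt (r θ : ℝ) : Plane := !₂[r * Real.cos θ, r * Real.sin θ]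

theorem continuous_polarPt : Continuous fun p : ℝ × ℝ => polarPt p.1 p.2 := by
  unfold polarPt
  refine (PiLp.continuous_toLp 2 _).comp (continuous_pi fun i => ?_)
  fin_cases i <;> simp <;> fun_prop

theorem norm_polarPt (r θ : ℝ) : ‖polarPt r θ‖ = |r| := by
  rw [EuclideanSpace.norm_eq, ← Real.sqrt_sq_eq_abs]
  congr 1
  simp [polarPt, Fin.sum_univ_two]
  linear_combination r ^ 2 * Real.cos_sq_add_sin_sq θ

theorem polarPt_eq (r θ : ℝ) : polarPt r θ =
    (r * Real.cos θ) • EuclideanSpace.single 0 1 + (r * Real.sin θ) • EuclideanSpace.single 1 1 := by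
  ext i; fin_cases i <;> simp [polarPt]

theorem hasDerivAt_polarPt_radius (r θ : ℝ) :
    HasDerivAt (fun r => polarPt r θ) (polarPt 1 θ) r := by
  simp_rw [polarPt_eq]
  exact (((hasDerivAt_id r).mul_const _).smul_const _).add
    (((hasDerivAt_id r).mul_const _).smul_const _)

theorem hasDerivAt_polarPt_angle (r θ : ℝ) :
    HasDerivAt (fun θ => polarPt r θ) ((-(r * Real.sin θ)) • EuclideanSpace.single 0 1 +
      (r * Real.cos θ) • EuclideanSpace.single 1 1) θ := by
  simp_rw [polarPt_eq]
  refine (((Real.hasDerivAt_cos θ).const_mul r).smul_const _).add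
    (((Real.hasDerivAt_sin θ).const_mul r).smul_const _) |>.congr_deriv ?_
  simp

theorem lintegral_polarPt {F : Plane → ℝ≥0∞} (hF : Measurable F) :
    ∫⁻ x, F x = ∫⁻ r in Ioi 0, ∫⁻ θ in Ioc (-Real.pi) Real.pi,
      ENNReal.ofReal r * F (polarPt r θ) := by
  have h1 := (Complex.orthonormalBasisOneI.measurePreserving_repr).lintegral_comp_emb
    (Complex.orthonormalBasisOneI.repr.toHomeomorph.measurableEmbedding) F
  rw [← h1, ← Complex.lintegral_comp_polarCoord_symm, polarCoord_target]
  have hm : Measurable fun p : ℝ × ℝ => ENNReal.ofReal p.1 * F (polarPt p.1 p.2) :=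
    (ENNReal.measurable_ofReal.comp measurable_fst).mul (hF.comp continuous_polarPt.measurable)
  have h2 : ∀ p : ℝ × ℝ, ENNReal.ofReal p.1 • F (Complex.orthonormalBasisOneI.repr
      (Complex.polarCoord.symm p)) = ENNReal.ofReal p.1 * F (polarPt p.1 p.2) := by
    intro p
    rw [smul_eq_mul]
    congr 2
  simp_rw [h2]
  rw [Measure.volume_eq_prod, setLIntegral_prod _ hm.aemeasurable]
  refine lintegral_congr fun r => ?_
  rw [restrict_Ioo_eq_restrict_Ioc]

end PauliHardy
end

/-! ### The weighted Hardy inequality for `∂₁ - i∂₂`, mode by mode -/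

noncomputable section

namespace PauliHardy

/-- The first-order operator `∂₁ - i ∂₂`. -/
def dz (f : Plane → ℂ) (x : Plane) : ℂ :=
  fderiv ℝ f x (EuclideanSpace.single 0 1) - Complex.I * fderiv ℝ f x (EuclideanSpace.single 1 1)

/-- The identity `e^{iθ}(∂₁ - i∂₂) = ∂_r - (i/r)∂_θ`, whose phase drops out of the norm. -/
theorem norm_dz_polarPt (f : Plane → ℂ) {r : ℝ} (hr : 0 < r) (θ : ℝ) :
    ‖fderiv ℝ f (polarPt r θ) (polarPt 1 θ) - Complex.I / r *
      fderiv ℝ f (polarPt r θ) ((-(r * Real.sin θ)) • EuclideanSpace.single 0 1 +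
      (r * Real.cos θ) • EuclideanSpace.single 1 1)‖ = ‖dz f (polarPt r θ)‖ := by
  set L := fderiv ℝ f (polarPt r θ)
  have hr' : (r : ℂ) ≠ 0 := by exact_mod_cast hr.ne'
  have : L (polarPt 1 θ) - Complex.I / r * L ((-(r * Real.sin θ)) • EuclideanSpace.single 0 1 +
      (r * Real.cos θ) • EuclideanSpace.single 1 1)
      = Complex.exp (θ * Complex.I) * dz f (polarPt r θ) := by
    rw [polarPt_eq, map_add, map_add, map_smul, map_smul, map_smul, map_smul, dz,
      Complex.exp_mul_I]
    simp only [Complex.real_smul]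
    push_cast
    field_simp
    ring_nf
    simp only [Complex.I_sq]
    ring
  rw [this, norm_mul, Complex.norm_exp_ofReal_mul_I, one_mul]

variable {f : Plane → ℂ}

theorem continuous_dz (hf : ContDiff ℝ 1 f) : Continuous (dz f) := by
  have := hf.continuous_fderiv one_ne_zero
  unfold dz
  fun_prop

/-- The angular Fourier coefficients of a function on the plane. -/
def angularMode (f : Plane → ℂ) (m : ℤ) (r : ℝ) : ℂ := circleCoeff (fun θ => f (polarPt r θ)) m

/-- The angular Fourier coefficients of the radial derivative. -/
def angularModeDeriv (f : Plane → ℂ) (m : ℤ) (r : ℝ) : ℂ :=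
  circleCoeff (fun θ => fderiv ℝ f (polarPt r θ) (polarPt 1 θ)) m

theorem continuous_circleCoeff {v : ℝ → ℝ → ℂ} (hv : Continuous fun p : ℝ × ℝ => v p.1 p.2)
    (m : ℤ) : Continuous fun r => circleCoeff (v r) m := by
  unfold circleCoeff
  refine Continuous.fun_const_smul ?_ _
  refine intervalIntegral.continuous_parametric_intervalIntegral_of_continuous' ?_ _ _
  have : Continuous fun p : ℝ × ℝ => Complex.exp (-(m * p.2 * Complex.I)) := by fun_prop
  exact this.mul hv

theorem continuous_comp_polarPt {E : Type*} [TopologicalSpace E] {g : Plane → E}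
    (hg : Continuous g) (r : ℝ) : Continuous fun θ => g (polarPt r θ) :=
  hg.comp (continuous_polarPt.comp (Continuous.prodMk_right r))

theorem continuous_radialDeriv (hf : ContDiff ℝ 1 f) :
    Continuous fun p : ℝ × ℝ => fderiv ℝ f (polarPt p.1 p.2) (polarPt 1 p.2) :=
  ((hf.continuous_fderiv one_ne_zero).comp continuous_polarPt).clm_apply
    (continuous_polarPt.comp (by fun_prop : Continuous fun p : ℝ × ℝ => ((1 : ℝ), p.2)))

theorem hasDerivAt_angularMode (hf : ContDiff ℝ 1 f) (hc : HasCompactSupport f) (m : ℤ) (r : ℝ) :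
    HasDerivAt (angularMode f m) (angularModeDeriv f m r) r := by
  obtain ⟨M, hM⟩ := (hc.fderiv (𝕜 := ℝ)).exists_bound_of_continuous
    (hf.continuous_fderiv one_ne_zero)
  have ce : Continuous fun θ : ℝ => Complex.exp (-(m * θ * Complex.I)) := by fun_prop
  unfold angularMode angularModeDeriv circleCoeff
  refine HasDerivAt.fun_const_smul _ ?_
  refine (intervalIntegral.hasDerivAt_integral_of_dominated_loc_of_deriv_le (s := univ)
    (bound := fun _ => M)
    (F' := fun r θ => Complex.exp (-(m * θ * Complex.I)) *
      fderiv ℝ f (polarPt r θ) (polarPt 1 θ)) univ_mem ?_ ?_ ?_ ?_ ?_ ?_).2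
  · exact Eventually.of_forall fun r =>
      (ce.mul (continuous_comp_polarPt hf.continuous r)).aestronglyMeasurable
  · exact (ce.mul (continuous_comp_polarPt hf.continuous r)).intervalIntegrable _ _
  · exact (ce.mul ((continuous_radialDeriv hf).comp
      (Continuous.prodMk_right r))).aestronglyMeasurable
  · refine Eventually.of_forall fun θ _ r _ => ?_
    rw [norm_mul, Complex.norm_exp]
    have := (fderiv ℝ f (polarPt r θ)).le_opNorm (polarPt 1 θ)
    rw [norm_polarPt, abs_one, mul_one] at this
    simpa using this.trans (hM _)
  · exact _root_.intervalIntegrable_const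
  · refine Eventually.of_forall fun θ _ r _ => ?_
    have := ((hf.differentiable one_ne_zero).differentiableAt
      (x := polarPt r θ)).hasFDerivAt.comp_hasDerivAt r (hasDerivAt_polarPt_radius r θ)
    exact this.const_mul _

theorem circleCoeff_const {m : ℤ} (hm : m ≠ 0) (c : ℂ) : circleCoeff (fun _ => c) m = 0 := by
  have := circleCoeff_deriv (v := fun _ => c) (v' := fun _ => 0) (fun θ => hasDerivAt_const θ c)
    continuous_const rfl m
  have h0 : circleCoeff (fun _ => 0) m = 0 := by simp [circleCoeff]
  rw [h0, eq_comm] at this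
  simpa [hm] using this

/-- The circle of radius `0` is a single point, and a constant has no nonzero modes. -/
theorem tendsto_angularMode_zero (hf : ContDiff ℝ 1 f) {m : ℤ} (hm : m ≠ 0) :
    Tendsto (angularMode f m) (nhdsWithin 0 (Ioi 0)) (nhds 0) := by
  have h := (continuous_circleCoeff (v := fun r θ => f (polarPt r θ))
    (hf.continuous.comp continuous_polarPt) m).tendsto 0
  have e : circleCoeff (fun θ => f (polarPt 0 θ)) m = 0 := by
    have : ∀ θ, polarPt 0 θ = 0 := fun θ => by simp [polarPt_eq]
    simp_rw [this]
    exact circleCoeff_const hm _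
  rw [e] at h
  exact h.mono_left nhdsWithin_le_nhds

theorem circleCoeff_dz (hf : ContDiff ℝ 1 f) (m : ℤ) (r : ℝ) :
    circleCoeff (fun θ => fderiv ℝ f (polarPt r θ) (polarPt 1 θ) - Complex.I / r *
      fderiv ℝ f (polarPt r θ) ((-(r * Real.sin θ)) • EuclideanSpace.single 0 1 +
      (r * Real.cos θ) • EuclideanSpace.single 1 1)) m =
      angularModeDeriv f m r + ((m : ℝ) / r : ℝ) • angularMode f m r := by
  have cang : Continuous fun θ => fderiv ℝ f (polarPt r θ)
      ((-(r * Real.sin θ)) • EuclideanSpace.single 0 1 +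
      (r * Real.cos θ) • EuclideanSpace.single 1 1) :=
    (continuous_comp_polarPt (hf.continuous_fderiv one_ne_zero) r).clm_apply (by fun_prop)
  have crad : Continuous fun θ => fderiv ℝ f (polarPt r θ) (polarPt 1 θ) :=
    (continuous_radialDeriv hf).comp (Continuous.prodMk_right r)
  rw [circleCoeff_sub_const_mul crad cang,
    circleCoeff_deriv (v := fun θ => f (polarPt r θ)) _ cang]
  · simp only [angularMode, angularModeDeriv, Complex.real_smul]
    push_cast
    linear_combination (-(m : ℂ) / r * circleCoeff (fun θ => f (polarPt r θ)) m) * Complex.I_sq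
  · simp [polarPt_eq]
  · exact fun θ => ((hf.differentiable one_ne_zero).differentiableAt
      (x := polarPt r θ)).hasFDerivAt.comp_hasDerivAt θ (hasDerivAt_polarPt_angle r θ)

theorem gPlus_measurable (α ρ : ℝ) : Measurable (gPlus α ρ) := by
  unfold gPlus
  exact Measurable.ite measurableSet_Iic measurable_const (by fun_prop)

/-- Hardy inequality for `∂₁ - i ∂₂` with the radial weight `g₊²`. -/
theorem lintegral_hardyProfile_le_dz (hf : ContDiff ℝ 1 f) (hc : HasCompactSupport f) {α ρ : ℝ}
    (hρ : 0 < ρ) (hα : 0 ≤ α) :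
    ∫⁻ x, ENNReal.ofReal (hardyProfile α ρ ‖x‖ * gPlus α ρ ‖x‖ ^ 2 * ‖f x‖ ^ 2) ≤
      ∫⁻ x, ENNReal.ofReal (gPlus α ρ ‖x‖ ^ 2 * ‖dz f x‖ ^ 2) := by
  have hgm := gPlus_measurable α ρ
  have hhm := hardyProfile_measurable α ρ
  have hfm := hf.continuous.measurable
  have hdm := (continuous_dz hf).measurable
  rw [lintegral_polarPt (by fun_prop), lintegral_polarPt (by fun_prop)]
  have e1 : ∀ r ∈ Ioi (0 : ℝ), ∫⁻ θ in Ioc (-Real.pi) Real.pi, ENNReal.ofReal r * ENNReal.ofReal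
      (hardyProfile α ρ ‖polarPt r θ‖ * gPlus α ρ ‖polarPt r θ‖ ^ 2 * ‖f (polarPt r θ)‖ ^ 2)
      = ENNReal.ofReal (2 * Real.pi) * ∑' m : ℤ, ENNReal.ofReal
        (hardyProfile α ρ r * gPlus α ρ r ^ 2 * r * ‖angularMode f m r‖ ^ 2) := by
    intro r hr
    have hr' : 0 < r := hr
    have hh := hardyProfile_nonneg α ρ r
    unfold angularMode
    rw [tsum_ofReal_circleCoeff (continuous_comp_polarPt hf.continuous r) (by positivity),
      ← mul_assoc, ← ENNReal.ofReal_mul (by positivity),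
      mul_inv_cancel₀ (by positivity), ENNReal.ofReal_one, one_mul]
    refine lintegral_congr fun θ => ?_
    rw [← ENNReal.ofReal_mul hr'.le, norm_polarPt, abs_of_pos hr']
    congr 1; ring
  have e2 : ∀ r ∈ Ioi (0 : ℝ), ∫⁻ θ in Ioc (-Real.pi) Real.pi, ENNReal.ofReal r * ENNReal.ofReal
      (gPlus α ρ ‖polarPt r θ‖ ^ 2 * ‖dz f (polarPt r θ)‖ ^ 2)
      = ENNReal.ofReal (2 * Real.pi) * ∑' m : ℤ, ENNReal.ofReal
        (gPlus α ρ r ^ 2 * r * ‖angularModeDeriv f m r + ((m : ℝ) / r : ℝ) •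
          angularMode f m r‖ ^ 2) := by
    intro r hr
    have hr' : 0 < r := hr
    have cv : Continuous fun θ => fderiv ℝ f (polarPt r θ) (polarPt 1 θ) - Complex.I / r *
      fderiv ℝ f (polarPt r θ) ((-(r * Real.sin θ)) • EuclideanSpace.single 0 1 +
      (r * Real.cos θ) • EuclideanSpace.single 1 1) :=
      ((continuous_radialDeriv hf).comp (Continuous.prodMk_right r)).sub (continuous_const.mul
        ((continuous_comp_polarPt (hf.continuous_fderiv one_ne_zero) r).clm_apply (by fun_prop)))
    simp_rw [← circleCoeff_dz hf _ r]
    rw [tsum_ofReal_circleCoeff cv (by positivity),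
      ← mul_assoc, ← ENNReal.ofReal_mul (by positivity),
      mul_inv_cancel₀ (by positivity), ENNReal.ofReal_one, one_mul]
    refine lintegral_congr fun θ => ?_
    rw [← ENNReal.ofReal_mul hr'.le, norm_polarPt, abs_of_pos hr', norm_dz_polarPt f hr']
    congr 1; ring
  have cF : ∀ m, Continuous (angularMode f m) := fun m =>
    continuous_circleCoeff (v := fun r θ => f (polarPt r θ))
      (hf.continuous.comp continuous_polarPt) m
  have cF' : ∀ m, Continuous (angularModeDeriv f m) := fun m =>
    continuous_circleCoeff (v := fun r θ => fderiv ℝ f (polarPt r θ) (polarPt 1 θ))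
      (continuous_radialDeriv hf) m
  rw [setLIntegral_congr_fun measurableSet_Ioi e1, setLIntegral_congr_fun measurableSet_Ioi e2,
    lintegral_const_mul' _ _ ENNReal.ofReal_ne_top, lintegral_const_mul' _ _ ENNReal.ofReal_ne_top]
  have m1 := fun m => (cF m).measurable
  have m2 := fun m => (cF' m).measurable
  rw [lintegral_tsum (fun m => by have := m1 m; fun_prop),
    lintegral_tsum (fun m => by have := m1 m; have := m2 m; fun_prop)]
  refine mul_le_mul' le_rfl (ENNReal.tsum_le_tsum fun m => ?_)
  obtain ⟨M, hM⟩ := hc.exists_bound_of_continuous hf.continuous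
  obtain ⟨R₀, hR₀⟩ := hc.isCompact.isBounded.subset_closedBall (0 : Plane)
  refine mode_hardy_hardyProfile (R₀ := max R₀ 0 + 1) (M := M) hρ hα m
    (fun r _ => hasDerivAt_angularMode hf hc m r) (cF' m).continuousOn (fun r hr => ?_)
    (fun r _ => norm_circleCoeff_le (fun θ => hM _) m) (fun hm => tendsto_angularMode_zero hf hm)
  have : ∀ θ, f (polarPt r θ) = 0 := fun θ => by
    refine image_eq_zero_of_notMem_tsupport fun h => ?_
    have := hR₀ h
    rw [mem_closedBall_zero_iff, norm_polarPt] at this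
    linarith [le_abs_self r, le_max_left R₀ 0]
  simp [angularMode, this, circleCoeff]

end PauliHardy
end

/-! ### Factorisation of the form and the complex potential of a smooth field -/

noncomputable section

namespace PauliHardy

/-- The classical partial derivative of a function with values in a normed space. -/
def pd {F : Type*} [NormedAddCommGroup F] [NormedSpace ℝ F] (j : Fin 2) (u : Plane → F)
    (x : Plane) : F := fderiv ℝ u x (EuclideanSpace.single j 1)

theorem two_le_infty : (2 : ℕ∞ω) ≤ ((⊤ : ℕ∞) : ℕ∞ω) := WithTop.coe_le_coe.2 le_top

theorem one_le_infty : (1 : ℕ∞ω) ≤ ((⊤ : ℕ∞) : ℕ∞ω) := WithTop.coe_le_coe.2 le_top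

section pd

variable {F : Type*} [NormedAddCommGroup F] [NormedSpace ℝ F]

theorem partialDeriv_eq_pd (j : Fin 2) (φ : Plane → ℝ) : partialDeriv j φ = pd j φ := rfl

theorem dz_eq_pd (f : Plane → ℂ) (x : Plane) : dz f x = pd 0 f x - Complex.I * pd 1 f x := rfl

theorem contDiff_pd {u : Plane → F} (hu : ContDiff ℝ ∞ u) (j : Fin 2) : ContDiff ℝ ∞ (pd j u) := by
  unfold pd
  exact (hu.fderiv_right (m := ∞) (by simp)).clm_apply contDiff_const

theorem hasCompactSupport_pd {u : Plane → F} (hc : HasCompactSupport u) (j : Fin 2) :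
    HasCompactSupport (pd j u) :=
  (hc.fderiv (𝕜 := ℝ)).comp_left (g := fun L : Plane →L[ℝ] F => L (EuclideanSpace.single j 1))
    (by simp)

theorem pd_comm {u : Plane → F} (hu : ContDiff ℝ ∞ u) (i j : Fin 2) (x : Plane) :
    pd i (pd j u) x = pd j (pd i u) x := by
  have hd : DifferentiableAt ℝ (fderiv ℝ u) x :=
    (hu.fderiv_right (m := ∞) (by simp)).differentiable (by simp) |>.differentiableAt
  have e : ∀ k l : Fin 2, pd k (pd l u) x = fderiv ℝ (fderiv ℝ u) x (EuclideanSpace.single k 1)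
      (EuclideanSpace.single l 1) := by
    intro k l
    unfold pd
    rw [fderiv_clm_apply hd (differentiableAt_const _)]
    simp
  rw [e, e]
  exact (hu.contDiffAt.isSymmSndFDerivAt (by
    rw [minSmoothness_of_isRCLikeNormedField]; exact two_le_infty)) _ _

theorem fderiv_apply_eq_pd (u : Plane → F) (x v : Plane) :
    fderiv ℝ u x v = v 0 • pd 0 u x + v 1 • pd 1 u x := by
  have : v = v 0 • EuclideanSpace.single 0 1 + v 1 • EuclideanSpace.single 1 1 := by
    ext i; fin_cases i <;> simp
  conv_lhs => rw [this]
  simp [pd]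

theorem pd_add {u v : Plane → F} (hu : Differentiable ℝ u) (hv : Differentiable ℝ v) (j : Fin 2)
    (x : Plane) : pd j (fun y => u y + v y) x = pd j u x + pd j v x := by
  unfold pd
  rw [fderiv_fun_add (hu x) (hv x)]; rfl

theorem pd_sub {u v : Plane → F} (hu : Differentiable ℝ u) (hv : Differentiable ℝ v) (j : Fin 2)
    (x : Plane) : pd j (fun y => u y - v y) x = pd j u x - pd j v x := by
  unfold pd
  rw [fderiv_fun_sub (hu x) (hv x)]; rfl

end pd

theorem pd_conj (u : Plane → ℂ) (j : Fin 2) (x : Plane) :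
    pd j (fun y => (starRingEnd ℂ) (u y)) x = (starRingEnd ℂ) (pd j u x) := by
  unfold pd
  have : (fun y => (starRingEnd ℂ) (u y)) = Complex.conjCLE ∘ u := by ext; simp
  rw [this, ContinuousLinearEquiv.comp_fderiv]
  simp

theorem pd_norm_sq {u : Plane → ℂ} {x : Plane} (hu : DifferentiableAt ℝ u x) (j : Fin 2) :
    pd j (fun y => ‖u y‖ ^ 2) x = 2 * ((starRingEnd ℂ) (u x) * pd j u x).re := by
  unfold pd
  rw [hu.hasFDerivAt.norm_sq.fderiv]
  simp [Complex.inner]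
  ring

/-- Expansion of `|(π₁ - i π₂) u|²`. -/
theorem norm_sq_dz_sub (u : Plane → ℂ) {x : Plane} (hu : DifferentiableAt ℝ u x) (a : Plane) :
    ‖dz u x - Complex.I * (a 0 - Complex.I * a 1) * u x‖ ^ 2 =
      (∑ j, ‖Complex.I * pd j u x + (a j : ℂ) * u x‖ ^ 2) +
        (a 0 * pd 1 (fun y => ‖u y‖ ^ 2) x - a 1 * pd 0 (fun y => ‖u y‖ ^ 2) x) +
        2 * ((starRingEnd ℂ) (pd 0 u x) * pd 1 u x).im := by
  rw [pd_norm_sq hu, pd_norm_sq hu, dz_eq_pd]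
  simp only [Fin.sum_univ_two, ← Complex.normSq_eq_norm_sq, Complex.normSq_apply]
  simp
  ring

/-- Two integrations by parts and the symmetry of second derivatives show that the complex integral
equals its own conjugate. -/
theorem integral_im_conj_pd_mul_pd {u : Plane → ℂ} (hu : ContDiff ℝ ∞ u)
    (hc : HasCompactSupport u) :
    ∫ x, ((starRingEnd ℂ) (pd 0 u x) * pd 1 u x).im = 0 := by
  set v : Plane → ℂ := fun y => (starRingEnd ℂ) (u y) with hv
  have sv : ContDiff ℝ ∞ v := Complex.conjCLE.contDiff.comp hu
  have cv : HasCompactSupport v := hc.comp_left (g := starRingEnd ℂ) (by simp)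
  have ibp : ∀ (p q : Plane → ℂ), ContDiff ℝ ∞ p → ContDiff ℝ ∞ q → HasCompactSupport p →
      ∀ j, ∫ x, p x * pd j q x = - ∫ x, pd j p x * q x := by
    intro p q hp hq hpc j
    refine integral_mul_fderiv_eq_neg_fderiv_mul_of_integrable ?_ ?_ ?_
      (fun x _ => hp.differentiable (by simp) |>.differentiableAt)
      (fun x _ => hq.differentiable (by simp) |>.differentiableAt)
    · exact ((contDiff_pd hp j).continuous.mul hq.continuous).integrable_of_hasCompactSupport
        (hasCompactSupport_pd hpc j).mul_right
    · exact (hp.continuous.mul (contDiff_pd hq j).continuous).integrable_of_hasCompactSupport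
        hpc.mul_right
    · exact (hp.continuous.mul hq.continuous).integrable_of_hasCompactSupport hpc.mul_right
  have e1 : ∫ x, pd 0 v x * pd 1 u x = ∫ x, pd 1 v x * pd 0 u x := by
    have h1 := ibp v (pd 1 u) sv (contDiff_pd hu 1) cv 0
    have h2 := ibp v (pd 0 u) sv (contDiff_pd hu 0) cv 1
    simp_rw [pd_comm hu 0 1] at h1
    rw [h1] at h2
    exact neg_injective h2
  simp_rw [hv, pd_conj] at e1
  have hint : Integrable fun x => (starRingEnd ℂ) (pd 0 u x) * pd 1 u x :=
    ((Complex.continuous_conj.comp (contDiff_pd hu 0).continuous).mul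
      (contDiff_pd hu 1).continuous).integrable_of_hasCompactSupport
        ((hasCompactSupport_pd hc 1).mul_left)
  have e2 := integral_im hint
  simp only [RCLike.im_to_complex] at e2
  rw [e2, ← Complex.conj_eq_iff_im, ← integral_conj, e1]
  refine integral_congr_ae (Eventually.of_forall fun x => ?_)
  simp [mul_comm]

/-- A complex potential whose real part is a prescribed superpotential. -/
theorem exists_complex_potential {a : Plane → Plane} {h : Plane → ℝ}
    (ha : ∀ j, ContDiff ℝ ∞ fun x => a x j) (hh : ContDiff ℝ ∞ h)
    (hcurl : ∀ x, pd 0 (fun y => a y 1) x - pd 1 (fun y => a y 0) x +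
      (pd 0 (pd 0 h) x + pd 1 (pd 1 h) x) = 0) :
    ∃ Ψ : Plane → ℂ, ContDiff ℝ 1 Ψ ∧ (∀ x, (Ψ x).re = h x) ∧
      ∀ x, dz Ψ x = -Complex.I * (a x 0 - Complex.I * a x 1) := by
  -- For `Ψ = h - iχ` the required equation says `∂₁χ = c` and `∂₂χ = d`. The form `c dx₁ + d dx₂`
  -- is closed precisely because `curl a = -Δh`.
  set c : Plane → ℝ := fun x => a x 0 - pd 1 h x with hc
  set d : Plane → ℝ := fun x => a x 1 + pd 0 h x with hd
  have sc : ContDiff ℝ ∞ c := (ha 0).sub (contDiff_pd hh 1)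
  have sd : ContDiff ℝ ∞ d := (ha 1).add (contDiff_pd hh 0)
  have dc : Differentiable ℝ c := sc.differentiable (by simp)
  have dd : Differentiable ℝ d := sd.differentiable (by simp)
  have hclosed : ∀ x, pd 1 c x = pd 0 d x := by
    intro x
    have e1 : pd 1 c x = pd 1 (fun y => a y 0) x - pd 1 (pd 1 h) x :=
      pd_sub ((ha 0).differentiable (by simp)) ((contDiff_pd hh 1).differentiable (by simp)) 1 x
    have e2 : pd 0 d x = pd 0 (fun y => a y 1) x + pd 0 (pd 0 h) x :=
      pd_add ((ha 1).differentiable (by simp)) ((contDiff_pd hh 0).differentiable (by simp)) 0 x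
    rw [e1, e2]
    linarith [hcurl x]
  set P : Fin 2 → Plane →L[ℝ] ℝ := fun j => EuclideanSpace.proj j
  set η : Plane → Plane →L[ℝ] ℝ := fun x => c x • P 0 + d x • P 1 with hη
  have sη : ContDiff ℝ ∞ η := (sc.smul contDiff_const).add (sd.smul contDiff_const)
  have dη : ∀ x, fderiv ℝ η x = (fderiv ℝ c x).smulRight (P 0) + (fderiv ℝ d x).smulRight (P 1) :=
    fun x => (((dc x).hasFDerivAt.smul_const (P 0)).add ((dd x).hasFDerivAt.smul_const (P 1))).fderiv
  obtain ⟨χ, hχ⟩ : ∃ χ : Plane → ℝ, ∀ x ∈ univ, HasFDerivAt χ (η x) x := by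
    refine convex_univ.exists_forall_hasFDerivAt_of_fderiv_symmetric isOpen_univ
      (sη.differentiable (by simp)).differentiableOn fun x _ v w => ?_
    rw [dη]
    simp only [add_apply, ContinuousLinearMap.smulRight_apply,
      smul_apply, fderiv_apply_eq_pd, smul_eq_mul, hclosed, P,
      PiLp.proj_apply]
    ring
  have dχ : Differentiable ℝ χ := fun x => (hχ x trivial).differentiableAt
  have fχ : fderiv ℝ χ = η := by ext1 x; exact (hχ x trivial).fderiv
  have sχ : ContDiff ℝ 1 χ := contDiff_one_iff_fderiv.2 ⟨dχ, fχ ▸ sη.continuous⟩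
  refine ⟨fun x => (h x : ℂ) - Complex.I * χ x, ?_, fun x => by simp, fun x => ?_⟩
  · exact (Complex.ofRealCLM.contDiff.comp (hh.of_le one_le_infty)).sub
      (contDiff_const.mul (Complex.ofRealCLM.contDiff.comp sχ))
  · have dh : HasFDerivAt h (fderiv ℝ h x) x :=
      (hh.differentiable (by simp)).differentiableAt.hasFDerivAt
    have dH : HasFDerivAt (fun y => (h y : ℂ)) (Complex.ofRealCLM ∘L fderiv ℝ h x) x :=
      Complex.ofRealCLM.hasFDerivAt.comp x dh
    have dX : HasFDerivAt (fun y => (χ y : ℂ)) (Complex.ofRealCLM ∘L η x) x :=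
      Complex.ofRealCLM.hasFDerivAt.comp x (hχ x trivial)
    have := dH.fun_sub (dX.const_mul Complex.I)
    rw [dz, this.fderiv]
    have e0 : η x (EuclideanSpace.single 0 1) = a x 0 - pd 1 h x := by
      simp [hη, hc, P]
    have e1 : η x (EuclideanSpace.single 1 1) = a x 1 + pd 0 h x := by
      simp [hη, hd, P]
    simp only [sub_apply, smul_apply,
      ContinuousLinearMap.comp_apply, e0, e1, Complex.ofRealCLM_apply, smul_eq_mul]
    change ((pd 0 h x : ℝ) : ℂ) - _ - Complex.I * (((pd 1 h x : ℝ) : ℂ) - _) = _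
    push_cast
    ring_nf
    simp only [Complex.I_sq]
    ring

end PauliHardy
end

/-! ### Ground state representation for smooth fields -/

noncomputable section

namespace PauliHardy

/-- A bounded weight makes the left side of the Hardy inequality continuous in `L²`, which the
passage to `H¹` relies on. -/
theorem hardyProfile_le {α ρ r : ℝ} (hρ : 0 < ρ) : hardyProfile α ρ r ≤ 1 / ρ ^ 2 := by
  unfold hardyProfile
  split_ifs
  · have h1 : |α| / (4 * |α| + Real.pi) ≤ 1 := by
      have := Real.pi_pos
      rw [div_le_one (by positivity)]
      nlinarith [abs_nonneg α]
    calc _ ≤ 1 * (1 / ρ ^ 2) := by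
          gcongr
          nlinarith [mul_nonneg (sq_nonneg r) (sq_nonneg (Real.log (r / ρ))), sq_nonneg r]
      _ = _ := one_mul _
  · have := distToInt_le_half α
    have := distToInt_nonneg α
    gcongr
    · nlinarith
    · nlinarith [sq_nonneg r]

theorem integrable_hardyProfile_mul {α ρ : ℝ} (hρ : 0 < ρ) {φ : Plane → ℝ} (hφ : Integrable φ) :
    Integrable fun x => hardyProfile α ρ ‖x‖ * φ x := by
  refine hφ.bdd_mul (c := 1 / ρ ^ 2) ?_ ?_
  · exact ((hardyProfile_measurable α ρ).comp measurable_norm).aestronglyMeasurable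
  · refine Eventually.of_forall fun x => ?_
    rw [Real.norm_of_nonneg (hardyProfile_nonneg _ _ _)]
    exact hardyProfile_le hρ

/-- The density of the quadratic form of `(i∇ + a)² + curl a`, the curl being tested against
`|u|²`. -/
def formDensity (a : Plane → Plane) (u : Plane → ℂ) (x : Plane) : ℝ :=
  (∑ j, ‖Complex.I * pd j u x + (a x j : ℂ) * u x‖ ^ 2) +
    (a x 0 * pd 1 (fun y => ‖u y‖ ^ 2) x - a x 1 * pd 0 (fun y => ‖u y‖ ^ 2) x)

theorem hasCompactSupport_norm_sq {u : Plane → ℂ} (hc : HasCompactSupport u) :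
    HasCompactSupport fun x => ‖u x‖ ^ 2 :=
  hc.comp_left (g := fun z : ℂ => ‖z‖ ^ 2) (by simp)

theorem integrable_norm_sq {u : Plane → ℂ} (hu : Continuous u) (hc : HasCompactSupport u) :
    Integrable fun x => ‖u x‖ ^ 2 :=
  (hu.norm.pow 2).integrable_of_hasCompactSupport (hasCompactSupport_norm_sq hc)

theorem norm_sq_dz_sub_le {a : Plane} {C : ℝ} (ha : ‖a‖ ≤ C) (u : Plane → ℂ) (x : Plane) :
    ‖dz u x - Complex.I * (a 0 - Complex.I * a 1) * u x‖ ^ 2 ≤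
      (‖pd 0 u x‖ + ‖pd 1 u x‖ + 2 * C * ‖u x‖) ^ 2 := by
  refine pow_le_pow_left₀ (norm_nonneg _) ?_ 2
  have a0 : |a 0| ≤ C := (PiLp.norm_apply_le a 0).trans ha
  have a1 : |a 1| ≤ C := (PiLp.norm_apply_le a 1).trans ha
  refine (norm_sub_le _ _).trans (add_le_add ?_ ?_)
  · rw [dz_eq_pd]
    refine (norm_sub_le _ _).trans ?_
    simp
  · rw [norm_mul, norm_mul, Complex.norm_I, one_mul]
    refine mul_le_mul_of_nonneg_right ((norm_sub_le _ _).trans ?_) (norm_nonneg _)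
    rw [norm_mul, Complex.norm_I, one_mul, Complex.norm_real, Complex.norm_real]
    simp only [Real.norm_eq_abs]
    linarith

theorem integrable_dz_sub_majorant (C : ℝ) {u : Plane → ℂ} (hu : ContDiff ℝ ∞ u)
    (hc : HasCompactSupport u) :
    Integrable fun x => (‖pd 0 u x‖ + ‖pd 1 u x‖ + 2 * C * ‖u x‖) ^ 2 := by
  have c0 := (contDiff_pd hu 0).continuous
  have c1 := (contDiff_pd hu 1).continuous
  have cu := hu.continuous
  refine Continuous.integrable_of_hasCompactSupport (by fun_prop) ?_
  have h0 := hasCompactSupport_pd hc 0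
  have h1 := hasCompactSupport_pd hc 1
  exact ((h0.norm.add h1.norm).add (hc.norm.mul_left (f := fun _ => 2 * C))).comp_left
    (g := fun t : ℝ => t ^ 2) (by simp)

theorem integrable_norm_sq_dz_sub {a : Plane → Plane} (ham : AEStronglyMeasurable a) {C : ℝ}
    (haC : ∀ᵐ x, ‖a x‖ ≤ C) {u : Plane → ℂ} (hu : ContDiff ℝ ∞ u) (hc : HasCompactSupport u) :
    Integrable fun x => ‖dz u x - Complex.I * (a x 0 - Complex.I * a x 1) * u x‖ ^ 2 := by
  have m0 : AEStronglyMeasurable fun x => ((a x 0 : ℝ) : ℂ) :=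
    Complex.continuous_ofReal.comp_aestronglyMeasurable
      ((EuclideanSpace.proj (𝕜 := ℝ) (0 : Fin 2)).continuous.comp_aestronglyMeasurable ham)
  have m1 : AEStronglyMeasurable fun x => ((a x 1 : ℝ) : ℂ) :=
    Complex.continuous_ofReal.comp_aestronglyMeasurable
      ((EuclideanSpace.proj (𝕜 := ℝ) (1 : Fin 2)).continuous.comp_aestronglyMeasurable ham)
  have mz : AEStronglyMeasurable (dz u) :=
    (continuous_dz (hu.of_le one_le_infty)).aestronglyMeasurable
  refine (integrable_dz_sub_majorant C hu hc).mono' ?_ ?_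
  · exact ((mz.sub (((m0.sub (m1.const_mul Complex.I)).const_mul Complex.I).mul
      hu.continuous.aestronglyMeasurable)).norm.pow 2)
  · filter_upwards [haC] with x hx
    rw [norm_pow, norm_norm]
    exact norm_sq_dz_sub_le hx u x

theorem integrable_im_conj_pd_mul_pd {u : Plane → ℂ} (hu : ContDiff ℝ ∞ u)
    (hc : HasCompactSupport u) :
    Integrable fun x => ((starRingEnd ℂ) (pd 0 u x) * pd 1 u x).im :=
  (Continuous.integrable_of_hasCompactSupport
    ((Complex.continuous_conj.comp (contDiff_pd hu 0).continuous).mul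
      (contDiff_pd hu 1).continuous)
        ((hasCompactSupport_pd hc 1).mul_left)).im

theorem formDensity_eq (a : Plane → Plane) {u : Plane → ℂ} (hu : ContDiff ℝ ∞ u) (x : Plane) :
    formDensity a u x = ‖dz u x - Complex.I * (a x 0 - Complex.I * a x 1) * u x‖ ^ 2 -
      2 * ((starRingEnd ℂ) (pd 0 u x) * pd 1 u x).im := by
  rw [norm_sq_dz_sub u (hu.differentiable (by simp) x), formDensity]; ring

theorem integrable_formDensity {a : Plane → Plane} (ham : AEStronglyMeasurable a) {C : ℝ}
    (haC : ∀ᵐ x, ‖a x‖ ≤ C) {u : Plane → ℂ} (hu : ContDiff ℝ ∞ u) (hc : HasCompactSupport u) :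
    Integrable (formDensity a u) := by
  rw [funext (formDensity_eq a hu)]
  exact (integrable_norm_sq_dz_sub ham haC hu hc).sub
    ((integrable_im_conj_pd_mul_pd hu hc).const_mul 2)

/-- No regularity of `a` beyond boundedness is needed: derivatives fall on `u` and `|u|²` only, and
the cross term integrates to zero. -/
theorem integral_formDensity {a : Plane → Plane} (ham : AEStronglyMeasurable a) {C : ℝ}
    (haC : ∀ᵐ x, ‖a x‖ ≤ C) {u : Plane → ℂ} (hu : ContDiff ℝ ∞ u) (hc : HasCompactSupport u) :
    ∫ x, formDensity a u x =
      ∫ x, ‖dz u x - Complex.I * (a x 0 - Complex.I * a x 1) * u x‖ ^ 2 := by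
  simp_rw [formDensity_eq a hu]
  rw [integral_sub (integrable_norm_sq_dz_sub ham haC hu hc)
    ((integrable_im_conj_pd_mul_pd hu hc).const_mul 2), integral_const_mul,
    integral_im_conj_pd_mul_pd hu hc]
  simp

/-- Transfer of a weighted Hardy inequality along a ground state representation. -/
theorem hardy_of_ground_state {f u : Plane → ℂ} {E h : Plane → ℝ} {Z : Plane → ℝ}
    {α ρ k K : ℝ} (hρ : 0 < ρ) (hk : 0 < k) (hK : 0 < K)
    (hkg : ∀ x, k * gPlus α ρ ‖x‖ ≤ Real.exp (-h x))
    (hKg : ∀ x, Real.exp (-h x) ≤ K * gPlus α ρ ‖x‖)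
    (nf : ∀ x, ‖f x‖ ^ 2 = (Real.exp (-h x) ^ 2)⁻¹ * ‖u x‖ ^ 2)
    (ndz : ∀ x, Z x = (Real.exp (-h x) ^ 2)⁻¹ * E x) (hE0 : ∀ x, 0 ≤ E x) (iE : Integrable E)
    (hV : Integrable fun x => hardyProfile α ρ ‖x‖ * ‖u x‖ ^ 2)
    (key : ∫⁻ x, ENNReal.ofReal (hardyProfile α ρ ‖x‖ * gPlus α ρ ‖x‖ ^ 2 * ‖f x‖ ^ 2) ≤
      ∫⁻ x, ENNReal.ofReal (gPlus α ρ ‖x‖ ^ 2 * Z x)) :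
    (k / K) ^ 2 * ∫ x, hardyProfile α ρ ‖x‖ * ‖u x‖ ^ 2 ≤ ∫ x, E x := by
  -- The upper bound `e^{-h} ≤ K g₊` is spent on the weighted mass and the lower bound `k g₊ ≤
  -- e^{-h}` on the derivative term; hence the factor `(k/K)²`.
  have L1 : ∫⁻ x, ENNReal.ofReal (hardyProfile α ρ ‖x‖ * ‖u x‖ ^ 2) ≤
      ENNReal.ofReal (K ^ 2) * ∫⁻ x, ENNReal.ofReal
        (hardyProfile α ρ ‖x‖ * gPlus α ρ ‖x‖ ^ 2 * ‖f x‖ ^ 2) := by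
    rw [← lintegral_const_mul' _ _ ENNReal.ofReal_ne_top]
    refine lintegral_mono fun x => ?_
    rw [← ENNReal.ofReal_mul (by positivity)]
    refine ENNReal.ofReal_le_ofReal ?_
    have h0 := hardyProfile_nonneg α ρ ‖x‖
    have h1 : Real.exp (-h x) ^ 2 ≤ (K * gPlus α ρ ‖x‖) ^ 2 :=
      pow_le_pow_left₀ (Real.exp_pos _).le (hKg x) 2
    have h2 : ‖u x‖ ^ 2 = Real.exp (-h x) ^ 2 * ‖f x‖ ^ 2 := by
      rw [nf, ← mul_assoc]
      have := (Real.exp_pos (-h x)).ne'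
      field_simp
    rw [h2]
    calc _ ≤ hardyProfile α ρ ‖x‖ * ((K * gPlus α ρ ‖x‖) ^ 2 * ‖f x‖ ^ 2) := by gcongr
      _ = _ := by ring
  have L2 : ∫⁻ x, ENNReal.ofReal (gPlus α ρ ‖x‖ ^ 2 * Z x) ≤
      ENNReal.ofReal ((k ^ 2)⁻¹) * ∫⁻ x, ENNReal.ofReal (E x) := by
    rw [← lintegral_const_mul' _ _ ENNReal.ofReal_ne_top]
    refine lintegral_mono fun x => ?_
    rw [← ENNReal.ofReal_mul (by positivity)]
    refine ENNReal.ofReal_le_ofReal ?_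
    have h1 : (k * gPlus α ρ ‖x‖) ^ 2 ≤ Real.exp (-h x) ^ 2 :=
      pow_le_pow_left₀ (mul_nonneg hk.le (gPlus_pos hρ).le) (hkg x) 2
    have h2 := Real.exp_pos (-h x)
    have h3 : 0 ≤ E x := hE0 x
    rw [ndz]
    have h4 : gPlus α ρ ‖x‖ ^ 2 ≤ (k ^ 2)⁻¹ * Real.exp (-h x) ^ 2 := by
      rw [inv_mul_eq_div, le_div_iff₀ (by positivity)]
      linarith [mul_pow k (gPlus α ρ ‖x‖) 2]
    calc _ ≤ (k ^ 2)⁻¹ * Real.exp (-h x) ^ 2 * ((Real.exp (-h x) ^ 2)⁻¹ * E x) := by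
          gcongr
      _ = _ := by
        have := h2.ne'
        field_simp
  have L3 : ∫⁻ x, ENNReal.ofReal (hardyProfile α ρ ‖x‖ * ‖u x‖ ^ 2) ≤
      ENNReal.ofReal (K ^ 2 * (k ^ 2)⁻¹) * ∫⁻ x, ENNReal.ofReal (E x) := by
    rw [ENNReal.ofReal_mul (by positivity), mul_assoc]
    exact L1.trans (mul_le_mul' le_rfl (key.trans L2))
  have hE1 : 0 ≤ ∫ x, E x := integral_nonneg hE0
  rw [← ofReal_integral_eq_lintegral_ofReal hV (Eventually.of_forall fun x =>
    mul_nonneg (hardyProfile_nonneg _ _ _) (sq_nonneg _)),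
    ← ofReal_integral_eq_lintegral_ofReal iE (Eventually.of_forall hE0),
    ← ENNReal.ofReal_mul (by positivity), ENNReal.ofReal_le_ofReal_iff
      (mul_nonneg (by positivity) hE1)] at L3
  refine (mul_le_mul_of_nonneg_left L3 (sq_nonneg (k / K))).trans (le_of_eq ?_)
  field_simp

theorem dz_exp_mul {Ψ u : Plane → ℂ} {x : Plane} (hΨ : DifferentiableAt ℝ Ψ x)
    (hu : DifferentiableAt ℝ u x) :
    dz (fun x => Complex.exp (Ψ x) * u x) x = Complex.exp (Ψ x) * (dz u x + dz Ψ x * u x) := by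
  rw [dz, (hΨ.hasFDerivAt.cexp.fun_mul hu.hasFDerivAt).fderiv]
  simp only [add_apply, smul_apply, smul_eq_mul, dz]
  ring

/-- The Hardy inequality for a smooth magnetic field with compactly supported smooth spinors. -/
theorem hardy_smooth {a : Plane → Plane} {h : Plane → ℝ}
    (ha : ∀ j, ContDiff ℝ ∞ fun x => a x j) (hh : ContDiff ℝ ∞ h)
    (hcurl : ∀ x, pd 0 (fun y => a y 1) x - pd 1 (fun y => a y 0) x +
      (pd 0 (pd 0 h) x + pd 1 (pd 1 h) x) = 0)
    (ham : AEStronglyMeasurable a) {C : ℝ} (haC : ∀ᵐ x, ‖a x‖ ≤ C)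
    {α ρ k K : ℝ} (hρ : 0 < ρ) (hα : 0 ≤ α) (hk : 0 < k) (hK : 0 < K)
    (hkg : ∀ x, k * gPlus α ρ ‖x‖ ≤ Real.exp (-h x))
    (hKg : ∀ x, Real.exp (-h x) ≤ K * gPlus α ρ ‖x‖)
    {u : Plane → ℂ} (hu : ContDiff ℝ ∞ u) (hc : HasCompactSupport u) :
    (k / K) ^ 2 * ∫ x, hardyProfile α ρ ‖x‖ * ‖u x‖ ^ 2 ≤ ∫ x, formDensity a u x := by
  obtain ⟨Ψ, sΨ, rΨ, dΨ⟩ := exists_complex_potential ha hh hcurl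
  have su : ContDiff ℝ 1 u := hu.of_le one_le_infty
  -- Multiplication by `e^Ψ` absorbs the vector potential: `∂₁ - i∂₂` of the product is `e^Ψ` times
  -- the magnetic operator applied to `u`.
  have sf : ContDiff ℝ 1 (fun x => Complex.exp (Ψ x) * u x) := sΨ.cexp.mul su
  have cf : HasCompactSupport (fun x => Complex.exp (Ψ x) * u x) := hc.mul_left
  have key := lintegral_hardyProfile_le_dz sf cf hρ hα
  have hV : Integrable fun x => hardyProfile α ρ ‖x‖ * ‖u x‖ ^ 2 :=
    integrable_hardyProfile_mul hρ (integrable_norm_sq hu.continuous hc)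
  rw [integral_formDensity ham haC hu hc]
  refine hardy_of_ground_state hρ hk hK hkg hKg (fun x => ?_) (fun x => ?_)
    (fun x => sq_nonneg _) (integrable_norm_sq_dz_sub ham haC hu hc) hV key
  · rw [norm_mul, Complex.norm_exp, rΨ, mul_pow, Real.exp_neg, inv_pow, inv_inv]
  · rw [dz_exp_mul (sΨ.differentiable one_ne_zero x) (su.differentiable one_ne_zero x), dΨ,
      norm_mul, Complex.norm_exp, rΨ, mul_pow, Real.exp_neg, inv_pow, inv_inv]
    congr 3
    ring

end PauliHardy
end

noncomputable section

namespace PauliHardy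

/-! ### The fundamental solution of the Laplacian in the plane -/

theorem integral_polarPt {F : Plane → ℂ} (hF : Integrable F) (hm : Measurable F) :
    ∫ x, F x = ∫ r in Ioi (0 : ℝ), ∫ θ in (-Real.pi)..Real.pi, (r : ℂ) * F (polarPt r θ) := by
  have h1 := (Complex.orthonormalBasisOneI.measurePreserving_repr).integral_comp
    (Complex.orthonormalBasisOneI.repr.toHomeomorph.measurableEmbedding) F
  have h2 : ∀ p : ℝ × ℝ, p.1 • F (Complex.orthonormalBasisOneI.repr
      (Complex.polarCoord.symm p)) = (p.1 : ℂ) * F (polarPt p.1 p.2) := by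
    intro p
    rw [Complex.real_smul]
    congr 2
  have h3 : Measurable fun p : ℝ × ℝ => (p.1 : ℂ) * F (polarPt p.1 p.2) :=
    (Complex.measurable_ofReal.comp measurable_fst).mul (hm.comp continuous_polarPt.measurable)
  have hi : Integrable (fun p : ℝ × ℝ => (p.1 : ℂ) * F (polarPt p.1 p.2))
      ((volume.restrict (Ioi 0)).prod (volume.restrict (Ioo (-Real.pi) Real.pi))) := by
    refine ⟨h3.aestronglyMeasurable, ?_⟩
    have h4 := hF.2
    rw [HasFiniteIntegral, lintegral_polarPt hm.enorm] at h4
    rw [HasFiniteIntegral, lintegral_prod _ h3.enorm.aemeasurable]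
    refine lt_of_eq_of_lt ?_ h4
    refine setLIntegral_congr_fun measurableSet_Ioi fun r hr => ?_
    rw [restrict_Ioo_eq_restrict_Ioc]
    refine lintegral_congr fun θ => ?_
    rw [enorm_mul]
    congr 1
    have hr0 : 0 ≤ r := (mem_Ioi.1 hr).le
    rw [← ofReal_norm, Complex.norm_real, Real.norm_of_nonneg hr0]
  rw [← h1, ← Complex.integral_comp_polarCoord_symm, polarCoord_target]
  simp_rw [h2]
  rw [Measure.volume_eq_prod, ← Measure.prod_restrict, integral_prod _ hi]
  refine integral_congr_ae (Eventually.of_forall fun r => ?_)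
  simp only
  rw [restrict_Ioo_eq_restrict_Ioc, intervalIntegral.integral_of_le (by linarith [Real.pi_pos])]

theorem integrableOn_inv_norm (R : ℝ) :
    IntegrableOn (fun x : Plane => ‖x‖⁻¹) (Metric.closedBall 0 R) := by
  rw [← integrable_indicator_iff Metric.isClosed_closedBall.measurableSet]
  have e : (Metric.closedBall (0 : Plane) R).indicator (fun x => ‖x‖⁻¹) =
      fun x => (Iic R).indicator (fun r : ℝ => r⁻¹) ‖x‖ := by
    ext x
    simp [indicator]
  rw [e, integrable_fun_norm_addHaar]
  simp only [finrank_euclideanSpace, Fintype.card_fin, Nat.add_one_sub_one, pow_one, smul_eq_mul]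
  have : IntegrableOn (fun _ : ℝ => (1 : ℝ)) (Ioc 0 R) := by simp
  refine (this.integrable_indicator measurableSet_Ioc).integrableOn.congr_fun
    (fun r hr => ?_) measurableSet_Ioi
  have hr0 : r ≠ 0 := (mem_Ioi.1 hr).ne'
  have hr1 : 0 < r := hr
  by_cases h : r ≤ R <;> simp [indicator, h, hr0, hr1]

theorem integrable_inv_norm_mul {g : Plane → ℝ} (hg : Continuous g) (hc : HasCompactSupport g) :
    Integrable fun x : Plane => ‖x‖⁻¹ * g x := by
  obtain ⟨M, hM⟩ := hc.exists_bound_of_continuous hg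
  obtain ⟨R, hR⟩ := hc.isCompact.isBounded.subset_closedBall (0 : Plane)
  have h1 : IntegrableOn (fun x : Plane => ‖x‖⁻¹ * g x) (Metric.closedBall 0 R) :=
    (integrableOn_inv_norm R).mul_bdd (c := M) hg.aestronglyMeasurable
      (Eventually.of_forall hM)
  rw [← integrableOn_iff_integrable_of_support_subset (s := Metric.closedBall (0 : Plane) R)]
  · exact h1
  · exact (Function.support_mul_subset_right _ _).trans ((subset_tsupport _).trans hR)

theorem norm_radial_le (f : Plane → ℂ) (x : Plane) :
    ‖((‖x‖ ^ 2)⁻¹ : ℝ) • fderiv ℝ f x x‖ ≤ ‖x‖⁻¹ * ‖fderiv ℝ f x‖ := by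
  rcases eq_or_ne x 0 with rfl | hx
  · simp
  · rw [norm_smul, Real.norm_of_nonneg (by positivity)]
    have h0 : 0 < ‖x‖ := norm_pos_iff.2 hx
    calc _ ≤ (‖x‖ ^ 2)⁻¹ * (‖fderiv ℝ f x‖ * ‖x‖) := by
          gcongr; exact (fderiv ℝ f x).le_opNorm x
      _ = _ := by field_simp

theorem integrable_inv_norm_mul_norm_fderiv {f : Plane → ℂ} (hf : ContDiff ℝ 1 f)
    (hc : HasCompactSupport f) : Integrable fun x : Plane => ‖x‖⁻¹ * ‖fderiv ℝ f x‖ :=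
  integrable_inv_norm_mul (hf.continuous_fderiv one_ne_zero).norm (hc.fderiv (𝕜 := ℝ)).norm

theorem measurable_radial {f : Plane → ℂ} (hf : ContDiff ℝ 1 f) (δ : ℝ) :
    Measurable fun x : Plane => ((‖x‖ ^ 2 + δ)⁻¹ : ℝ) • fderiv ℝ f x x := by
  have h1 : Measurable fun x : Plane => fderiv ℝ f x x :=
    ((hf.continuous_fderiv one_ne_zero).clm_apply continuous_id).measurable
  have h2 : Measurable fun x : Plane => ((‖x‖ ^ 2 + δ)⁻¹ : ℝ) := by fun_prop
  exact h2.smul h1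

/-- In polar coordinates the integrand against Lebesgue measure is `∂_r f dr dθ`. The zeroth angular
mode starts at `f 0` and ends at `0`. -/
theorem integral_radial_deriv {f : Plane → ℂ} (hf : ContDiff ℝ 1 f) (hc : HasCompactSupport f) :
    ∫ x : Plane, ((‖x‖ ^ 2)⁻¹ : ℝ) • fderiv ℝ f x x = -(2 * Real.pi) * f 0 := by
  have hmeas := measurable_radial hf 0
  simp only [add_zero] at hmeas
  have hint : Integrable fun x : Plane => ((‖x‖ ^ 2)⁻¹ : ℝ) • fderiv ℝ f x x :=
    (integrable_inv_norm_mul_norm_fderiv hf hc).mono' hmeas.aestronglyMeasurable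
      (Eventually.of_forall (norm_radial_le f))
  rw [integral_polarPt hint hmeas]
  have e1 : ∀ r ∈ Ioi (0 : ℝ), ∫ θ in (-Real.pi)..Real.pi, (r : ℂ) *
      (((‖polarPt r θ‖ ^ 2)⁻¹ : ℝ) • fderiv ℝ f (polarPt r θ) (polarPt r θ)) =
      (2 * Real.pi) * angularModeDeriv f 0 r := by
    intro r hr
    have hr0 : (r : ℂ) ≠ 0 := by exact_mod_cast (mem_Ioi.1 hr).ne'
    have hpi : (Real.pi : ℂ) ≠ 0 := by exact_mod_cast Real.pi_pos.ne'
    rw [angularModeDeriv, circleCoeff, Complex.real_smul]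
    have : (2 * Real.pi : ℂ) * (((2 * Real.pi)⁻¹ : ℝ) * ∫ θ in (-Real.pi)..Real.pi,
      Complex.exp (-((0 : ℤ) * θ * Complex.I)) * fderiv ℝ f (polarPt r θ) (polarPt 1 θ)) =
      ∫ θ in (-Real.pi)..Real.pi,
      Complex.exp (-((0 : ℤ) * θ * Complex.I)) * fderiv ℝ f (polarPt r θ) (polarPt 1 θ) := by
      rw [← mul_assoc]
      have : (2 * Real.pi : ℂ) * ((2 * Real.pi)⁻¹ : ℝ) = 1 := by push_cast; field_simp
      rw [this, one_mul]
    rw [this]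
    refine intervalIntegral.integral_congr fun θ _ => ?_
    have h1 : polarPt r θ = r • polarPt 1 θ := by simp [polarPt_eq, smul_smul]
    have h2 : fderiv ℝ f (polarPt r θ) (polarPt r θ) =
        (r : ℂ) * fderiv ℝ f (polarPt r θ) (polarPt 1 θ) := by
      conv_lhs => rw [show (fderiv ℝ f (polarPt r θ)) (polarPt r θ) =
        (fderiv ℝ f (polarPt r θ)) (r • polarPt 1 θ) by rw [← h1]]
      rw [map_smul, Complex.real_smul]
    rw [h2, norm_polarPt, sq_abs, Complex.real_smul]
    push_cast
    field_simp
    simp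
  rw [setIntegral_congr_fun measurableSet_Ioi e1, integral_const_mul]
  obtain ⟨R, hR⟩ := hc.isCompact.isBounded.subset_closedBall (0 : Plane)
  have z1 : ∀ r, max R 0 < r → angularMode f 0 r = 0 := by
    intro r hr
    have : ∀ θ, f (polarPt r θ) = 0 := fun θ => by
      refine image_eq_zero_of_notMem_tsupport fun h => ?_
      have := hR h
      rw [mem_closedBall_zero_iff, norm_polarPt] at this
      linarith [le_abs_self r, le_max_left R 0]
    simp [angularMode, this, circleCoeff]
  have z2 : ∀ r, max R 0 < r → angularModeDeriv f 0 r = 0 := by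
    intro r hr
    have h1 := hasDerivAt_angularMode hf hc 0 r
    have h2 : HasDerivAt (angularMode f 0) 0 r := by
      refine (hasDerivAt_const r (0 : ℂ)).congr_of_eventuallyEq ?_
      filter_upwards [lt_mem_nhds hr] with s hs using z1 s hs
    exact h1.unique h2
  have cd : Continuous (angularModeDeriv f 0) :=
    continuous_circleCoeff (v := fun r θ => fderiv ℝ f (polarPt r θ) (polarPt 1 θ))
      (continuous_radialDeriv hf) 0
  have id : IntegrableOn (angularModeDeriv f 0) (Ioi 0) := by
    rw [← Ioc_union_Ioi_eq_Ioi (le_max_right R 0)]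
    refine IntegrableOn.union ?_ ?_
    · exact (cd.continuousOn.integrableOn_Icc).mono_set Ioc_subset_Icc_self
    · exact integrableOn_zero.congr_fun (fun r hr => (z2 r hr).symm) measurableSet_Ioi
  have ft := integral_Ioi_of_hasDerivAt_of_tendsto (a := 0) (m := 0)
    (hasDerivAt_angularMode hf hc 0 0).continuousAt.continuousWithinAt
    (fun r _ => hasDerivAt_angularMode hf hc 0 r) id (by
      refine tendsto_const_nhds.congr' ?_
      filter_upwards [eventually_gt_atTop (max R 0)] with r hr using (z1 r hr).symm)
  rw [ft]
  have e0 : angularMode f 0 0 = f 0 := by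
    have : ∀ θ, polarPt 0 θ = 0 := fun θ => by simp [polarPt_eq]
    have hpi : (Real.pi : ℂ) ≠ 0 := by exact_mod_cast Real.pi_pos.ne'
    simp only [angularMode, circleCoeff, this]
    simp
    field_simp
    ring
  rw [e0]; ring

/-- The Laplacian in the plane. -/
def lap {F : Type*} [NormedAddCommGroup F] [NormedSpace ℝ F] (u : Plane → F) (x : Plane) : F :=
  pd 0 (pd 0 u) x + pd 1 (pd 1 u) x

theorem pd_log_norm_sq_add {δ : ℝ} (hδ : 0 < δ) (j : Fin 2) (x : Plane) :
    pd j (fun x : Plane => ((Real.log (‖x‖ ^ 2 + δ) / 2 : ℝ) : ℂ)) x =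
      ((x j * (‖x‖ ^ 2 + δ)⁻¹ : ℝ) : ℂ) := by
  have h0 : (‖x‖ ^ 2 + δ) ≠ 0 := by positivity
  have h1 : HasFDerivAt (fun x : Plane => ‖x‖ ^ 2 + δ) (2 • innerSL ℝ x) x := by
    have := (hasFDerivAt_id (𝕜 := ℝ) x).norm_sq.add_const δ
    simpa using this
  have h2 := ((h1.log h0).mul_const (2 : ℝ)⁻¹)
  have h3 : HasFDerivAt (fun x : Plane => ((Real.log (‖x‖ ^ 2 + δ) / 2 : ℝ) : ℂ)) _ x :=
    Complex.ofRealCLM.hasFDerivAt.comp x h2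
  rw [pd, h3.fderiv]
  have e : inner ℝ x (EuclideanSpace.single j 1) = x j := by
    simp [EuclideanSpace.inner_single_right]
  simp [e]
  field_simp

theorem contDiff_log_norm_sq_add {δ : ℝ} (hδ : 0 < δ) :
    ContDiff ℝ ∞ fun x : Plane => ((Real.log (‖x‖ ^ 2 + δ) / 2 : ℝ) : ℂ) := by
  refine Complex.ofRealCLM.contDiff.comp (ContDiff.div_const (ContDiff.log
    ((contDiff_norm_sq ℝ).add contDiff_const) fun x => ?_) 2)
  positivity

/-- Replacing `log |x|` by the smooth `log(|x|² + δ)/2`, with gradient `x/(|x|² + δ)`, permits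
integration by parts over the whole plane without excising a disc. -/
theorem integral_log_reg_mul_lap {f : Plane → ℂ} (hf : ContDiff ℝ ∞ f) (hc : HasCompactSupport f)
    {δ : ℝ} (hδ : 0 < δ) :
    ∫ x : Plane, ((Real.log (‖x‖ ^ 2 + δ) / 2 : ℝ) : ℂ) * lap f x =
      -∫ x : Plane, ((‖x‖ ^ 2 + δ)⁻¹ : ℝ) • fderiv ℝ f x x := by
  set L : Plane → ℂ := fun x => ((Real.log (‖x‖ ^ 2 + δ) / 2 : ℝ) : ℂ) with hL
  have sL : ContDiff ℝ ∞ L := contDiff_log_norm_sq_add hδ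
  have c1 : ∀ j, HasCompactSupport (pd j f) := hasCompactSupport_pd hc
  have s1 : ∀ j, ContDiff ℝ ∞ (pd j f) := contDiff_pd hf
  have c2 : ∀ j, HasCompactSupport (pd j (pd j f)) := fun j => hasCompactSupport_pd (c1 j) j
  have s2 : ∀ j, ContDiff ℝ ∞ (pd j (pd j f)) := fun j => contDiff_pd (s1 j) j
  have i1 : ∀ j, Integrable fun x => L x * pd j (pd j f) x := fun j =>
    (sL.continuous.mul (s2 j).continuous).integrable_of_hasCompactSupport (c2 j).mul_left
  have i2 : ∀ j, Integrable fun x => pd j L x * pd j f x := fun j =>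
    ((contDiff_pd sL j).continuous.mul (s1 j).continuous).integrable_of_hasCompactSupport
      (c1 j).mul_left
  have ibp : ∀ j, ∫ x, L x * pd j (pd j f) x = - ∫ x, pd j L x * pd j f x := fun j =>
    integral_mul_fderiv_eq_neg_fderiv_mul_of_integrable (i2 j) (i1 j)
      ((sL.continuous.mul (s1 j).continuous).integrable_of_hasCompactSupport (c1 j).mul_left)
      (fun x _ => sL.differentiable (by simp) |>.differentiableAt)
      (fun x _ => (s1 j).differentiable (by simp) |>.differentiableAt)
  simp only [lap, mul_add]
  rw [integral_add (i1 0) (i1 1), ibp, ibp, ← neg_add, ← integral_add (i2 0) (i2 1)]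
  congr 1
  refine integral_congr_ae (Eventually.of_forall fun x => ?_)
  simp only [hL]
  rw [pd_log_norm_sq_add hδ, pd_log_norm_sq_add hδ, fderiv_apply_eq_pd]
  simp only [Complex.real_smul]
  push_cast
  ring

theorem abs_log_le_inv_add {t : ℝ} (ht : 0 ≤ t) : |Real.log t| ≤ t⁻¹ + t := by
  rcases ht.eq_or_lt with rfl | ht
  · simp
  have h1 := Real.log_le_sub_one_of_pos ht
  have h2 := Real.log_le_sub_one_of_pos (inv_pos.2 ht)
  rw [Real.log_inv] at h2
  have := inv_pos.2 ht
  rw [abs_le]; constructor <;> linarith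

/-- A majorant independent of `δ` for dominated convergence. The factor `t⁻¹` is locally integrable
in the plane, and the polynomial is absorbed by compact support. -/
theorem abs_log_reg_le {t δ : ℝ} (ht : 0 < t) (hδ : 0 < δ) (hδ1 : δ ≤ 1) :
    |Real.log (t ^ 2 + δ) / 2| ≤ t⁻¹ * (1 + t ^ 2 + t ^ 3) := by
  have e : t⁻¹ * (1 + t ^ 2 + t ^ 3) = t⁻¹ + t + t ^ 2 := by field_simp
  rw [e]
  have h1 := (abs_le.1 (abs_log_le_inv_add ht.le)).1
  have h2 : 2 * Real.log t ≤ Real.log (t ^ 2 + δ) := by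
    rw [← Nat.cast_ofNat, ← Real.log_pow]
    exact Real.log_le_log (by positivity) (by linarith)
  have h3 := Real.log_le_sub_one_of_pos (show 0 < t ^ 2 + δ by positivity)
  have := inv_pos.2 ht
  have := sq_nonneg t
  rw [abs_le]; constructor <;> linarith

theorem hasCompactSupport_lap {F : Type*} [NormedAddCommGroup F] [NormedSpace ℝ F]
    {u : Plane → F} (hc : HasCompactSupport u) : HasCompactSupport (lap u) :=
  (hasCompactSupport_pd (hasCompactSupport_pd hc 0) 0).add
    (hasCompactSupport_pd (hasCompactSupport_pd hc 1) 1)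

theorem contDiff_lap {F : Type*} [NormedAddCommGroup F] [NormedSpace ℝ F]
    {u : Plane → F} (hu : ContDiff ℝ ∞ u) : ContDiff ℝ ∞ (lap u) :=
  (contDiff_pd (contDiff_pd hu 0) 0).add (contDiff_pd (contDiff_pd hu 1) 1)

theorem ae_ne_zero : ∀ᵐ x : Plane, x ≠ 0 := by
  simp [ae_iff, measure_singleton]

/-- `log |x|` is `2π` times the fundamental solution of the Laplacian. -/
theorem integral_log_norm_mul_lap {f : Plane → ℂ} (hf : ContDiff ℝ ∞ f)
    (hc : HasCompactSupport f) :
    ∫ x : Plane, (Real.log ‖x‖ : ℂ) * lap f x = 2 * Real.pi * f 0 := by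
  have hf1 := hf.of_le one_le_infty
  set δ : ℕ → ℝ := fun n => 1 / ((n : ℝ) + 1) with hδ
  have δ0 : ∀ n, 0 < δ n := fun n => by simp only [hδ]; positivity
  have δ1 : ∀ n, δ n ≤ 1 := fun n => by
    simp only [hδ]
    rw [div_le_one (by positivity)]
    have : (0 : ℝ) ≤ n := by positivity
    linarith
  have δt : Tendsto δ atTop (nhds 0) := tendsto_one_div_add_atTop_nhds_zero_nat
  have cl := (contDiff_lap hf).continuous
  have T1 : Tendsto (fun n => ∫ x : Plane, ((Real.log (‖x‖ ^ 2 + δ n) / 2 : ℝ) : ℂ) * lap f x)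
      atTop (nhds (∫ x : Plane, (Real.log ‖x‖ : ℂ) * lap f x)) := by
    refine tendsto_integral_of_dominated_convergence
      (fun x => ‖x‖⁻¹ * ((1 + ‖x‖ ^ 2 + ‖x‖ ^ 3) * ‖lap f x‖)) (fun n => ?_) ?_ (fun n => ?_) ?_
    · exact ((contDiff_log_norm_sq_add (δ0 n)).continuous.mul cl).aestronglyMeasurable
    · exact integrable_inv_norm_mul (by fun_prop) (hasCompactSupport_lap hc).norm.mul_left
    · filter_upwards [ae_ne_zero] with x hx
      rw [norm_mul, Complex.norm_real, Real.norm_eq_abs, ← mul_assoc]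
      exact mul_le_mul_of_nonneg_right (abs_log_reg_le (norm_pos_iff.2 hx) (δ0 n) (δ1 n))
        (norm_nonneg _)
    · filter_upwards [ae_ne_zero] with x hx
      refine Tendsto.mul_const _ ?_
      refine (Complex.continuous_ofReal.tendsto _).comp ?_
      have h0 : 0 < ‖x‖ := norm_pos_iff.2 hx
      have h1 : Tendsto (fun n => ‖x‖ ^ 2 + δ n) atTop (nhds (‖x‖ ^ 2)) := by
        simpa using (tendsto_const_nhds (x := ‖x‖ ^ 2)).add δt
      have h2 := (h1.log (by positivity)).div_const 2
      rw [Real.log_pow] at h2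
      simpa using h2
  have T2 : Tendsto (fun n => -∫ x : Plane, ((‖x‖ ^ 2 + δ n)⁻¹ : ℝ) • fderiv ℝ f x x)
      atTop (nhds (-∫ x : Plane, ((‖x‖ ^ 2)⁻¹ : ℝ) • fderiv ℝ f x x)) := by
    refine Tendsto.neg ?_
    refine tendsto_integral_of_dominated_convergence
      (fun x => ‖x‖⁻¹ * ‖fderiv ℝ f x‖) (fun n => ?_) ?_ (fun n => ?_) ?_
    · exact (measurable_radial hf1 _).aestronglyMeasurable
    · exact integrable_inv_norm_mul_norm_fderiv hf1 hc
    · filter_upwards [ae_ne_zero] with x hx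
      refine le_trans ?_ (norm_radial_le f x)
      have h0 : 0 < ‖x‖ := norm_pos_iff.2 hx
      have := δ0 n
      rw [norm_smul, norm_smul, Real.norm_of_nonneg (by positivity),
        Real.norm_of_nonneg (by positivity)]
      gcongr
      linarith
    · filter_upwards [ae_ne_zero] with x hx
      have h0 : 0 < ‖x‖ := norm_pos_iff.2 hx
      refine Tendsto.smul_const ?_ _
      refine Tendsto.inv₀ ?_ (by positivity)
      simpa using (tendsto_const_nhds (x := ‖x‖ ^ 2)).add δt
  simp_rw [fun n => integral_log_reg_mul_lap hf hc (δ0 n)] at T1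
  rw [tendsto_nhds_unique T1 T2, integral_radial_deriv hf1 hc]
  ring

theorem pd_ofReal {φ : Plane → ℝ} (hφ : Differentiable ℝ φ) (j : Fin 2) :
    pd j (fun x => (φ x : ℂ)) = fun x => ((pd j φ x : ℝ) : ℂ) := by
  ext x
  have h : HasFDerivAt (fun x => (φ x : ℂ)) (Complex.ofRealCLM ∘L fderiv ℝ φ x) x :=
    Complex.ofRealCLM.hasFDerivAt.comp x (hφ x).hasFDerivAt
  rw [pd, h.fderiv]
  rfl

theorem integral_log_norm_mul_lap_real {φ : Plane → ℝ} (hφ : ContDiff ℝ ∞ φ)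
    (hc : HasCompactSupport φ) :
    ∫ x : Plane, Real.log ‖x‖ * lap φ x = 2 * Real.pi * φ 0 := by
  have h := integral_log_norm_mul_lap (f := fun x => (φ x : ℂ))
    (Complex.ofRealCLM.contDiff.comp hφ) (hc.comp_left (g := Complex.ofReal) (by simp))
  have e : ∀ x, lap (fun x => (φ x : ℂ)) x = ((lap φ x : ℝ) : ℂ) := fun x => by
    simp only [lap]
    rw [pd_ofReal (hφ.differentiable (by simp)), pd_ofReal (hφ.differentiable (by simp)),
      pd_ofReal ((contDiff_pd hφ 0).differentiable (by simp)),
      pd_ofReal ((contDiff_pd hφ 1).differentiable (by simp))]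
    push_cast; rfl
  simp_rw [e] at h
  have h2 : ∀ x : Plane, (Real.log ‖x‖ : ℂ) * ((lap φ x : ℝ) : ℂ) =
      ((Real.log ‖x‖ * lap φ x : ℝ) : ℂ) := fun x => by push_cast; rfl
  simp_rw [h2] at h
  rw [integral_complex_ofReal] at h
  exact_mod_cast h

end PauliHardy
end

noncomputable section

namespace PauliHardy

/-! ### Admissible magnetic fields and their superpotentials -/

/-- This form has no case distinction: `log g₊` is visibly linear in `α`, Lipschitz in `r`, and
within a bounded distance of `α log(1 + r)`. -/
theorem gPlus_eq_exp {α ρ r : ℝ} (hρ : 0 < ρ) :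
    gPlus α ρ r = Real.exp (α * Real.log (max r ρ / ρ)) := by
  unfold gPlus
  split_ifs with h
  · rw [max_eq_right h, div_self hρ.ne']; simp
  · have h' := not_le.1 h
    have hr : 0 < r := hρ.trans h'
    rw [max_eq_left h'.le, Real.log_div hr.ne' hρ.ne', Real.rpow_def_of_pos hρ,
      Real.rpow_def_of_pos hr, ← Real.exp_add]
    congr 1; ring

theorem abs_log_max_div_sub_le {ρ r : ℝ} (hρ : 0 < ρ) (hr : 0 ≤ r) :
    |Real.log (max r ρ / ρ) - Real.log (1 + r)| ≤
      |Real.log ρ| + Real.log (1 + ρ) + Real.log (1 + ρ⁻¹) := by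
  have hm : 0 < max r ρ := lt_max_of_lt_right hρ
  have hi := inv_pos.2 hρ
  rw [Real.log_div hm.ne' hρ.ne']
  have h1 : Real.log (max r ρ) ≤ Real.log (1 + r) + Real.log (1 + ρ) := by
    rw [← Real.log_mul (by positivity) (by positivity)]
    refine Real.log_le_log hm (max_le ?_ ?_) <;> nlinarith
  have h2 : Real.log (1 + r) ≤ Real.log (max r ρ) + Real.log (1 + ρ⁻¹) := by
    rw [← Real.log_mul (by positivity) (by positivity)]
    refine Real.log_le_log (by positivity) ?_
    have h3 : 1 ≤ max r ρ * ρ⁻¹ := by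
      rw [← div_eq_mul_inv, one_le_div hρ]; exact le_max_right _ _
    nlinarith [le_max_left r ρ]
  have h3 : 0 ≤ Real.log (1 + ρ) := Real.log_nonneg (by linarith)
  have h4 : 0 ≤ Real.log (1 + ρ⁻¹) := Real.log_nonneg (by linarith)
  have h5 := neg_abs_le (Real.log ρ)
  have h6 := le_abs_self (Real.log ρ)
  rw [abs_le]; constructor <;> linarith

theorem log_one_add_le_two_sqrt {t : ℝ} (ht : 0 ≤ t) : Real.log (1 + t) ≤ 2 * Real.sqrt t := by
  have h := Real.sqrt_nonneg t
  have h1 : Real.log (1 + t) ≤ Real.log ((1 + Real.sqrt t) ^ 2) :=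
    Real.log_le_log (by positivity) (by nlinarith [Real.sq_sqrt ht])
  rw [Real.log_pow] at h1
  have h2 := Real.log_le_sub_one_of_pos (show 0 < 1 + Real.sqrt t by positivity)
  push_cast at h1
  linarith

/-- Logarithms of `|x-y| ≤ (1+|x|)(1+|y|)` and `1+|x| ≤ (1+|y|)(1+|x-y|)`. Subtracting `log(1+|x|)`
from the kernel isolates the growth `-α log |x|` of the superpotential. -/
theorem abs_log_norm_sub_sub_le (x y : Plane) :
    |Real.log ‖x - y‖ - Real.log (1 + ‖x‖)| ≤
      Real.log (1 + ‖y‖) + Real.log (1 + ‖x - y‖⁻¹) := by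
  have hx := norm_nonneg x
  have hy := norm_nonneg y
  rcases eq_or_ne x y with rfl | hxy
  -- On the diagonal the conventions `log 0 = 0` and `0⁻¹ = 0` turn the claim into an equality.
  · have : 0 ≤ Real.log (1 + ‖x‖) := Real.log_nonneg (by linarith)
    simp [abs_of_nonneg this]
  have hs : 0 < ‖x - y‖ := norm_pos_iff.2 (sub_ne_zero.2 hxy)
  have hi := inv_pos.2 hs
  have h3 : 0 ≤ Real.log (1 + ‖x - y‖⁻¹) := Real.log_nonneg (by linarith)
  have h1 : Real.log ‖x - y‖ ≤ Real.log (1 + ‖x‖) + Real.log (1 + ‖y‖) := by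
    rw [← Real.log_mul (by positivity) (by positivity)]
    refine Real.log_le_log hs ((norm_sub_le x y).trans ?_)
    nlinarith
  have h2 : Real.log (1 + ‖x‖) ≤
      Real.log (1 + ‖y‖) + (Real.log (1 + ‖x - y‖⁻¹) + Real.log ‖x - y‖) := by
    rw [← Real.log_mul (by positivity) (by positivity),
      ← Real.log_mul (by positivity) (by positivity)]
    refine Real.log_le_log (by positivity) ?_
    have e : (1 + ‖x - y‖⁻¹) * ‖x - y‖ = ‖x - y‖ + 1 := by field_simp
    rw [e]
    have := norm_sub_norm_le x y
    nlinarith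
  rw [abs_le]; constructor <;> linarith

/-- The singular part of the logarithmic kernel. -/
def nearKernel (x : Plane) : ℝ := (Metric.closedBall (0 : Plane) 1).indicator (fun x => ‖x‖⁻¹) x

theorem integrable_nearKernel : Integrable nearKernel :=
  (integrableOn_inv_norm 1).integrable_indicator Metric.isClosed_closedBall.measurableSet

theorem nearKernel_nonneg (x : Plane) : 0 ≤ nearKernel x :=
  indicator_nonneg (fun _ _ => by positivity) _

/-- Near the origin the logarithm is at most `2|z|^{-1/2}`, and Young's inequality separates `b²`
from the integrable `|z|⁻¹`. Thus `B ∈ L²` controls the kernel uniformly. -/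
theorem abs_mul_log_one_add_inv_le (b : ℝ) (z : Plane) :
    |b| * Real.log (1 + ‖z‖⁻¹) ≤ |b| + b ^ 2 + nearKernel z := by
  have hb := abs_nonneg b
  by_cases h : ‖z‖ ≤ 1
  · have e : nearKernel z = ‖z‖⁻¹ := by simp [nearKernel, indicator, h]
    have hi : 0 ≤ ‖z‖⁻¹ := by positivity
    have h1 := log_one_add_le_two_sqrt hi
    rw [e]
    have h2 := Real.sq_sqrt hi
    nlinarith [sq_nonneg (|b| - Real.sqrt ‖z‖⁻¹), sq_abs b, mul_le_mul_of_nonneg_left h1 hb]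
  · have h' := not_le.1 h
    have h1 := Real.log_le_sub_one_of_pos (show 0 < 1 + ‖z‖⁻¹ by positivity)
    have h2 : ‖z‖⁻¹ ≤ 1 := inv_le_one_of_one_le₀ h'.le
    nlinarith [nearKernel_nonneg z, sq_nonneg b, mul_le_mul_of_nonneg_left
      (show Real.log (1 + ‖z‖⁻¹) ≤ 1 by linarith) hb]

theorem isFiniteMeasure_restrict_closedBall (R : ℝ) :
    IsFiniteMeasure (volume.restrict (Metric.closedBall (0 : Plane) R)) :=
  ⟨by
    rw [Measure.restrict_apply_univ]
    exact measure_closedBall_lt_top⟩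

namespace IsAdmissibleField

variable {B : Plane → ℝ}

theorem exists_bound (hB : IsAdmissibleField B) : ∃ R C τ : ℝ, 2 < τ ∧ 0 ≤ C ∧
    MemLp B 2 (volume.restrict (Metric.closedBall 0 R)) ∧
    ∀ᵐ x, x ∈ (Metric.closedBall (0 : Plane) R)ᶜ → |B x| ≤ C * (1 + ‖x‖) ^ (-τ) := by
  obtain ⟨p, hp, hloc⟩ := hB.locLp
  obtain ⟨τ, hτ, C, R, h⟩ := hB.decay
  -- Beyond radius `1` one has `(1+|x|)/2 ≤ |x|`, at the price of `2^τ`.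
  refine ⟨max R 1, |C| * 2 ^ τ, τ, hτ, by positivity, ?_, ?_⟩
  · have : IsFiniteMeasure (volume.restrict (Metric.closedBall (0 : Plane) (max R 1))) :=
      isFiniteMeasure_restrict_closedBall _
    exact (hloc _ (isCompact_closedBall _ _)).mono_exponent hp.le
  · filter_upwards [h] with x hx hxR
    simp only [mem_compl_iff, mem_closedBall_zero_iff, not_le, max_lt_iff] at hxR
    refine (hx hxR.1.le).trans ?_
    rw [mul_assoc]
    have h0 : 0 < ‖x‖ := by linarith
    have h1 : ‖x‖ ^ (-τ) ≤ 2 ^ τ * (1 + ‖x‖) ^ (-τ) := by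
      have e : (2 : ℝ) ^ τ * (1 + ‖x‖) ^ (-τ) = ((1 + ‖x‖) / 2) ^ (-τ) := by
        rw [Real.div_rpow (by positivity) (by norm_num), Real.rpow_neg (by norm_num : (0:ℝ) ≤ 2)]
        field_simp
      rw [e]
      exact Real.rpow_le_rpow_of_nonpos (by positivity) (by linarith) (by linarith)
    exact mul_le_mul (le_abs_self C) h1 (by positivity) (abs_nonneg C)

theorem aestronglyMeasurable (hB : IsAdmissibleField B) : AEStronglyMeasurable B := by
  obtain ⟨p, hp, hloc⟩ := hB.locLp
  have : (⋃ n : ℕ, Metric.closedBall (0 : Plane) n) = univ := by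
    rw [Metric.iUnion_closedBall_nat]
  rw [← Measure.restrict_univ (μ := volume), ← this]
  exact AEStronglyMeasurable.iUnion fun n => (hloc _ (isCompact_closedBall _ _)).1

theorem integrable_mul (hB : IsAdmissibleField B) :
    ∃ s : ℝ, 0 < s ∧ Integrable fun x => B x * (1 + ‖x‖) ^ s := by
  obtain ⟨R, C, τ, hτ, hC, h1, h2⟩ := hB.exists_bound
  have : IsFiniteMeasure (volume.restrict (Metric.closedBall (0 : Plane) R)) :=
    isFiniteMeasure_restrict_closedBall _
  have hcont : Continuous fun x : Plane => (1 + ‖x‖) ^ ((τ - 2) / 2) :=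
    Continuous.rpow_const (by fun_prop) fun x => Or.inr (by linarith)
  -- Half of the surplus decay: the exponent `-τ + (τ-2)/2 = -(τ+2)/2` is still below `-2`.
  refine ⟨(τ - 2) / 2, by linarith, ?_⟩
  rw [← integrableOn_univ, ← union_compl_self (Metric.closedBall (0 : Plane) R)]
  refine IntegrableOn.union ?_ ?_
  · obtain ⟨M, hM⟩ := (isCompact_closedBall (0 : Plane) R).exists_bound_of_continuousOn
      hcont.continuousOn
    refine (h1.integrable (by norm_num)).mul_bdd (c := M) hcont.aestronglyMeasurable ?_
    filter_upwards [self_mem_ae_restrict Metric.isClosed_closedBall.measurableSet] with x hx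
      using hM x hx
  · have h3 : Integrable fun x : Plane => C * (1 + ‖x‖) ^ (-((τ + 2) / 2)) := by
      refine Integrable.const_mul (integrable_one_add_norm ?_) C
      simp; linarith
    refine Integrable.mono' h3.integrableOn
      ((hB.aestronglyMeasurable.mul hcont.aestronglyMeasurable).restrict) ?_
    rw [ae_restrict_iff' Metric.isClosed_closedBall.measurableSet.compl]
    filter_upwards [h2] with x hx hxR
    have hp : 0 < 1 + ‖x‖ := by positivity
    rw [norm_mul, Real.norm_eq_abs, Real.norm_of_nonneg (by positivity)]
    calc _ ≤ C * (1 + ‖x‖) ^ (-τ) * (1 + ‖x‖) ^ ((τ - 2) / 2) := by gcongr; exact hx hxR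
      _ = _ := by
        rw [mul_assoc, ← Real.rpow_add hp]; congr 2; ring

theorem integrable (hB : IsAdmissibleField B) : Integrable B := by
  obtain ⟨s, hs, h⟩ := hB.integrable_mul
  refine h.mono hB.aestronglyMeasurable (Eventually.of_forall fun x => ?_)
  have h1 : 1 ≤ (1 + ‖x‖) ^ s := Real.one_le_rpow (by linarith [norm_nonneg x]) hs.le
  rw [norm_mul, Real.norm_of_nonneg (by positivity : 0 ≤ (1 + ‖x‖) ^ s)]
  nlinarith [norm_nonneg (B x)]

theorem integrable_mul_log_one_add (hB : IsAdmissibleField B) :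
    Integrable fun x => |B x| * Real.log (1 + ‖x‖) := by
  obtain ⟨s, hs, h⟩ := hB.integrable_mul
  have hm : Measurable fun x : Plane => Real.log (1 + ‖x‖) := by fun_prop
  refine (h.const_mul s⁻¹).mono (hB.aestronglyMeasurable.norm.mul hm.aestronglyMeasurable)
    (Eventually.of_forall fun x => ?_)
  have h0 : 0 ≤ Real.log (1 + ‖x‖) := Real.log_nonneg (by linarith [norm_nonneg x])
  have h1 := Real.log_le_rpow_div (show 0 ≤ 1 + ‖x‖ by positivity) hs
  rw [norm_mul, norm_mul, norm_mul, Real.norm_of_nonneg h0,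
    Real.norm_of_nonneg (by positivity : 0 ≤ (1 + ‖x‖) ^ s), Real.norm_of_nonneg (by positivity),
    Real.norm_of_nonneg (inv_nonneg.2 hs.le), Real.norm_eq_abs]
  calc _ ≤ |B x| * ((1 + ‖x‖) ^ s / s) := by gcongr
    _ = _ := by ring

theorem memLp_two (hB : IsAdmissibleField B) : MemLp B 2 := by
  obtain ⟨R, C, τ, hτ, hC, h1, h2⟩ := hB.exists_bound
  rw [memLp_two_iff_integrable_sq hB.aestronglyMeasurable, ← integrableOn_univ,
    ← union_compl_self (Metric.closedBall (0 : Plane) R)]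
  refine IntegrableOn.union h1.integrable_sq ?_
  have h3 : Integrable fun x : Plane => C ^ 2 * (1 + ‖x‖) ^ (-(2 * τ)) := by
    refine Integrable.const_mul (integrable_one_add_norm ?_) _
    simp; linarith
  refine Integrable.mono' h3.integrableOn (hB.aestronglyMeasurable.pow 2).restrict ?_
  rw [ae_restrict_iff' Metric.isClosed_closedBall.measurableSet.compl]
  filter_upwards [h2] with x hx hxR
  have hp : 0 < 1 + ‖x‖ := by positivity
  rw [norm_pow, Real.norm_eq_abs]
  calc _ ≤ (C * (1 + ‖x‖) ^ (-τ)) ^ 2 := pow_le_pow_left₀ (abs_nonneg _) (hx hxR) 2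
    _ = _ := by
      rw [mul_pow, ← Real.rpow_natCast, ← Real.rpow_natCast, ← Real.rpow_mul hp.le]
      congr 2; push_cast; ring

theorem neg (hB : IsAdmissibleField B) : IsAdmissibleField (fun x => -B x) := by
  refine ⟨?_, ?_⟩
  · obtain ⟨p, hp, h⟩ := hB.locLp
    exact ⟨p, hp, fun K hK => (h K hK).neg⟩
  · simpa using hB.decay

/-- An integrable majorant of the integrand of `h(x) + α log (1 + |x|)`. -/
theorem integrable_majorant (hB : IsAdmissibleField B) (x : Plane) :
    Integrable fun y => |B y| * Real.log (1 + ‖y‖) + (|B y| + B y ^ 2 + nearKernel (x - y)) :=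
  hB.integrable_mul_log_one_add.add
    ((hB.integrable.abs.add hB.memLp_two.integrable_sq).add (integrable_nearKernel.comp_sub_left x))

theorem norm_mul_log_sub_le (B : Plane → ℝ) (x y : Plane) :
    ‖B y * (Real.log ‖x - y‖ - Real.log (1 + ‖x‖))‖ ≤
      |B y| * Real.log (1 + ‖y‖) + (|B y| + B y ^ 2 + nearKernel (x - y)) := by
  rw [norm_mul, Real.norm_eq_abs, Real.norm_eq_abs]
  have h1 := mul_le_mul_of_nonneg_left (abs_log_norm_sub_sub_le x y) (abs_nonneg (B y))
  have h2 := abs_mul_log_one_add_inv_le (B y) (x - y)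
  rw [mul_add] at h1
  linarith

theorem integrable_mul_log_sub (hB : IsAdmissibleField B) (x : Plane) :
    Integrable fun y => B y * (Real.log ‖x - y‖ - Real.log (1 + ‖x‖)) := by
  refine (hB.integrable_majorant x).mono' ?_ (Eventually.of_forall (norm_mul_log_sub_le B x))
  have hm : Measurable fun y : Plane => Real.log ‖x - y‖ - Real.log (1 + ‖x‖) := by fun_prop
  exact hB.aestronglyMeasurable.mul hm.aestronglyMeasurable

theorem integrable_mul_log (hB : IsAdmissibleField B) (x : Plane) :
    Integrable fun y => B y * Real.log ‖x - y‖ := by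
  have := (hB.integrable_mul_log_sub x).add (hB.integrable.mul_const (Real.log (1 + ‖x‖)))
  refine this.congr (Eventually.of_forall fun y => ?_)
  simp only [Pi.add_apply]; ring

/-- The majorant depends on `x` only through a translate of `nearKernel`, so its integral does not
depend on `x`. -/
theorem exists_integral_norm_mul_log_sub_le (hB : IsAdmissibleField B) : ∃ C : ℝ, 0 ≤ C ∧
    ∀ x, ∫ y, ‖B y * (Real.log ‖x - y‖ - Real.log (1 + ‖x‖))‖ ≤ C := by
  refine ⟨∫ y, (|B y| * Real.log (1 + ‖y‖) + (|B y| + B y ^ 2 + nearKernel (0 - y))), ?_,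
    fun x => ?_⟩
  · exact integral_nonneg fun y => (norm_nonneg _).trans (norm_mul_log_sub_le B 0 y)
  · refine (integral_mono (hB.integrable_mul_log_sub x).norm (hB.integrable_majorant x)
      (norm_mul_log_sub_le B x)).trans (le_of_eq ?_)
    have i1 := hB.integrable_mul_log_one_add
    have i2 : Integrable fun y => |B y| + B y ^ 2 :=
      hB.integrable.abs.add hB.memLp_two.integrable_sq
    have e : ∀ z : Plane, ∫ y, (|B y| * Real.log (1 + ‖y‖) +
        (|B y| + B y ^ 2 + nearKernel (z - y))) = (∫ y, |B y| * Real.log (1 + ‖y‖)) +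
        ((∫ y, (|B y| + B y ^ 2)) + ∫ y, nearKernel y) := by
      intro z
      have i3 : Integrable fun y => |B y| + B y ^ 2 + nearKernel (z - y) :=
        i2.add (integrable_nearKernel.comp_sub_left z)
      rw [integral_add i1 i3, integral_add i2 (integrable_nearKernel.comp_sub_left z),
        integral_sub_left_eq_self nearKernel volume z]
    rw [e, e]

theorem superpotential_add_eq (hB : IsAdmissibleField B) (x : Plane) :
    superpotential B x + flux B * Real.log (1 + ‖x‖) =
      -(2 * Real.pi)⁻¹ * ∫ y, B y * (Real.log ‖x - y‖ - Real.log (1 + ‖x‖)) := by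
  simp only [mul_sub]
  rw [integral_sub (hB.integrable_mul_log x) (hB.integrable.mul_const _), integral_mul_const,
    superpotential, flux]
  ring

theorem exists_abs_superpotential_add_le (hB : IsAdmissibleField B) : ∃ C : ℝ, ∀ x,
    |superpotential B x + flux B * Real.log (1 + ‖x‖)| ≤ C := by
  obtain ⟨C, hC0, hC⟩ := hB.exists_integral_norm_mul_log_sub_le
  refine ⟨(2 * Real.pi)⁻¹ * C, fun x => ?_⟩
  have hpi := Real.pi_pos
  rw [hB.superpotential_add_eq, abs_mul, abs_neg, abs_of_pos (by positivity)]
  gcongr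
  exact (norm_integral_le_integral_norm _).trans (hC x)

/-- The logarithm of the ratio differs from `-(h + α log(1+|x|))` by a bounded function, hence is
bounded. The sign of the flux plays no role, so the result also serves `-B`. -/
theorem exists_ratioPlus_bounds (hB : IsAdmissibleField B) {ρ : ℝ} (hρ : 0 < ρ) :
    ∃ c C : ℝ, 0 < c ∧ ∀ x, c ≤ ratioPlus B ρ x ∧ ratioPlus B ρ x ≤ C := by
  obtain ⟨M, hM⟩ := hB.exists_abs_superpotential_add_le
  set N := M + |flux B| * (|Real.log ρ| + Real.log (1 + ρ) + Real.log (1 + ρ⁻¹)) with hN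
  refine ⟨Real.exp (-N), Real.exp N, Real.exp_pos _, fun x => ?_⟩
  have e : ratioPlus B ρ x =
      Real.exp (-superpotential B x - flux B * Real.log (max ‖x‖ ρ / ρ)) := by
    rw [ratioPlus, gPlus_eq_exp hρ, ← Real.exp_sub]
  have h1 := hM x
  have h2 : |flux B * (Real.log (max ‖x‖ ρ / ρ) - Real.log (1 + ‖x‖))| ≤
      |flux B| * (|Real.log ρ| + Real.log (1 + ρ) + Real.log (1 + ρ⁻¹)) := by
    rw [abs_mul]
    exact mul_le_mul_of_nonneg_left (abs_log_max_div_sub_le hρ (norm_nonneg x)) (abs_nonneg _)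
  rw [abs_le] at h1 h2
  rw [e, Real.exp_le_exp, Real.exp_le_exp]
  constructor <;> linarith

end IsAdmissibleField

end PauliHardy
end

noncomputable section

namespace PauliHardy

/-! ### Mollification -/

section mollify

variable {F : Type*} [NormedAddCommGroup F] [NormedSpace ℝ F]

/-- The convolution of a scalar kernel with a vector-valued function. -/
def mollify (η : Plane → ℝ) (g : Plane → F) (x : Plane) : F := ∫ y, η (x - y) • g y

theorem mollify_eq_convolution (η : Plane → ℝ) (g : Plane → F) :
    mollify η g = convolution η g (ContinuousLinearMap.lsmul ℝ ℝ) volume := by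
  ext x
  rw [convolution_lsmul_swap, mollify]

variable {η : Plane → ℝ} {g : Plane → F}

theorem integrable_mollify (hη : Continuous η) (hc : HasCompactSupport η)
    (hg : LocallyIntegrable g) (x : Plane) : Integrable fun y => η (x - y) • g y :=
  ((hc.convolutionExists_left (ContinuousLinearMap.lsmul ℝ ℝ) hη hg) x).integrable_swap

theorem contDiff_mollify (hη : ContDiff ℝ ∞ η) (hc : HasCompactSupport η)
    (hg : LocallyIntegrable g) : ContDiff ℝ ∞ (mollify η g) := by
  rw [mollify_eq_convolution]
  exact hc.contDiff_convolution_left _ hη hg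

theorem pd_mollify (hη : ContDiff ℝ ∞ η) (hc : HasCompactSupport η)
    (hg : LocallyIntegrable g) (j : Fin 2) : pd j (mollify η g) = mollify (pd j η) g := by
  ext x
  have h := hc.hasFDerivAt_convolution_left (ContinuousLinearMap.lsmul ℝ ℝ)
    (hη.of_le one_le_infty) hg x
  have hex := (hc.fderiv (𝕜 := ℝ)).convolutionExists_left
    ((ContinuousLinearMap.lsmul ℝ ℝ : ℝ →L[ℝ] F →L[ℝ] F).precompL Plane)
    (hη.continuous_fderiv (by simp)) hg x
  rw [← mollify_eq_convolution] at h
  rw [pd, h.fderiv, convolution_eq_swap, ContinuousLinearMap.integral_apply hex.integrable_swap]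
  rfl

theorem pd_comp_const_sub {c : Plane} (hη : Differentiable ℝ η) (j : Fin 2) (y : Plane) :
    pd j (fun y => η (c - y)) y = -pd j η (c - y) := by
  have h : HasFDerivAt (fun y => η (c - y)) _ y :=
    (hη (c - y)).hasFDerivAt.comp y ((hasFDerivAt_id y).const_sub c)
  rw [pd, h.fderiv]
  simp [pd]

theorem contDiff_comp_const_sub (hη : ContDiff ℝ ∞ η) (c : Plane) :
    ContDiff ℝ ∞ fun y => η (c - y) := hη.comp (contDiff_const.sub contDiff_id)

theorem hasCompactSupport_comp_const_sub {E : Type*} [Zero E] {k : Plane → E}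
    (hc : HasCompactSupport k) (c : Plane) : HasCompactSupport fun y => k (c - y) :=
  hc.comp_homeomorph (Homeomorph.subLeft c)

theorem lap_comp_const_sub (hη : ContDiff ℝ ∞ η) (c y : Plane) :
    lap (fun y => η (c - y)) y = lap η (c - y) := by
  have d := hη.differentiable (by simp)
  have e : ∀ j, pd j (fun y => η (c - y)) = fun y => -pd j η (c - y) := fun j =>
    funext fun y => pd_comp_const_sub d j y
  have e2 : ∀ j, pd j (fun y => -pd j η (c - y)) y = pd j (pd j η) (c - y) := fun j => by
    have h := pd_comp_const_sub (c := c) ((contDiff_pd hη j).differentiable (by simp)) j y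
    have h2 : pd j (fun y => -pd j η (c - y)) y = - pd j (fun y => pd j η (c - y)) y := by
      unfold pd
      rw [fderiv_fun_neg]; simp
    rw [h2, h, neg_neg]
  simp only [lap, e, e2]

end mollify

theorem isTest_comp_const_sub {η : Plane → ℝ} (hη : ContDiff ℝ ∞ η) (hc : HasCompactSupport η)
    (c : Plane) : IsTest fun y => η (c - y) :=
  ⟨contDiff_comp_const_sub hη c, hasCompactSupport_comp_const_sub hc c⟩

variable {B : Plane → ℝ} {η : Plane → ℝ}

theorem IsAdmissibleField.aestronglyMeasurable_kernel (hB : IsAdmissibleField B) :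
    AEStronglyMeasurable (fun p : Plane × Plane => B p.2 * Real.log ‖p.1 - p.2‖)
      (volume.prod volume) := by
  have hm : Measurable fun p : Plane × Plane => Real.log ‖p.1 - p.2‖ := by fun_prop
  exact hB.aestronglyMeasurable.comp_snd.mul hm.aestronglyMeasurable

theorem IsAdmissibleField.aestronglyMeasurable_superpotential (hB : IsAdmissibleField B) :
    AEStronglyMeasurable (superpotential B) :=
  (hB.aestronglyMeasurable_kernel.integral_prod_right').const_mul _

theorem IsAdmissibleField.locallyIntegrable_superpotential (hB : IsAdmissibleField B) :
    LocallyIntegrable (superpotential B) := by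
  obtain ⟨C, hC⟩ := hB.exists_abs_superpotential_add_le
  have hc : Continuous fun x : Plane => C + |flux B| * Real.log (1 + ‖x‖) := by
    refine continuous_const.add (continuous_const.mul (Continuous.log (by fun_prop) fun x => ?_))
    positivity
  refine hc.locallyIntegrable.mono hB.aestronglyMeasurable_superpotential
    (Eventually.of_forall fun x => ?_)
  have h1 := hC x
  have h0 : 0 ≤ Real.log (1 + ‖x‖) := Real.log_nonneg (by linarith [norm_nonneg x])
  have h2 : |superpotential B x| ≤ C + |flux B| * Real.log (1 + ‖x‖) := by
    have h3 : superpotential B x = (superpotential B x + flux B * Real.log (1 + ‖x‖)) -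
      flux B * Real.log (1 + ‖x‖) := by ring
    rw [h3]
    refine (abs_sub _ _).trans (add_le_add h1 (le_of_eq ?_))
    rw [abs_mul, abs_of_nonneg h0]
  exact h2.trans (le_abs_self _)

/-- The mollified superpotential solves the Poisson equation for the mollified field. -/
theorem IsAdmissibleField.lap_mollify_superpotential (hB : IsAdmissibleField B)
    (hη : ContDiff ℝ ∞ η) (hc : HasCompactSupport η) (x : Plane) :
    lap (mollify η (superpotential B)) x = -mollify η B x := by
  have hli := hB.locallyIntegrable_superpotential
  have e1 : lap (mollify η (superpotential B)) x = ∫ y, lap η (x - y) * superpotential B y := by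
    simp only [lap]
    rw [pd_mollify hη hc hli, pd_mollify hη hc hli,
      pd_mollify (contDiff_pd hη 0) (hasCompactSupport_pd hc 0) hli,
      pd_mollify (contDiff_pd hη 1) (hasCompactSupport_pd hc 1) hli]
    simp only [mollify]
    rw [← integral_add
      (integrable_mollify (contDiff_pd (contDiff_pd hη 0) 0).continuous
        (hasCompactSupport_pd (hasCompactSupport_pd hc 0) 0) hli x)
      (integrable_mollify (contDiff_pd (contDiff_pd hη 1) 1).continuous
        (hasCompactSupport_pd (hasCompactSupport_pd hc 1) 1) hli x)]
    refine integral_congr_ae (Eventually.of_forall fun y => ?_)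
    simp only [smul_eq_mul]; ring
  set l : Plane → ℝ := fun y => lap η (x - y) with hl
  have cl : Continuous l := (contDiff_lap hη).continuous.comp (by fun_prop)
  have sl : HasCompactSupport l := hasCompactSupport_comp_const_sub (hasCompactSupport_lap hc) x
  have hk : AEStronglyMeasurable (fun p : Plane × Plane => l p.1 * (B p.2 * Real.log ‖p.1 - p.2‖))
      (volume.prod volume) :=
    (cl.comp continuous_fst).aestronglyMeasurable.mul hB.aestronglyMeasurable_kernel
  obtain ⟨C, hC0, hC⟩ := hB.exists_integral_norm_mul_log_sub_le
  -- Fubini is justified since the inner absolute integral grows at most like `C + ‖B‖₁ log(1+|y|)`,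
  -- while `l` has compact support.
  have hki : Integrable (fun p : Plane × Plane => l p.1 * (B p.2 * Real.log ‖p.1 - p.2‖))
      (volume.prod volume) := by
    rw [integrable_prod_iff hk]
    refine ⟨Eventually.of_forall fun y => (hB.integrable_mul_log y).const_mul (l y), ?_⟩
    have hcont : Continuous fun y : Plane => C + (∫ z, |B z|) * Real.log (1 + ‖y‖) := by
      refine continuous_const.add (continuous_const.mul
        (Continuous.log (by fun_prop) fun x => ?_))
      positivity
    have hi : Integrable fun y => ‖l y‖ * (C + (∫ z, |B z|) * Real.log (1 + ‖y‖)) :=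
      (cl.norm.mul hcont).integrable_of_hasCompactSupport sl.norm.mul_right
    refine hi.mono' hk.norm.integral_prod_right' (Eventually.of_forall fun y => ?_)
    rw [Real.norm_of_nonneg (integral_nonneg fun z => norm_nonneg _)]
    simp only [norm_mul (l y)]
    rw [integral_const_mul]
    refine mul_le_mul_of_nonneg_left ?_ (norm_nonneg _)
    have h0 : 0 ≤ Real.log (1 + ‖y‖) := Real.log_nonneg (by linarith [norm_nonneg y])
    refine le_trans (integral_mono (g := fun z => ‖B z * (Real.log ‖y - z‖ - Real.log (1 + ‖y‖))‖ +
      |B z| * Real.log (1 + ‖y‖)) (hB.integrable_mul_log y).norm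
      ((hB.integrable_mul_log_sub y).norm.add (hB.integrable.abs.mul_const _)) fun z => ?_) ?_
    · have e : B z * Real.log ‖y - z‖ = B z * (Real.log ‖y - z‖ - Real.log (1 + ‖y‖)) +
        B z * Real.log (1 + ‖y‖) := by ring
      simp only
      rw [e]
      refine (norm_add_le _ _).trans (add_le_add le_rfl (le_of_eq ?_))
      rw [norm_mul, Real.norm_eq_abs, Real.norm_of_nonneg h0]
    · rw [integral_add (hB.integrable_mul_log_sub y).norm (hB.integrable.abs.mul_const _),
        integral_mul_const]
      exact add_le_add (hC y) le_rfl
  have e2 : ∫ y, l y * superpotential B y =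
      -(2 * Real.pi)⁻¹ * ∫ y, ∫ z, l y * (B z * Real.log ‖y - z‖) := by
    rw [← integral_const_mul]
    refine integral_congr_ae (Eventually.of_forall fun y => ?_)
    simp only [superpotential]
    rw [integral_const_mul]; ring
  -- After translating by `z`, the fundamental solution is tested against `y ↦ η(x - z - y)`, whose
  -- value at the origin is `η(x - z)`.
  have e3 : ∀ z, ∫ y, l y * (B z * Real.log ‖y - z‖) = 2 * Real.pi * (η (x - z) * B z) := by
    intro z
    have h1 := integral_log_norm_mul_lap_real (contDiff_comp_const_sub hη (x - z))
      (hasCompactSupport_comp_const_sub hc (x - z))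
    simp_rw [lap_comp_const_sub hη] at h1
    rw [← integral_sub_right_eq_self _ z, sub_zero] at h1
    calc _ = B z * ∫ y, Real.log ‖y - z‖ * lap η (x - z - (y - z)) := by
          rw [← integral_const_mul]
          refine integral_congr_ae (Eventually.of_forall fun y => ?_)
          simp only [hl, sub_sub_sub_cancel_right]; ring
      _ = _ := by rw [h1]; ring
  rw [e1, e2, integral_integral_swap hki]
  simp_rw [e3]
  rw [integral_const_mul, mollify]
  have := Real.pi_pos.ne'
  simp only [smul_eq_mul]
  field_simp

theorem locallyIntegrable_of_memLp_top {F : Type*} [NormedAddCommGroup F] {A : Plane → F}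
    (hA : MemLp A ⊤) : LocallyIntegrable A :=
  hA.locallyIntegrable le_top

theorem mollify_apply {A : Plane → Plane} (hη : Continuous η) (hc : HasCompactSupport η)
    (hA : LocallyIntegrable A) (i : Fin 2) (x : Plane) :
    mollify η A x i = mollify η (fun y => A y i) x := by
  exact ((EuclideanSpace.proj i : Plane →L[ℝ] ℝ).integral_comp_comm
    (integrable_mollify hη hc hA x)).symm

theorem locallyIntegrable_apply {A : Plane → Plane} (hA : LocallyIntegrable A) (i : Fin 2) :
    LocallyIntegrable fun y => A y i :=
  hA.mono ((EuclideanSpace.proj (𝕜 := ℝ) i).continuous.comp_aestronglyMeasurable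
    hA.aestronglyMeasurable) (Eventually.of_forall fun x => PiLp.norm_apply_le (A x) i)

theorem contDiff_mollify_apply {A : Plane → Plane} (hη : ContDiff ℝ ∞ η)
    (hc : HasCompactSupport η) (hA : LocallyIntegrable A) (i : Fin 2) :
    ContDiff ℝ ∞ fun x => mollify η A x i := by
  simp_rw [mollify_apply hη.continuous hc hA]
  exact contDiff_mollify hη hc (locallyIntegrable_apply hA i)

/-- Mollification commutes with the distributional curl. -/
theorem curl_mollify {A : Plane → Plane} (hη : ContDiff ℝ ∞ η) (hc : HasCompactSupport η)
    (hA : LocallyIntegrable A) (hAB : HasDistribCurl A B) (x : Plane) :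
    pd 0 (fun y => mollify η A y 1) x - pd 1 (fun y => mollify η A y 0) x = mollify η B x := by
  simp_rw [mollify_apply hη.continuous hc hA]
  have hA' := locallyIntegrable_apply hA
  rw [pd_mollify hη hc (hA' 1), pd_mollify hη hc (hA' 0)]
  have h := hAB _ (isTest_comp_const_sub hη hc x)
  simp_rw [partialDeriv_eq_pd, pd_comp_const_sub (hη.differentiable (by simp))] at h
  simp only [mollify]
  rw [← integral_sub
    (integrable_mollify (contDiff_pd hη 0).continuous (hasCompactSupport_pd hc 0) (hA' 1) x)
    (integrable_mollify (contDiff_pd hη 1).continuous (hasCompactSupport_pd hc 1) (hA' 0) x)]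
  simp only [smul_eq_mul]
  calc _ = ∫ y, (A y 0 * -pd 1 η (x - y) - A y 1 * -pd 0 η (x - y)) := by
        refine integral_congr_ae (Eventually.of_forall fun y => ?_)
        simp only; ring
    _ = _ := by rw [h]; simp_rw [mul_comm]

end PauliHardy
end

noncomputable section

namespace PauliHardy

/-! ### Passing to the limit in the mollification -/

section bump

variable (φ : ContDiffBump (0 : Plane))

theorem integral_normed_comp_sub (x : Plane) : ∫ y, φ.normed volume (x - y) = 1 := by
  rw [integral_sub_left_eq_self (φ.normed volume) volume x, φ.integral_normed]

theorem norm_mollify_normed_le {F : Type*} [NormedAddCommGroup F] [NormedSpace ℝ F]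
    {g : Plane → F} {C : ℝ} (hg : ∀ᵐ y, ‖g y‖ ≤ C) (x : Plane) :
    ‖mollify (φ.normed volume) g x‖ ≤ C := by
  have hi : Integrable fun y => φ.normed volume (x - y) := φ.integrable_normed.comp_sub_left x
  calc ‖mollify (φ.normed volume) g x‖ ≤ ∫ y, φ.normed volume (x - y) * C := by
        refine norm_integral_le_of_norm_le (hi.mul_const C) ?_
        filter_upwards [hg] with y hy
        rw [norm_smul, Real.norm_of_nonneg (φ.nonneg_normed _)]
        exact mul_le_mul_of_nonneg_left hy (φ.nonneg_normed _)
    _ = C := by rw [integral_mul_const, integral_normed_comp_sub, one_mul]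

/-- The kernel is a probability density supported in a ball, so only values of `g` within `rOut` of
`x` count. -/
theorem le_mollify_normed {g : Plane → ℝ} (hg : LocallyIntegrable g) {c : ℝ} {x : Plane}
    (h : ∀ y, ‖x - y‖ < φ.rOut → c ≤ g y) : c ≤ mollify (φ.normed volume) g x := by
  have hi : Integrable fun y => φ.normed volume (x - y) := φ.integrable_normed.comp_sub_left x
  calc c = ∫ y, φ.normed volume (x - y) * c := by
        rw [integral_mul_const, integral_normed_comp_sub, one_mul]
    _ ≤ _ := by
      refine integral_mono (hi.mul_const c)
        (integrable_mollify φ.continuous_normed φ.hasCompactSupport_normed hg x) fun y => ?_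
      simp only [smul_eq_mul]
      by_cases hy : ‖x - y‖ < φ.rOut
      · exact mul_le_mul_of_nonneg_left (h y hy) (φ.nonneg_normed _)
      · have : φ.normed volume (x - y) = 0 := by
          rw [← Function.notMem_support, φ.support_normed_eq]
          simpa using hy
        simp [this]

theorem mollify_normed_le {g : Plane → ℝ} (hg : LocallyIntegrable g) {c : ℝ} {x : Plane}
    (h : ∀ y, ‖x - y‖ < φ.rOut → g y ≤ c) : mollify (φ.normed volume) g x ≤ c := by
  have h1 := le_mollify_normed φ (g := fun y => -g y) hg.neg (c := -c) (x := x)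
    fun y hy => neg_le_neg (h y hy)
  have h2 : mollify (φ.normed volume) (fun y => -g y) x = -mollify (φ.normed volume) g x := by
    simp only [mollify, smul_neg, integral_neg]
  linarith

end bump

theorem abs_log_max_div_sub_log_max_div_le {ρ : ℝ} (hρ : 0 < ρ) (r s : ℝ) :
    |Real.log (max r ρ / ρ) - Real.log (max s ρ / ρ)| ≤ |r - s| / ρ := by
  have key : ∀ r s : ℝ, Real.log (max r ρ / ρ) - Real.log (max s ρ / ρ) ≤ |r - s| / ρ := by
    intro r s
    have hr : 0 < max r ρ := lt_max_of_lt_right hρ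
    have hs : 0 < max s ρ := lt_max_of_lt_right hρ
    rw [Real.log_div hr.ne' hρ.ne', Real.log_div hs.ne' hρ.ne', sub_sub_sub_cancel_right,
      ← Real.log_div hr.ne' hs.ne']
    refine (Real.log_le_sub_one_of_pos (by positivity)).trans ?_
    have h1 : max r ρ - max s ρ ≤ |r - s| := (le_abs_self _).trans
      ((abs_max_sub_max_le_max r ρ s ρ).trans (by simp))
    rw [div_sub_one hs.ne']
    calc _ ≤ |r - s| / max s ρ := by gcongr
      _ ≤ |r - s| / ρ := by gcongr; exact le_max_right _ _
  rw [abs_le]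
  constructor
  · have := key s r
    rw [abs_sub_comm] at this
    linarith
  · exact key r s

/-- `log g₊` is Lipschitz with constant `α/ρ`; mollification therefore changes the comparison
constants by a factor tending to `1`. -/
theorem gPlus_le_exp_mul {α ρ : ℝ} (hρ : 0 < ρ) (hα : 0 ≤ α) {x y : Plane} {ε : ℝ}
    (hxy : ‖x - y‖ ≤ ε) :
    gPlus α ρ ‖x‖ ≤ Real.exp (α * (ε / ρ)) * gPlus α ρ ‖y‖ := by
  rw [gPlus_eq_exp hρ, gPlus_eq_exp hρ, ← Real.exp_add, Real.exp_le_exp, ← mul_add]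
  refine mul_le_mul_of_nonneg_left ?_ hα
  have h1 := (abs_le.1 (abs_log_max_div_sub_log_max_div_le hρ ‖x‖ ‖y‖)).2
  have h2 : |‖x‖ - ‖y‖| / ρ ≤ ε / ρ := by
    gcongr
    exact (abs_norm_sub_norm_le x y).trans hxy
  linarith

variable {B : Plane → ℝ} {A : Plane → Plane}

/-- The Hardy inequality for the mollified magnetic field. -/
theorem hardy_mollified (hB : IsAdmissibleField B) {CA : ℝ} (hA : LocallyIntegrable A)
    (hCA : ∀ᵐ x, ‖A x‖ ≤ CA) (hAB : HasDistribCurl A B) {α ρ k K : ℝ} (hρ : 0 < ρ)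
    (hα : 0 ≤ α) (hk : 0 < k) (hK : 0 < K)
    (hkg : ∀ x, k * gPlus α ρ ‖x‖ ≤ Real.exp (-superpotential B x))
    (hKg : ∀ x, Real.exp (-superpotential B x) ≤ K * gPlus α ρ ‖x‖)
    {u : Plane → ℂ} (hu : ContDiff ℝ ∞ u) (hc : HasCompactSupport u)
    (φ : ContDiffBump (0 : Plane)) :
    (k * Real.exp (-(α * (φ.rOut / ρ))) / (K * Real.exp (α * (φ.rOut / ρ)))) ^ 2 *
      ∫ x, hardyProfile α ρ ‖x‖ * ‖u x‖ ^ 2 ≤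
        ∫ x, formDensity (mollify (φ.normed volume) A) u x := by
  have sη : ContDiff ℝ ∞ (φ.normed volume) := φ.contDiff_normed
  have cη := φ.hasCompactSupport_normed (μ := volume)
  have hli := hB.locallyIntegrable_superpotential
  set E := Real.exp (α * (φ.rOut / ρ)) with hE
  have hE0 : 0 < E := Real.exp_pos _
  have hEi : Real.exp (-(α * (φ.rOut / ρ))) = E⁻¹ := Real.exp_neg _
  rw [hEi]
  have mA : AEStronglyMeasurable (mollify (φ.normed volume) A) :=
    (contDiff_mollify sη cη hA).continuous.aestronglyMeasurable
  refine hardy_smooth (h := mollify (φ.normed volume) (superpotential B))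
    (contDiff_mollify_apply sη cη hA) (contDiff_mollify sη cη hli) (fun x => ?_) mA
    (Eventually.of_forall (norm_mollify_normed_le φ hCA)) hρ hα (by positivity) (by positivity)
    (fun x => ?_) (fun x => ?_) hu hc
  · have h1 := curl_mollify sη cη hA hAB x
    have h2 := hB.lap_mollify_superpotential sη cη x
    rw [lap] at h2
    rw [h1, h2]; ring
  · have hg := gPlus_pos (α := α) (r := ‖x‖) hρ
    -- The bounds are averaged after taking logarithms, because it is `h` that is mollified and not
    -- `e^{-h}`.
    have h1 : mollify (φ.normed volume) (superpotential B) x ≤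
        -Real.log (k * E⁻¹ * gPlus α ρ ‖x‖) := by
      refine mollify_normed_le φ hli fun y hy => ?_
      rw [le_neg, Real.log_le_iff_le_exp (by positivity)]
      refine le_trans ?_ (hkg y)
      have h2 := gPlus_le_exp_mul hρ hα hy.le
      rw [mul_assoc, inv_mul_eq_div]
      gcongr
      rw [div_le_iff₀ hE0, mul_comm]
      exact h2
    have h3 := Real.exp_le_exp.2 (le_neg.1 h1)
    rwa [Real.exp_log (by positivity)] at h3
  · have hg := gPlus_pos (α := α) (r := ‖x‖) hρ
    have h1 : -Real.log (K * E * gPlus α ρ ‖x‖) ≤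
        mollify (φ.normed volume) (superpotential B) x := by
      refine le_mollify_normed φ hli fun y hy => ?_
      rw [neg_le, Real.le_log_iff_exp_le (by positivity)]
      refine (hKg y).trans ?_
      have h2 := gPlus_le_exp_mul (x := y) (y := x) hρ hα ((norm_sub_rev y x).trans_le hy.le)
      rw [mul_assoc]
      gcongr
    have h3 := Real.exp_le_exp.2 (neg_le.1 h1)
    rwa [Real.exp_log (by positivity)] at h3

/-- A sequence of bump functions shrinking to the origin. -/
def shrinkingBump (n : ℕ) : ContDiffBump (0 : Plane) where
  rIn := 1 / ((n : ℝ) + 1) / 2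
  rOut := 1 / ((n : ℝ) + 1)
  rIn_pos := by positivity
  rIn_lt_rOut := half_lt_self (by positivity)

theorem tendsto_rOut_shrinkingBump :
    Tendsto (fun n => (shrinkingBump n).rOut) atTop (nhds 0) :=
  tendsto_one_div_add_atTop_nhds_zero_nat

theorem ae_tendsto_mollify_shrinkingBump {F : Type*} [NormedAddCommGroup F] [NormedSpace ℝ F]
    [CompleteSpace F] {g : Plane → F} (hg : LocallyIntegrable g) :
    ∀ᵐ x, Tendsto (fun n => mollify ((shrinkingBump n).normed volume) g x) atTop (nhds (g x)) := by
  simp_rw [mollify_eq_convolution]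
  -- Convergence almost everywhere needs the ratio `rOut / rIn` bounded; here it equals `2`.
  refine ContDiffBump.ae_convolution_tendsto_right_of_locallyIntegrable (K := 2)
    tendsto_rOut_shrinkingBump (Eventually.of_forall fun n => ?_) hg
  simp only [shrinkingBump]
  linarith

/-- Written as a perfect square, the form involves `A` alone. A uniform bound and convergence almost
everywhere suffice; the mollified fields need not converge. -/
theorem tendsto_integral_formDensity_mollify (hA : LocallyIntegrable A) {CA : ℝ}
    (hCA : ∀ᵐ x, ‖A x‖ ≤ CA) {u : Plane → ℂ} (hu : ContDiff ℝ ∞ u) (hc : HasCompactSupport u) :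
    Tendsto (fun n => ∫ x, formDensity (mollify ((shrinkingBump n).normed volume) A) u x) atTop
      (nhds (∫ x, formDensity A u x)) := by
  have sA : ∀ n, ContDiff ℝ ∞ (mollify ((shrinkingBump n).normed volume) A) := fun n =>
    contDiff_mollify (shrinkingBump n).contDiff_normed (shrinkingBump n).hasCompactSupport_normed hA
  have bA := fun n => norm_mollify_normed_le (shrinkingBump n) hCA
  rw [integral_formDensity hA.aestronglyMeasurable hCA hu hc]
  simp_rw [fun n => integral_formDensity (sA n).continuous.aestronglyMeasurable
    (Eventually.of_forall (bA n)) hu hc]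
  refine tendsto_integral_of_dominated_convergence _ (fun n =>
    (integrable_norm_sq_dz_sub (sA n).continuous.aestronglyMeasurable
    (Eventually.of_forall (bA n)) hu hc).1) (integrable_dz_sub_majorant CA hu hc)
    (fun n => Eventually.of_forall fun x => ?_) ?_
  · rw [norm_pow, norm_norm]
    exact norm_sq_dz_sub_le (bA n x) u x
  · filter_upwards [ae_tendsto_mollify_shrinkingBump hA] with x hx
    have hi : ∀ i : Fin 2, Tendsto (fun n =>
        ((mollify ((shrinkingBump n).normed volume) A x i : ℝ) : ℂ)) atTop
        (nhds ((A x i : ℝ) : ℂ)) := fun i =>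
      (Complex.continuous_ofReal.tendsto _).comp
        (((EuclideanSpace.proj i : Plane →L[ℝ] ℝ).continuous.tendsto _).comp hx)
    exact ((tendsto_const_nhds.sub ((((hi 0).sub ((hi 1).const_mul Complex.I)).const_mul
      Complex.I).mul_const (u x))).norm).pow 2

/-- The Hardy inequality on test functions. -/
theorem hardy_test (hB : IsAdmissibleField B) (hA : LocallyIntegrable A) {CA : ℝ}
    (hCA : ∀ᵐ x, ‖A x‖ ≤ CA) (hAB : HasDistribCurl A B) {α ρ k K : ℝ} (hρ : 0 < ρ)
    (hα : 0 ≤ α) (hk : 0 < k) (hK : 0 < K)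
    (hkg : ∀ x, k * gPlus α ρ ‖x‖ ≤ Real.exp (-superpotential B x))
    (hKg : ∀ x, Real.exp (-superpotential B x) ≤ K * gPlus α ρ ‖x‖)
    {u : Plane → ℂ} (hu : ContDiff ℝ ∞ u) (hc : HasCompactSupport u) :
    (k / K) ^ 2 * ∫ x, hardyProfile α ρ ‖x‖ * ‖u x‖ ^ 2 ≤ ∫ x, formDensity A u x := by
  refine le_of_tendsto_of_tendsto' ?_ (tendsto_integral_formDensity_mollify hA hCA hu hc)
    fun n => hardy_mollified hB hA hCA hAB hρ hα hk hK hkg hKg hu hc (shrinkingBump n)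
  refine Tendsto.mul_const _ (Tendsto.pow ?_ 2)
  have h0 : Tendsto (fun n => α * ((shrinkingBump n).rOut / ρ)) atTop (nhds 0) := by
    simpa using (tendsto_rOut_shrinkingBump.div_const ρ).const_mul α
  have h1 : Tendsto (fun n => Real.exp (α * ((shrinkingBump n).rOut / ρ))) atTop (nhds 1) := by
    simpa [Function.comp_def] using (Real.continuous_exp.tendsto 0).comp h0
  have h2 : Tendsto (fun n => Real.exp (-(α * ((shrinkingBump n).rOut / ρ)))) atTop (nhds 1) := by
    simpa [Function.comp_def] using (Real.continuous_exp.tendsto (-0)).comp h0.neg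
  have h3 := (h2.const_mul k).div (h1.const_mul K) (by simpa using hK.ne')
  rw [mul_one, mul_one] at h3
  exact h3

end PauliHardy
end

noncomputable section

namespace PauliHardy

/-! ### Square integrable functions -/

section l2

variable {F : Type*} [NormedAddCommGroup F]

/-- The square of the `L²` norm, as an extended nonnegative number. -/
def l2sq (f : Plane → F) : ℝ≥0∞ := ∫⁻ x, ‖f x‖ₑ ^ 2

theorem memLp_two_iff_l2sq {f : Plane → F} :
    MemLp f 2 ↔ AEStronglyMeasurable f ∧ l2sq f < ⊤ := by
  have h : eLpNorm f 2 volume ^ 2 = l2sq f := by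
    have := eLpNorm_nnreal_pow_eq_lintegral (f := f) (μ := (volume : Measure Plane))
      (p := 2) two_ne_zero
    simpa [l2sq] using this
  rw [MemLp, ← h]
  simp

theorem ennreal_add_sq_le (a b : ℝ≥0∞) : (a + b) ^ 2 ≤ 2 * a ^ 2 + 2 * b ^ 2 := by
  have := ENNReal.rpow_add_le_mul_rpow_add_rpow a b (p := 2) (by norm_num)
  norm_num at this
  rwa [mul_add] at this

theorem l2sq_add_le {f g : Plane → F} (hf : AEStronglyMeasurable f) :
    l2sq (fun x => f x + g x) ≤ 2 * l2sq f + 2 * l2sq g := by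
  rw [l2sq, l2sq, l2sq, ← lintegral_const_mul' _ _ (by simp), ← lintegral_const_mul' _ _ (by simp),
    ← lintegral_add_left' ((hf.enorm.pow_const 2).const_mul 2)]
  refine lintegral_mono fun x => ?_
  exact (pow_le_pow_left' (enorm_add_le _ _) 2).trans (ennreal_add_sq_le _ _)

theorem l2sq_neg (f : Plane → F) : l2sq (fun x => -f x) = l2sq f := by simp [l2sq]

theorem l2sq_le_mul {G : Type*} [NormedAddCommGroup G] {f : Plane → F} {g : Plane → G} {C : ℝ}
    (h : ∀ᵐ x, ‖f x‖ ≤ C * ‖g x‖) : l2sq f ≤ ENNReal.ofReal C ^ 2 * l2sq g := by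
  rw [l2sq, l2sq, ← lintegral_const_mul' _ _ (by simp)]
  refine lintegral_mono_ae ?_
  filter_upwards [h] with x hx
  rw [← mul_pow]
  refine pow_le_pow_left' ?_ 2
  rw [← ofReal_norm, ← ofReal_norm, ← ENNReal.ofReal_mul' (norm_nonneg _)]
  exact ENNReal.ofReal_le_ofReal hx

/-- Almost everywhere convergence with no escape of mass implies convergence in `L²`. -/
theorem tendsto_l2sq_sub_of_ae {f : Plane → F} {f' : ℕ → Plane → F} (hf : MemLp f 2)
    (hf' : ∀ n, AEStronglyMeasurable (f' n)) (hle : ∀ n, l2sq (f' n) ≤ l2sq f)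
    (h : ∀ᵐ x, Tendsto (fun n => f' n x) atTop (nhds (f x))) :
    Tendsto (fun n => l2sq (fun x => f' n x - f x)) atTop (nhds 0) := by
  have hfin := (memLp_two_iff_l2sq.1 hf).2
  set S : ℕ → Plane → ℝ≥0∞ := fun n x => 2 * ‖f' n x‖ₑ ^ 2 + 2 * ‖f x‖ₑ ^ 2 with hS
  -- Fatou is applied to the nonnegative `2|f'ₙ|² + 2|f|² - |f'ₙ - f|²`, which tends to `4|f|²` and
  -- whose integral plus the squared distance is at most `4‖f‖²`.
  set R : ℕ → Plane → ℝ≥0∞ := fun n x => S n x - ‖f' n x - f x‖ₑ ^ 2 with hR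
  have mD : ∀ n, AEMeasurable fun x => ‖f' n x - f x‖ₑ ^ 2 := fun n =>
    ((hf' n).sub hf.1).enorm.pow_const 2
  have mf : AEMeasurable fun x => 2 * ‖f x‖ₑ ^ 2 := (hf.1.enorm.pow_const 2).const_mul 2
  have mf' : ∀ n, AEMeasurable fun x => 2 * ‖f' n x‖ₑ ^ 2 := fun n =>
    ((hf' n).enorm.pow_const 2).const_mul 2
  have mR : ∀ n, AEMeasurable (R n) := fun n => ((mf' n).add mf).sub (mD n)
  have hDS : ∀ n x, ‖f' n x - f x‖ₑ ^ 2 ≤ S n x := fun n x =>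
    (pow_le_pow_left' (enorm_sub_le) 2).trans (ennreal_add_sq_le _ _)
  have hSI : ∀ n, ∫⁻ x, S n x ≤ 4 * l2sq f := by
    intro n
    simp only [hS]
    rw [lintegral_add_right' _ mf, lintegral_const_mul' _ _ (by simp),
      lintegral_const_mul' _ _ (by simp)]
    calc _ ≤ 2 * l2sq f + 2 * l2sq f := by gcongr; exacts [hle n, le_rfl]
      _ = _ := by rw [← add_mul]; norm_num
  have hsum : ∀ n, l2sq (fun x => f' n x - f x) + ∫⁻ x, R n x ≤ 4 * l2sq f := by
    intro n
    rw [l2sq, ← lintegral_add_right' _ (mR n)]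
    refine le_trans (le_of_eq (lintegral_congr fun x => ?_)) (hSI n)
    exact add_tsub_cancel_of_le (hDS n x)
  have hfatou : 4 * l2sq f ≤ liminf (fun n => ∫⁻ x, R n x) atTop := by
    refine le_trans ?_ (lintegral_liminf_le' mR)
    rw [l2sq, ← lintegral_const_mul' _ _ (by simp)]
    refine lintegral_mono_ae ?_
    filter_upwards [h] with x hx
    have h1 : Tendsto (fun n => S n x) atTop (nhds (4 * ‖f x‖ₑ ^ 2)) := by
      have e : 4 * ‖f x‖ₑ ^ 2 = 2 * ‖f x‖ₑ ^ 2 + 2 * ‖f x‖ₑ ^ 2 := by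
        rw [← add_mul]; norm_num
      rw [e]
      exact (ENNReal.Tendsto.const_mul (ENNReal.Tendsto.pow hx.enorm) (Or.inr (by simp))).add
        tendsto_const_nhds
    have h2 : Tendsto (fun n => ‖f' n x - f x‖ₑ ^ 2) atTop (nhds 0) := by
      have := ENNReal.Tendsto.pow (n := 2) (hx.sub_const (f x)).enorm
      simpa using this
    have h3 := ENNReal.Tendsto.sub h1 h2 (Or.inr (by simp))
    rw [tsub_zero] at h3
    exact h3.liminf_eq.ge
  rw [ENNReal.tendsto_nhds_zero]
  intro ε hε
  by_cases h0 : 4 * l2sq f = 0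
  · refine Eventually.of_forall fun n => ?_
    exact (le_self_add.trans (hsum n)).trans (h0.le.trans bot_le)
  · have hlt : 4 * l2sq f - ε < liminf (fun n => ∫⁻ x, R n x) atTop :=
      lt_of_lt_of_le (ENNReal.sub_lt_self (ENNReal.mul_lt_top (by simp) hfin).ne h0 hε.ne') hfatou
    filter_upwards [eventually_lt_of_lt_liminf hlt] with n hn
    have h1 : l2sq (fun x => f' n x - f x) + (4 * l2sq f - ε) ≤ 4 * l2sq f :=
      (add_le_add le_rfl hn.le).trans (hsum n)
    refine le_trans (ENNReal.le_sub_of_add_le_right ?_ h1) tsub_tsub_le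
    exact (lt_of_le_of_lt tsub_le_self (ENNReal.mul_lt_top (by simp) hfin)).ne

theorem sq_lintegral_mul_le {f g : Plane → ℝ≥0∞} (hf : AEMeasurable f) (hg : AEMeasurable g) :
    (∫⁻ x, f x * g x) ^ 2 ≤ (∫⁻ x, f x ^ 2) * ∫⁻ x, g x ^ 2 := by
  have h := ENNReal.lintegral_mul_le_Lp_mul_Lq volume Real.HolderConjugate.two_two hf hg
  have h2 := pow_le_pow_left' h 2
  refine h2.trans (le_of_eq ?_)
  rw [mul_pow, ← ENNReal.rpow_natCast, ← ENNReal.rpow_natCast, ← ENNReal.rpow_mul,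
    ← ENNReal.rpow_mul]
  norm_num

theorem integrable_norm_sq_of_memLp {f : Plane → F} (hf : MemLp f 2) :
    Integrable fun x => ‖f x‖ ^ 2 := hf.integrable_norm_pow two_ne_zero

/-- Weighted squares depend continuously on the function in `L²`. -/
theorem tendsto_integral_mul_norm_sq {b : Plane → ℝ} (hb : AEStronglyMeasurable b) {M : ℝ}
    (hM : ∀ x, |b x| ≤ M) {f : Plane → F} {f' : ℕ → Plane → F} (hf : MemLp f 2)
    (hf' : ∀ n, MemLp (f' n) 2)
    (h : Tendsto (fun n => l2sq (fun x => f' n x - f x)) atTop (nhds 0)) :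
    Tendsto (fun n => ∫ x, b x * ‖f' n x‖ ^ 2) atTop (nhds (∫ x, b x * ‖f x‖ ^ 2)) := by
  have hi : ∀ g : Plane → F, MemLp g 2 → Integrable fun x => b x * ‖g x‖ ^ 2 := fun g hg =>
    (integrable_norm_sq_of_memLp hg).bdd_mul (c := M) hb (Eventually.of_forall hM)
  have hfin := (memLp_two_iff_l2sq.1 hf).2
  refine tendsto_integral_of_L1 _ (hi f hf).1 (Eventually.of_forall fun n => hi _ (hf' n)) ?_
  set D : ℕ → Plane → F := fun n x => f' n x - f x
  have mD : ∀ n, AEStronglyMeasurable (D n) := fun n => (hf' n).1.sub hf.1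
  have key : ∀ n, ∫⁻ x, ‖b x * ‖f' n x‖ ^ 2 - b x * ‖f x‖ ^ 2‖ₑ ≤
      ENNReal.ofReal M * (l2sq (D n) + 2 * (l2sq (D n) * l2sq f) ^ (1 / 2 : ℝ)) := by
    intro n
    have h1 : ∀ x, ‖b x * ‖f' n x‖ ^ 2 - b x * ‖f x‖ ^ 2‖ₑ ≤
        ENNReal.ofReal M * (‖D n x‖ₑ ^ 2 + 2 * (‖D n x‖ₑ * ‖f x‖ₑ)) := by
      intro x
      have hM0 : 0 ≤ M := (abs_nonneg _).trans (hM x)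
      have e : ENNReal.ofReal M * (‖D n x‖ₑ ^ 2 + 2 * (‖D n x‖ₑ * ‖f x‖ₑ)) =
          ENNReal.ofReal (M * (‖D n x‖ ^ 2 + 2 * (‖D n x‖ * ‖f x‖))) := by
        rw [ENNReal.ofReal_mul hM0, ENNReal.ofReal_add (by positivity) (by positivity),
          ENNReal.ofReal_pow (norm_nonneg _), ENNReal.ofReal_mul zero_le_two,
          ENNReal.ofReal_mul (norm_nonneg _), ofReal_norm, ofReal_norm]
        simp
      rw [e, ← ofReal_norm]
      refine ENNReal.ofReal_le_ofReal ?_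
      rw [← mul_sub, norm_mul]
      refine mul_le_mul (hM x) ?_ (norm_nonneg _) hM0
      have h2 : |‖f' n x‖ - ‖f x‖| ≤ ‖D n x‖ := abs_norm_sub_norm_le _ _
      rw [sq_sub_sq, norm_mul, Real.norm_eq_abs, Real.norm_eq_abs,
        abs_of_nonneg (by positivity : 0 ≤ ‖f' n x‖ + ‖f x‖)]
      have h3 : ‖f' n x‖ + ‖f x‖ ≤ ‖D n x‖ + 2 * ‖f x‖ := by
        linarith [le_abs_self (‖f' n x‖ - ‖f x‖)]
      calc _ ≤ (‖D n x‖ + 2 * ‖f x‖) * ‖D n x‖ := by gcongr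
        _ = _ := by ring
    refine (lintegral_mono h1).trans ?_
    rw [lintegral_const_mul' _ _ (by simp), lintegral_add_left' ((mD n).enorm.pow_const 2),
      lintegral_const_mul' _ _ (by simp)]
    refine mul_le_mul' le_rfl (add_le_add le_rfl (mul_le_mul' le_rfl ?_))
    rw [one_div, ENNReal.le_rpow_inv_iff zero_lt_two]
    exact_mod_cast sq_lintegral_mul_le (mD n).enorm hf.1.enorm
  have h2 : Tendsto (fun n => ENNReal.ofReal M *
      (l2sq (D n) + 2 * (l2sq (D n) * l2sq f) ^ (1 / 2 : ℝ))) atTop (nhds 0) := by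
    have h3 : Tendsto (fun n => l2sq (D n) * l2sq f) atTop (nhds 0) := by
      simpa using ENNReal.Tendsto.mul_const h (Or.inr hfin.ne)
    have h4 := (h3.ennrpow_const (1 / 2 : ℝ))
    have h5 := ENNReal.Tendsto.const_mul (a := ENNReal.ofReal M)
      (h.add (ENNReal.Tendsto.const_mul (a := 2) h4 (Or.inr (by simp)))) (Or.inr (by simp))
    simpa using h5
  exact tendsto_of_tendsto_of_tendsto_of_le_of_le tendsto_const_nhds h2 (fun _ => bot_le) key

end l2

end PauliHardy
end

noncomputable section

namespace PauliHardy

/-! ### Approximation in `H¹` -/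

section mollify

variable {F : Type*} [NormedAddCommGroup F] [NormedSpace ℝ F]

/-- Mollification does not increase the `L²` norm. -/
theorem l2sq_mollify_le (φ : ContDiffBump (0 : Plane)) {g : Plane → F}
    (hg : AEStronglyMeasurable g) : l2sq (mollify (φ.normed volume) g) ≤ l2sq g := by
  set η := φ.normed (volume : Measure Plane) with hη
  have η0 : ∀ z, 0 ≤ η z := φ.nonneg_normed
  have ηm : Measurable η := φ.continuous_normed.measurable
  have hone : ∀ c : Plane → Plane, (∫ x, η (c x) = 1) → Integrable (fun x => η (c x)) →
      ∫⁻ x, ENNReal.ofReal (η (c x)) = 1 := by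
    intro c h1 h2
    rw [← ofReal_integral_eq_lintegral_ofReal h2 (Eventually.of_forall fun x => η0 _), h1]
    simp
  -- Jensen's inequality, obtained from Cauchy–Schwarz with `η = √η · √η` and unit mass.
  have h1 : ∀ x, ‖mollify η g x‖ₑ ^ 2 ≤ ∫⁻ y, ENNReal.ofReal (η (x - y)) * ‖g y‖ₑ ^ 2 := by
    intro x
    have ms : AEMeasurable fun y => ENNReal.ofReal √(η (x - y)) :=
      (ηm.comp (measurable_const.sub measurable_id)).sqrt.ennreal_ofReal.aemeasurable
    have e : ∀ y, ENNReal.ofReal √(η (x - y)) * ENNReal.ofReal √(η (x - y)) =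
        ENNReal.ofReal (η (x - y)) := fun y => by
      rw [← ENNReal.ofReal_mul (Real.sqrt_nonneg _), Real.mul_self_sqrt (η0 _)]
    calc ‖mollify η g x‖ₑ ^ 2 ≤ (∫⁻ y, ‖η (x - y) • g y‖ₑ) ^ 2 :=
          pow_le_pow_left' (enorm_integral_le_lintegral_enorm _) 2
      _ = (∫⁻ y, ENNReal.ofReal √(η (x - y)) * (ENNReal.ofReal √(η (x - y)) * ‖g y‖ₑ)) ^ 2 := by
          congr 1
          refine lintegral_congr fun y => ?_
          rw [← mul_assoc, e, enorm_smul, Real.enorm_eq_ofReal (η0 _)]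
      _ ≤ _ := sq_lintegral_mul_le ms (ms.mul hg.enorm)
      _ = _ := by
          simp_rw [mul_pow, sq (ENNReal.ofReal _), e]
          rw [hone _ (integral_normed_comp_sub φ x) (φ.integrable_normed.comp_sub_left x), one_mul]
  calc l2sq (mollify η g) ≤ ∫⁻ x, ∫⁻ y, ENNReal.ofReal (η (x - y)) * ‖g y‖ₑ ^ 2 :=
        lintegral_mono h1
    _ = ∫⁻ y, ∫⁻ x, ENNReal.ofReal (η (x - y)) * ‖g y‖ₑ ^ 2 := by
        refine lintegral_lintegral_swap (AEMeasurable.mul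
          (f := fun z : Plane × Plane => ENNReal.ofReal (η (z.1 - z.2)))
          (g := fun z : Plane × Plane => ‖g z.2‖ₑ ^ 2) ?_ ?_)
        · exact (ηm.comp (measurable_fst.sub measurable_snd)).ennreal_ofReal.aemeasurable
        · exact (hg.enorm.pow_const 2).comp_snd
    _ = l2sq g := by
        refine lintegral_congr fun y => ?_
        rw [lintegral_mul_const' _ _ (by simp), hone _ _ (φ.integrable_normed.comp_sub_right y),
          one_mul]
        rw [integral_sub_right_eq_self η y]
        exact φ.integral_normed

end mollify

/-- A bump function equal to one on the unit ball. -/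
def unitBump : ContDiffBump (0 : Plane) := ⟨1, 2, one_pos, one_lt_two⟩

/-- Cut-off functions exhausting the plane. -/
def cutoff (n : ℕ) (x : Plane) : ℝ := unitBump (((n : ℝ) + 1)⁻¹ • x)

theorem contDiff_cutoff (n : ℕ) : ContDiff ℝ ∞ (cutoff n) :=
  unitBump.contDiff.comp (contDiff_const_smul _)

theorem hasCompactSupport_cutoff (n : ℕ) : HasCompactSupport (cutoff n) :=
  unitBump.hasCompactSupport.comp_smul (by positivity)

theorem abs_cutoff_le (n : ℕ) (x : Plane) : |cutoff n x| ≤ 1 := by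
  rw [cutoff, abs_of_nonneg unitBump.nonneg]
  exact unitBump.le_one

theorem tendsto_cutoff (x : Plane) : Tendsto (fun n => cutoff n x) atTop (nhds 1) := by
  refine tendsto_const_nhds.congr' ?_
  filter_upwards [eventually_ge_atTop ⌈‖x‖⌉₊] with n hn
  refine (unitBump.one_of_mem_closedBall ?_).symm
  have h1 : ‖x‖ ≤ n := (Nat.le_ceil _).trans (by exact_mod_cast hn)
  rw [mem_closedBall_zero_iff, norm_smul, Real.norm_of_nonneg (by positivity), inv_mul_eq_div]
  exact div_le_one_of_le₀ (by linarith) (by positivity)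

theorem pd_cutoff (j : Fin 2) (n : ℕ) (x : Plane) :
    pd j (cutoff n) x = ((n : ℝ) + 1)⁻¹ * pd j unitBump (((n : ℝ) + 1)⁻¹ • x) := by
  have h : HasFDerivAt (cutoff n) _ x :=
    ((unitBump.contDiff (n := 1)).differentiable one_ne_zero
      (((n : ℝ) + 1)⁻¹ • x)).hasFDerivAt.comp x ((hasFDerivAt_id x).const_smul (((n : ℝ) + 1)⁻¹))
  rw [pd, h.fderiv]
  simp [pd]

theorem exists_abs_pd_cutoff_le (j : Fin 2) :
    ∃ C, 0 ≤ C ∧ ∀ n x, |pd j (cutoff n) x| ≤ C * ((n : ℝ) + 1)⁻¹ := by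
  obtain ⟨C, hC⟩ := (hasCompactSupport_pd unitBump.hasCompactSupport j).exists_bound_of_continuous
    (contDiff_pd unitBump.contDiff j).continuous
  refine ⟨C, (norm_nonneg _).trans (hC 0), fun n x => ?_⟩
  rw [pd_cutoff, abs_mul, abs_of_nonneg (by positivity), mul_comm]
  gcongr
  exact hC _

variable {v : Plane → ℂ} {E : Fin 2 → Plane → ℂ}

theorem IsH1.locallyIntegrable {F : Type*} [NormedAddCommGroup F] [NormedSpace ℝ F]
    {u : Plane → F} {D : Fin 2 → Plane → F} (h : IsH1 u D) : LocallyIntegrable u :=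
  h.memLp.locallyIntegrable one_le_two

theorem IsH1.locallyIntegrable_deriv {F : Type*} [NormedAddCommGroup F] [NormedSpace ℝ F]
    {u : Plane → F} {D : Fin 2 → Plane → F} (h : IsH1 u D) (j : Fin 2) :
    LocallyIntegrable (D j) :=
  (h.memLp_deriv j).locallyIntegrable one_le_two

theorem IsH1.pd_mollify (h : IsH1 v E) {η : Plane → ℝ} (hη : ContDiff ℝ ∞ η)
    (hc : HasCompactSupport η) (j : Fin 2) : pd j (mollify η v) = mollify η (E j) := by
  rw [PauliHardy.pd_mollify hη hc h.locallyIntegrable]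
  funext x
  have h1 := h.weakDeriv j _ (isTest_comp_const_sub hη hc x)
  simp_rw [partialDeriv_eq_pd, pd_comp_const_sub (hη.differentiable (by simp)), neg_smul,
    integral_neg] at h1
  exact neg_injective h1

/-- Smooth compactly supported approximation of an `H¹` function. -/
def approx (v : Plane → ℂ) (n : ℕ) (x : Plane) : ℂ :=
  cutoff n x • mollify ((shrinkingBump n).normed volume) v x

theorem contDiff_approx (hv : LocallyIntegrable v) (n : ℕ) : ContDiff ℝ ∞ (approx v n) :=
  (contDiff_cutoff n).smul (contDiff_mollify (shrinkingBump n).contDiff_normed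
    (shrinkingBump n).hasCompactSupport_normed hv)

theorem hasCompactSupport_approx (n : ℕ) : HasCompactSupport (approx v n) :=
  (hasCompactSupport_cutoff n).smul_right

theorem ae_tendsto_approx (hv : LocallyIntegrable v) :
    ∀ᵐ x, Tendsto (fun n => approx v n x) atTop (nhds (v x)) := by
  filter_upwards [ae_tendsto_mollify_shrinkingBump hv] with x hx
  have h := (tendsto_cutoff x).smul hx
  rw [one_smul] at h
  exact h

theorem l2sq_approx_le (hv : AEStronglyMeasurable v) (n : ℕ) : l2sq (approx v n) ≤ l2sq v := by
  refine le_trans ?_ (l2sq_mollify_le (shrinkingBump n) hv)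
  have h := l2sq_le_mul (f := approx v n) (g := mollify ((shrinkingBump n).normed volume) v)
    (C := 1) (Eventually.of_forall fun x => ?_)
  · simpa using h
  · rw [approx, norm_smul]
    gcongr
    exact abs_cutoff_le n x

theorem tendsto_l2sq_approx_sub (hv : MemLp v 2) :
    Tendsto (fun n => l2sq (fun x => approx v n x - v x)) atTop (nhds 0) :=
  have hl := hv.locallyIntegrable one_le_two
  tendsto_l2sq_sub_of_ae hv (fun n => (contDiff_approx hl n).continuous.aestronglyMeasurable)
    (l2sq_approx_le hv.1) (ae_tendsto_approx hl)

theorem IsH1.pd_approx (h : IsH1 v E) (j : Fin 2) (n : ℕ) (x : Plane) :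
    pd j (approx v n) x = approx (E j) n x +
      pd j (cutoff n) x • mollify ((shrinkingBump n).normed volume) v x := by
  have sη := (shrinkingBump n).contDiff_normed (μ := (volume : Measure Plane)) (n := ⊤)
  have cη := (shrinkingBump n).hasCompactSupport_normed (μ := volume)
  have h1 : HasFDerivAt (approx v n) _ x :=
    ((contDiff_cutoff n).differentiable (by simp) x).hasFDerivAt.smul
      ((contDiff_mollify sη cη h.locallyIntegrable).differentiable (by simp) x).hasFDerivAt
  rw [approx, ← h.pd_mollify sη cη j, pd, h1.fderiv]
  simp [pd]

/-- The product rule leaves the approximation of `E j` plus a cut-off gradient of size `O(1/n)`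
times the mollified `v`. -/
theorem IsH1.tendsto_l2sq_pd_approx_sub (h : IsH1 v E) (j : Fin 2) :
    Tendsto (fun n => l2sq (fun x => pd j (approx v n) x - E j x)) atTop (nhds 0) := by
  obtain ⟨C, hC0, hC⟩ := exists_abs_pd_cutoff_le j
  have hl : LocallyIntegrable (E j) := h.locallyIntegrable_deriv j
  set a : ℕ → ℝ≥0∞ := fun n => ENNReal.ofReal (C * ((n : ℝ) + 1)⁻¹) ^ 2 * l2sq v with ha
  have ha0 : Tendsto a atTop (nhds 0) := by
    have h1 : Tendsto (fun n : ℕ => C * ((n : ℝ) + 1)⁻¹) atTop (nhds 0) := by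
      simpa [one_div] using (tendsto_one_div_add_atTop_nhds_zero_nat (𝕜 := ℝ)).const_mul C
    have h2 := ENNReal.Tendsto.pow (n := 2) (ENNReal.tendsto_ofReal h1)
    have h3 := ENNReal.Tendsto.mul_const h2 (Or.inr (memLp_two_iff_l2sq.1 h.memLp).2.ne)
    simpa using h3
  have hle : ∀ n, l2sq (fun x => pd j (approx v n) x - E j x) ≤
      2 * l2sq (fun x => approx (E j) n x - E j x) + 2 * a n := by
    intro n
    have e : (fun x => pd j (approx v n) x - E j x) = fun x => (approx (E j) n x - E j x) +
        pd j (cutoff n) x • mollify ((shrinkingBump n).normed volume) v x := by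
      funext x
      rw [h.pd_approx]; ring
    rw [e]
    refine (l2sq_add_le ((contDiff_approx hl n).continuous.aestronglyMeasurable.sub
      (hl.aestronglyMeasurable))).trans ?_
    refine add_le_add le_rfl (mul_le_mul' le_rfl ?_)
    refine le_trans (l2sq_le_mul (C := C * ((n : ℝ) + 1)⁻¹)
      (g := mollify ((shrinkingBump n).normed volume) v) (Eventually.of_forall fun x => ?_)) ?_
    · rw [norm_smul]
      gcongr
      exact hC n x
    · exact mul_le_mul' le_rfl (l2sq_mollify_le _ h.memLp.1)
  refine tendsto_of_tendsto_of_tendsto_of_le_of_le tendsto_const_nhds ?_ (fun _ => bot_le) hle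
  simpa using (ENNReal.Tendsto.const_mul (a := 2) (tendsto_l2sq_approx_sub (h.memLp_deriv j))
    (Or.inr (by simp))).add (ENNReal.Tendsto.const_mul (a := 2) ha0 (Or.inr (by simp)))

end PauliHardy
end

noncomputable section

namespace PauliHardy

/-! ### The magnetic field as a form-bounded perturbation -/

/-- A quantity equivalent to the square of the `H¹` norm. -/
def energy (v : Plane → ℂ) (E : Fin 2 → Plane → ℂ) : ℝ≥0∞ := 2 * l2sq v + ∑ j, l2sq (E j)

theorem energy_sub_le {v w : Plane → ℂ} {E G : Fin 2 → Plane → ℂ} (hv : AEStronglyMeasurable v)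
    (hE : ∀ j, AEStronglyMeasurable (E j)) :
    energy (fun x => v x - w x) (fun j x => E j x - G j x) ≤ 2 * energy v E + 2 * energy w G := by
  have h : ∀ f g : Plane → ℂ, AEStronglyMeasurable f →
      l2sq (fun x => f x - g x) ≤ 2 * l2sq f + 2 * l2sq g := fun f g hf => by
    simp_rw [sub_eq_add_neg]
    exact (l2sq_add_le hf).trans_eq (by rw [l2sq_neg])
  simp only [energy, Fin.sum_univ_two]
  calc _ ≤ 2 * (2 * l2sq v + 2 * l2sq w) + ((2 * l2sq (E 0) + 2 * l2sq (G 0)) +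
        (2 * l2sq (E 1) + 2 * l2sq (G 1))) := by
        gcongr
        exacts [h _ _ hv, h _ _ (hE 0), h _ _ (hE 1)]
    _ = _ := by ring

/-- Ladyzhenskaya's inequality. -/
theorem exists_lintegral_pow_four_le :
    ∃ C : ℝ≥0∞, C ≠ ⊤ ∧ ∀ w : Plane → ℂ, ContDiff ℝ ∞ w → HasCompactSupport w →
      ∫⁻ x, ‖w x‖ₑ ^ 4 ≤ C * energy w (fun j => pd j w) ^ 2 := by
  have hp : Real.HolderConjugate (Module.finrank ℝ Plane) 2 := by
    rw [finrank_euclideanSpace_fin]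
    exact_mod_cast Real.HolderConjugate.two_two
  refine ⟨lintegralPowLePowLIntegralFDerivConst (volume : Measure Plane) 2, ENNReal.coe_ne_top,
    fun w hw hc => ?_⟩
  have hw1 : ContDiff ℝ 1 w := hw.of_le one_le_infty
  -- The embedding of `W^{1,1}` into `L²` in the plane, applied to `w²`. Young's inequality on
  -- `|∇(w²)| ≤ 2|w|(|∂₁w| + |∂₂w|)` then gives the energy density, with its factor `2` on `|w|²`.
  have h := lintegral_pow_le_pow_lintegral_fderiv (volume : Measure Plane)
    (u := fun x => w x * w x) (hw1.mul hw1) hc.mul_right hp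
  have e1 : ∀ x, ‖w x * w x‖ₑ ^ (2 : ℝ) = ‖w x‖ₑ ^ 4 := fun x => by
    rw [enorm_mul, ← sq, ENNReal.rpow_ofNat, ← pow_mul]
  simp_rw [e1] at h
  refine h.trans (mul_le_mul' le_rfl ?_)
  rw [ENNReal.rpow_ofNat]
  refine pow_le_pow_left' ?_ 2
  have m : ∀ j, AEMeasurable fun x => ‖pd j w x‖ₑ ^ 2 := fun j =>
    ((contDiff_pd hw j).continuous.aestronglyMeasurable.enorm.pow_const 2)
  have mw : AEMeasurable fun x => 2 * ‖w x‖ₑ ^ 2 :=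
    (hw.continuous.aestronglyMeasurable.enorm.pow_const 2).const_mul 2
  have e2 : energy w (fun j => pd j w) =
      ∫⁻ x, (2 * ‖w x‖ₑ ^ 2 + (‖pd 0 w x‖ₑ ^ 2 + ‖pd 1 w x‖ₑ ^ 2)) := by
    rw [lintegral_add_left' mw, lintegral_add_left' (m 0), lintegral_const_mul' _ _ (by simp)]
    simp [energy, l2sq]
  rw [e2]
  refine lintegral_mono fun x => ?_
  have hd : DifferentiableAt ℝ w x := hw1.differentiable one_ne_zero x
  have h1 : ‖fderiv ℝ w x‖ ≤ ‖pd 0 w x‖ + ‖pd 1 w x‖ := by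
    refine ContinuousLinearMap.opNorm_le_bound _ (by positivity) fun y => ?_
    rw [fderiv_apply_eq_pd, add_mul]
    refine (norm_add_le _ _).trans (add_le_add ?_ ?_) <;>
    · rw [norm_smul, mul_comm]
      gcongr
      exact PiLp.norm_apply_le y _
  have h2 : ‖fderiv ℝ (fun x => w x * w x) x‖ ≤
      2 * ‖w x‖ ^ 2 + (‖pd 0 w x‖ ^ 2 + ‖pd 1 w x‖ ^ 2) := by
    rw [fderiv_fun_mul hd hd]
    refine (norm_add_le _ _).trans ?_
    rw [norm_smul]
    nlinarith [sq_nonneg (‖w x‖ - ‖pd 0 w x‖), sq_nonneg (‖w x‖ - ‖pd 1 w x‖),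
      mul_le_mul_of_nonneg_left h1 (norm_nonneg (w x))]
  simp only [← ofReal_norm, ← ENNReal.ofReal_pow (norm_nonneg _)]
  have e3 := ENNReal.ofReal_mul (p := 2) (q := ‖w x‖ ^ 2) zero_le_two
  rw [ENNReal.ofReal_ofNat] at e3
  rw [← e3,
    ← ENNReal.ofReal_add (by positivity) (by positivity),
    ← ENNReal.ofReal_add (by positivity) (by positivity)]
  exact ENNReal.ofReal_le_ofReal h2

variable {B : Plane → ℝ} {v : Plane → ℂ} {E : Fin 2 → Plane → ℂ}

/-- Cauchy–Schwarz gives `‖B‖₂ ‖w‖₄²`, and Ladyzhenskaya controls the second factor. -/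
theorem exists_lintegral_mul_sq_le_energy_of_test (hB : MemLp B 2) :
    ∃ C : ℝ≥0∞, C ≠ ⊤ ∧ ∀ w : Plane → ℂ, ContDiff ℝ ∞ w → HasCompactSupport w →
      ∫⁻ x, ‖B x‖ₑ * ‖w x‖ₑ ^ 2 ≤ C * energy w (fun j => pd j w) := by
  obtain ⟨C, hC, h⟩ := exists_lintegral_pow_four_le
  have hfin := (memLp_two_iff_l2sq.1 hB).2
  refine ⟨(l2sq B * C) ^ (1 / 2 : ℝ), ENNReal.rpow_ne_top_of_nonneg (by norm_num)
    (ENNReal.mul_ne_top hfin.ne hC), fun w hw hc => ?_⟩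
  have h1 := sq_lintegral_mul_le hB.1.enorm
    (hw.continuous.aestronglyMeasurable.enorm.pow_const 2)
  simp_rw [← pow_mul] at h1
  have h2 := h1.trans (mul_le_mul' le_rfl (h w hw hc))
  rw [← ENNReal.pow_le_pow_left_iff two_ne_zero, mul_pow, ← ENNReal.rpow_natCast
    ((l2sq B * C) ^ _), ← ENNReal.rpow_mul]
  norm_num
  rw [mul_assoc]
  exact h2

theorem aestronglyMeasurable_pd {w : Plane → ℂ} (hw : ContDiff ℝ ∞ w) (j : Fin 2) :
    AEStronglyMeasurable (pd j w) := (contDiff_pd hw j).continuous.aestronglyMeasurable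

theorem IsH1.tendsto_energy_approx_sub (h : IsH1 v E) :
    Tendsto (fun n => energy (fun x => approx v n x - v x) (fun j x => pd j (approx v n) x - E j x))
      atTop (nhds 0) := by
  have h1 := (ENNReal.Tendsto.const_mul (a := 2) (tendsto_l2sq_approx_sub h.memLp)
    (Or.inr (by simp))).add (tendsto_finsetSum Finset.univ fun j _ =>
      h.tendsto_l2sq_pd_approx_sub j)
  simpa [energy] using h1

theorem memLp_approx (hv : LocallyIntegrable v) (n : ℕ) : MemLp (approx v n) 2 :=
  (contDiff_approx hv n).continuous.memLp_of_hasCompactSupport (hasCompactSupport_approx n)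

theorem memLp_pd_approx (hv : LocallyIntegrable v) (j : Fin 2) (n : ℕ) :
    MemLp (pd j (approx v n)) 2 :=
  (contDiff_pd (contDiff_approx hv n) j).continuous.memLp_of_hasCompactSupport
    (hasCompactSupport_pd (hasCompactSupport_approx n) j)

/-- The square root of `|B|` times a function: the form domain of the potential `|B|`. -/
def rootMul (B : Plane → ℝ) (v : Plane → ℂ) (x : Plane) : ℂ := (√|B x| : ℝ) * v x

theorem enorm_rootMul_sq (B : Plane → ℝ) (v : Plane → ℂ) (x : Plane) :
    ‖rootMul B v x‖ₑ ^ 2 = ‖B x‖ₑ * ‖v x‖ₑ ^ 2 := by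
  rw [rootMul, enorm_mul, mul_pow]
  congr 1
  rw [← ofReal_norm, Complex.norm_real, Real.norm_of_nonneg (Real.sqrt_nonneg _),
    ← ENNReal.ofReal_pow (Real.sqrt_nonneg _), Real.sq_sqrt (abs_nonneg _), ← Real.norm_eq_abs,
    ofReal_norm]

theorem norm_rootMul_sq (B : Plane → ℝ) (v : Plane → ℂ) (x : Plane) :
    ‖rootMul B v x‖ ^ 2 = |B x| * ‖v x‖ ^ 2 := by
  rw [rootMul, norm_mul, mul_pow, Complex.norm_real, Real.norm_of_nonneg (Real.sqrt_nonneg _),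
    Real.sq_sqrt (abs_nonneg _)]

theorem aestronglyMeasurable_rootMul (hB : AEStronglyMeasurable B) (hv : AEStronglyMeasurable v) :
    AEStronglyMeasurable (rootMul B v) :=
  (Complex.continuous_ofReal.comp_aestronglyMeasurable
    ((Real.continuous_sqrt.comp continuous_abs).comp_aestronglyMeasurable hB)).mul hv

theorem IsH1.tendsto_l2sq_rootMul_sub (h : IsH1 v E) (hB : MemLp B 2) :
    Tendsto (fun n => l2sq (fun x => rootMul B (approx v n) x - rootMul B v x)) atTop
      (nhds 0) := by
  obtain ⟨C, hC, hle⟩ := exists_lintegral_mul_sq_le_energy_of_test hB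
  have hl := h.locallyIntegrable
  set e : ℕ → ℝ≥0∞ := fun n =>
    energy (fun x => approx v n x - v x) (fun j x => pd j (approx v n) x - E j x) with he
  have he0 : Tendsto e atTop (nhds 0) := h.tendsto_energy_approx_sub
  have cd := contDiff_approx hl
  have ms : ∀ n, AEStronglyMeasurable (approx v n) := fun n =>
    (cd n).continuous.aestronglyMeasurable
  have hdiff : ∀ n, l2sq (fun x => rootMul B (approx v n) x - rootMul B v x) =
      ∫⁻ x, ‖B x‖ₑ * ‖approx v n x - v x‖ₑ ^ 2 := fun n => by
    refine lintegral_congr fun x => ?_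
    rw [← enorm_rootMul_sq B (fun x => approx v n x - v x)]
    simp only [rootMul, mul_sub]
  have key : ∀ n, l2sq (fun x => rootMul B (approx v n) x - rootMul B v x) ≤ C * (2 * e n) := by
    intro n
    -- The form bound is known only on test functions, and a difference of two approximations is
    -- one. Fatou in `m` then replaces `approx v m` by `v`.
    have h1 : ∀ m, ∫⁻ x, ‖B x‖ₑ * ‖approx v n x - approx v m x‖ₑ ^ 2 ≤
        C * (2 * e n + 2 * e m) := by
      intro m
      refine (hle (fun x => approx v n x - approx v m x) ((cd n).sub (cd m))
        ((hasCompactSupport_approx n).sub (hasCompactSupport_approx m))).trans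
        (mul_le_mul' le_rfl ?_)
      have h2 := energy_sub_le (v := fun x => approx v n x - v x)
        (w := fun x => approx v m x - v x) (E := fun j x => pd j (approx v n) x - E j x)
        (G := fun j x => pd j (approx v m) x - E j x) ((ms n).sub h.memLp.1)
        fun j => (aestronglyMeasurable_pd (cd n) j).sub (h.memLp_deriv j).1
      simp only [sub_sub_sub_cancel_right] at h2
      refine le_trans (le_of_eq ?_) h2
      congr 1
      funext j x
      exact pd_sub ((cd n).differentiable (by simp)) ((cd m).differentiable (by simp)) j x
    have h3 : Tendsto (fun m => C * (2 * e n + 2 * e m)) atTop (nhds (C * (2 * e n))) := by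
      have h4 := ENNReal.Tendsto.const_mul (a := C) (tendsto_const_nhds (x := 2 * e n)
        |>.add (ENNReal.Tendsto.const_mul (a := 2) he0 (Or.inr (by simp)))) (Or.inr hC)
      simpa using h4
    rw [hdiff]
    calc _ ≤ ∫⁻ x, liminf (fun m => ‖B x‖ₑ * ‖approx v n x - approx v m x‖ₑ ^ 2) atTop := by
          refine lintegral_mono_ae ?_
          filter_upwards [ae_tendsto_approx hl] with x hx
          exact (ENNReal.Tendsto.const_mul (ENNReal.Tendsto.pow (hx.const_sub _).enorm)
            (Or.inr (by simp))).liminf_eq.ge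
      _ ≤ liminf (fun m => ∫⁻ x, ‖B x‖ₑ * ‖approx v n x - approx v m x‖ₑ ^ 2) atTop :=
          lintegral_liminf_le' fun m => hB.1.enorm.mul (((ms n).sub (ms m)).enorm.pow_const 2)
      _ ≤ liminf (fun m => C * (2 * e n + 2 * e m)) atTop :=
          liminf_le_liminf (Eventually.of_forall h1)
      _ = _ := h3.liminf_eq
  refine tendsto_of_tendsto_of_tendsto_of_le_of_le tendsto_const_nhds ?_ (fun _ => bot_le) key
  simpa using ENNReal.Tendsto.const_mul (a := C)
    (ENNReal.Tendsto.const_mul (a := 2) he0 (Or.inr (by simp))) (Or.inr hC)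

end PauliHardy
end

noncomputable section

namespace PauliHardy

/-! ### The quadratic form on `H¹` -/

variable {A : Plane → Plane} {B : Plane → ℝ} {v : Plane → ℂ} {E : Fin 2 → Plane → ℂ} {CA : ℝ}

/-- The component `(i ∂_j + A_j) v` of the magnetic gradient. -/
def magneticDeriv (A : Plane → Plane) (v : Plane → ℂ) (E : Fin 2 → Plane → ℂ) (j : Fin 2)
    (x : Plane) : ℂ := Complex.I * E j x + (A x j : ℂ) * v x

theorem aestronglyMeasurable_ofReal_apply (hA : AEStronglyMeasurable A) (j : Fin 2) :
    AEStronglyMeasurable fun x => (A x j : ℂ) :=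
  (Complex.continuous_ofReal.comp
    (EuclideanSpace.proj j : Plane →L[ℝ] ℝ).continuous).comp_aestronglyMeasurable hA

theorem memLp_apply_mul (hA : AEStronglyMeasurable A) (hCA : ∀ᵐ x, ‖A x‖ ≤ CA) (hv : MemLp v 2)
    (j : Fin 2) : MemLp (fun x => (A x j : ℂ) * v x) 2 := by
  refine hv.of_le_mul (c := CA) ((aestronglyMeasurable_ofReal_apply hA j).mul hv.1) ?_
  filter_upwards [hCA] with x hx
  rw [norm_mul, Complex.norm_real]
  gcongr
  exact (PiLp.norm_apply_le (A x) j).trans hx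

theorem memLp_magneticDeriv (hA : AEStronglyMeasurable A) (hCA : ∀ᵐ x, ‖A x‖ ≤ CA)
    (hv : MemLp v 2) {j : Fin 2} (hE : MemLp (E j) 2) : MemLp (magneticDeriv A v E j) 2 :=
  (hE.const_mul Complex.I).add (memLp_apply_mul hA hCA hv j)

theorem integrable_mul_norm_sq_of_memLp_rootMul (hB : AEStronglyMeasurable B)
    (hv : AEStronglyMeasurable v) (h : MemLp (rootMul B v) 2) :
    Integrable fun x => B x * ‖v x‖ ^ 2 := by
  refine (integrable_norm_sq_of_memLp h).mono (hB.mul (hv.norm.pow 2))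
    (Eventually.of_forall fun x => ?_)
  rw [norm_rootMul_sq, norm_mul, norm_mul, Real.norm_eq_abs, Real.norm_eq_abs,
    Real.norm_eq_abs, abs_abs]

theorem integrable_scalarDensity_of_memLp (hA : AEStronglyMeasurable A)
    (hCA : ∀ᵐ x, ‖A x‖ ≤ CA) (hB : AEStronglyMeasurable B) (hv : MemLp v 2)
    (hE : ∀ j, MemLp (E j) 2) (hr : MemLp (rootMul B v) 2) (s : ℝ) :
    Integrable (scalarDensity s A B v E) := by
  have h1 := (integrable_mul_norm_sq_of_memLp_rootMul hB hv.1 hr).const_mul s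
  refine (integrable_finsetSum Finset.univ fun j _ =>
    integrable_norm_sq_of_memLp (memLp_magneticDeriv hA hCA hv (hE j))).add
      (h1.congr (Eventually.of_forall fun x => ?_))
  simp only
  ring

theorem integral_scalarDensity_of_memLp (hA : AEStronglyMeasurable A)
    (hCA : ∀ᵐ x, ‖A x‖ ≤ CA) (hB : AEStronglyMeasurable B) (hv : MemLp v 2)
    (hE : ∀ j, MemLp (E j) 2) (hr : MemLp (rootMul B v) 2) (s : ℝ) :
    ∫ x, scalarDensity s A B v E x =
      (∑ j, ∫ x, ‖magneticDeriv A v E j x‖ ^ 2) + s * ∫ x, B x * ‖v x‖ ^ 2 := by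
  have h1 := (integrable_mul_norm_sq_of_memLp_rootMul hB hv.1 hr).const_mul s
  have h2 : ∀ j ∈ Finset.univ, Integrable fun x => ‖magneticDeriv A v E j x‖ ^ 2 := fun j _ =>
    integrable_norm_sq_of_memLp (memLp_magneticDeriv hA hCA hv (hE j))
  rw [← integral_const_mul, ← integral_finsetSum _ h2,
    ← integral_add (integrable_finsetSum _ h2) h1]
  refine integral_congr_ae (Eventually.of_forall fun x => ?_)
  simp only [scalarDensity, magneticDeriv]
  ring

theorem memLp_rootMul_of_test (hB : MemLp B 2) {w : Plane → ℂ} (hw : ContDiff ℝ ∞ w)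
    (hc : HasCompactSupport w) : MemLp (rootMul B w) 2 := by
  obtain ⟨C, hC, hle⟩ := exists_lintegral_mul_sq_le_energy_of_test hB
  refine memLp_two_iff_l2sq.2
    ⟨aestronglyMeasurable_rootMul hB.1 hw.continuous.aestronglyMeasurable, ?_⟩
  simp_rw [l2sq, enorm_rootMul_sq]
  refine (hle w hw hc).trans_lt (ENNReal.mul_lt_top hC.lt_top ?_)
  have h1 := (memLp_two_iff_l2sq.1 (hw.continuous.memLp_of_hasCompactSupport hc)).2
  have h2 := fun j => (memLp_two_iff_l2sq.1 ((contDiff_pd hw j).continuous.memLp_of_hasCompactSupport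
    (hasCompactSupport_pd hc j))).2
  exact ENNReal.add_lt_top.2 ⟨ENNReal.mul_lt_top (by simp) h1, ENNReal.sum_lt_top.2 fun j _ => h2 j⟩

theorem IsH1.memLp_rootMul (h : IsH1 v E) (hB : MemLp B 2) : MemLp (rootMul B v) 2 := by
  have hl := h.locallyIntegrable
  -- A single approximation at finite distance is enough to transfer membership in `L²`.
  obtain ⟨n, hn⟩ := ((h.tendsto_l2sq_rootMul_sub hB).eventually (gt_mem_nhds zero_lt_one)).exists
  have m1 := memLp_rootMul_of_test hB (contDiff_approx hl n) (hasCompactSupport_approx n)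
  have m2 : MemLp (fun x => rootMul B (approx v n) x - rootMul B v x) 2 :=
    memLp_two_iff_l2sq.2 ⟨m1.1.sub (aestronglyMeasurable_rootMul hB.1 h.memLp.1),
      hn.trans ENNReal.one_lt_top⟩
  refine (m1.sub m2).ae_eq (Eventually.of_forall fun x => ?_)
  simp

theorem IsH1.integrable_scalarDensity (h : IsH1 v E) (hA : AEStronglyMeasurable A)
    (hCA : ∀ᵐ x, ‖A x‖ ≤ CA) (hB : MemLp B 2) (s : ℝ) : Integrable (scalarDensity s A B v E) :=
  integrable_scalarDensity_of_memLp hA hCA hB.1 h.memLp h.memLp_deriv (h.memLp_rootMul hB) s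

/-- The sign of a real number, with value one at zero. -/
def signOne (t : ℝ) : ℝ := if 0 ≤ t then 1 else -1

theorem measurable_signOne : Measurable signOne :=
  Measurable.ite measurableSet_Ici measurable_const measurable_const

theorem abs_signOne (t : ℝ) : |signOne t| ≤ 1 := by
  rw [signOne]; split_ifs <;> simp

theorem signOne_mul_abs (t : ℝ) : signOne t * |t| = t := by
  rw [signOne]
  split_ifs with h
  · rw [abs_of_nonneg h, one_mul]
  · rw [abs_of_neg (not_le.1 h)]; ring

theorem IsH1.tendsto_integral_mul_norm_sq (h : IsH1 v E) (hB : MemLp B 2) :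
    Tendsto (fun n => ∫ x, B x * ‖approx v n x‖ ^ 2) atTop (nhds (∫ x, B x * ‖v x‖ ^ 2)) := by
  have hl := h.locallyIntegrable
  -- The unbounded weight `B` is traded for the bounded weight `sign B` acting on `√|B| w`, which
  -- converges in `L²`.
  have e : ∀ (w : Plane → ℂ) x, B x * ‖w x‖ ^ 2 = signOne (B x) * ‖rootMul B w x‖ ^ 2 :=
    fun w x => by rw [norm_rootMul_sq, ← mul_assoc, signOne_mul_abs]
  simp_rw [fun n x => e (approx v n) x, e v]
  exact PauliHardy.tendsto_integral_mul_norm_sq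
    (measurable_signOne.comp_aemeasurable hB.1.aemeasurable).aestronglyMeasurable
    (fun x => abs_signOne (B x)) (h.memLp_rootMul hB)
    (fun n => memLp_rootMul_of_test hB (contDiff_approx hl n) (hasCompactSupport_approx n))
    (h.tendsto_l2sq_rootMul_sub hB)

theorem IsH1.tendsto_integral_norm_sq_magneticDeriv (h : IsH1 v E) (hA : AEStronglyMeasurable A)
    (hCA : ∀ᵐ x, ‖A x‖ ≤ CA) (j : Fin 2) :
    Tendsto (fun n => ∫ x, ‖magneticDeriv A (approx v n) (fun j => pd j (approx v n)) j x‖ ^ 2)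
      atTop (nhds (∫ x, ‖magneticDeriv A v E j x‖ ^ 2)) := by
  have hl := h.locallyIntegrable
  have key : Tendsto (fun n => l2sq (fun x => magneticDeriv A (approx v n)
      (fun j => pd j (approx v n)) j x - magneticDeriv A v E j x)) atTop (nhds 0) := by
    have hle : ∀ n, l2sq (fun x => magneticDeriv A (approx v n)
        (fun j => pd j (approx v n)) j x - magneticDeriv A v E j x) ≤
        2 * l2sq (fun x => pd j (approx v n) x - E j x) +
        2 * (ENNReal.ofReal CA ^ 2 * l2sq (fun x => approx v n x - v x)) := by
      intro n
      have e : (fun x => magneticDeriv A (approx v n)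
          (fun j => pd j (approx v n)) j x - magneticDeriv A v E j x) = fun x =>
          Complex.I * (pd j (approx v n) x - E j x) + (A x j : ℂ) * (approx v n x - v x) := by
        funext x
        simp only [magneticDeriv]
        ring
      have e2 : l2sq (fun x => Complex.I * (pd j (approx v n) x - E j x)) =
          l2sq (fun x => pd j (approx v n) x - E j x) := by
        simp [l2sq, enorm_mul, ← ofReal_norm (Complex.I)]
      rw [e]
      refine (l2sq_add_le (((memLp_pd_approx hl j n).1.sub (h.memLp_deriv j).1).const_mul _)).trans
        (add_le_add (mul_le_mul' le_rfl e2.le) (mul_le_mul' le_rfl (l2sq_le_mul ?_)))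
      filter_upwards [hCA] with x hx
      rw [norm_mul, Complex.norm_real]
      gcongr
      exact (PiLp.norm_apply_le (A x) j).trans hx
    refine tendsto_of_tendsto_of_tendsto_of_le_of_le tendsto_const_nhds ?_ (fun _ => bot_le) hle
    simpa using (ENNReal.Tendsto.const_mul (a := 2) (h.tendsto_l2sq_pd_approx_sub j)
      (Or.inr (by simp))).add (ENNReal.Tendsto.const_mul (a := 2) (ENNReal.Tendsto.const_mul
      (a := ENNReal.ofReal CA ^ 2) (tendsto_l2sq_approx_sub h.memLp) (Or.inr (by simp)))
      (Or.inr (by simp)))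
  simpa using PauliHardy.tendsto_integral_mul_norm_sq (b := fun _ => 1)
    aestronglyMeasurable_const (M := 1) (fun x => by simp)
    (memLp_magneticDeriv hA hCA h.memLp (h.memLp_deriv j))
    (fun n => memLp_magneticDeriv (E := fun j => pd j (approx v n)) hA hCA (memLp_approx hl n)
      (memLp_pd_approx hl j n)) key

/-- The form of the Pauli operator is continuous along the approximating sequence. -/
theorem IsH1.tendsto_integral_scalarDensity (h : IsH1 v E) (hA : AEStronglyMeasurable A)
    (hCA : ∀ᵐ x, ‖A x‖ ≤ CA) (hB : MemLp B 2) (s : ℝ) :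
    Tendsto (fun n => ∫ x, scalarDensity s A B (approx v n) (fun j => pd j (approx v n)) x) atTop
      (nhds (∫ x, scalarDensity s A B v E x)) := by
  have hl := h.locallyIntegrable
  rw [integral_scalarDensity_of_memLp hA hCA hB.1 h.memLp h.memLp_deriv (h.memLp_rootMul hB)]
  simp_rw [fun n => integral_scalarDensity_of_memLp hA hCA hB.1 (memLp_approx hl n)
    (fun j => memLp_pd_approx hl j n)
    (memLp_rootMul_of_test hB (contDiff_approx hl n) (hasCompactSupport_approx n)) s]
  exact (tendsto_finsetSum _ fun j _ => h.tendsto_integral_norm_sq_magneticDeriv hA hCA j).add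
    ((h.tendsto_integral_mul_norm_sq hB).const_mul s)

/-- On test functions the potential term of the form is the distributional curl. -/
theorem integral_formDensity_eq_integral_scalarDensity (hA : AEStronglyMeasurable A)
    (hCA : ∀ᵐ x, ‖A x‖ ≤ CA) (hB : MemLp B 2) (hAB : HasDistribCurl A B) {w : Plane → ℂ}
    (hw : ContDiff ℝ ∞ w) (hc : HasCompactSupport w) :
    ∫ x, formDensity A w x = ∫ x, scalarDensity 1 A B w (fun j => pd j w) x := by
  have mw := hw.continuous.memLp_of_hasCompactSupport hc (μ := volume) (p := 2)
  have md := fun j => (contDiff_pd hw j).continuous.memLp_of_hasCompactSupport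
    (hasCompactSupport_pd hc j) (μ := volume) (p := 2)
  rw [integral_scalarDensity_of_memLp hA hCA hB.1 mw md (memLp_rootMul_of_test hB hw hc)]
  have h2 : ∀ j ∈ Finset.univ, Integrable fun x => ‖magneticDeriv A w (fun j => pd j w) j x‖ ^ 2 :=
    fun j _ => integrable_norm_sq_of_memLp
      (memLp_magneticDeriv (E := fun j => pd j w) hA hCA mw (md j))
  have h3 := integrable_finsetSum _ h2
  -- The distributional identity for the curl is used with the test function `|w|²`.
  have h5 := hAB (fun y => ‖w y‖ ^ 2) ⟨hw.norm_sq ℝ, hasCompactSupport_norm_sq hc⟩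
  rw [one_mul, ← integral_finsetSum _ h2, ← h5, ← sub_eq_iff_eq_add',
    ← integral_sub (integrable_formDensity hA hCA hw hc) h3]
  refine integral_congr_ae (Eventually.of_forall fun x => ?_)
  simp only [formDensity, magneticDeriv, partialDeriv_eq_pd]
  ring

/-- A Hardy inequality with bounded weight extends from test functions to `H¹`. -/
theorem IsH1.le_integral_scalarDensity (h : IsH1 v E) (hA : AEStronglyMeasurable A)
    (hCA : ∀ᵐ x, ‖A x‖ ≤ CA) (hB : MemLp B 2) (hAB : HasDistribCurl A B) {V : Plane → ℝ}
    (hV : AEStronglyMeasurable V) {M : ℝ} (hM : ∀ x, |V x| ≤ M)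
    (htest : ∀ w : Plane → ℂ, ContDiff ℝ ∞ w → HasCompactSupport w →
      ∫ x, V x * ‖w x‖ ^ 2 ≤ ∫ x, formDensity A w x) :
    ∫ x, V x * ‖v x‖ ^ 2 ≤ ∫ x, scalarDensity 1 A B v E x := by
  have hl := h.locallyIntegrable
  refine le_of_tendsto_of_tendsto' (PauliHardy.tendsto_integral_mul_norm_sq hV hM h.memLp
    (memLp_approx hl) (tendsto_l2sq_approx_sub h.memLp))
    (h.tendsto_integral_scalarDensity hA hCA hB 1) fun n => ?_
  rw [← integral_formDensity_eq_integral_scalarDensity hA hCA hB hAB (contDiff_approx hl n)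
    (hasCompactSupport_approx n)]
  exact htest _ (contDiff_approx hl n) (hasCompactSupport_approx n)

end PauliHardy
end

noncomputable section

namespace PauliHardy

/-! ### Components, and reversal of the magnetic field -/

section components

variable {F G : Type*} [NormedAddCommGroup F] [NormedSpace ℝ F] [CompleteSpace F]
  [NormedAddCommGroup G] [NormedSpace ℝ G] [CompleteSpace G]

/-- Real linearity is what is needed: the result covers spinor components and also complex
conjugation. -/
theorem IsH1.clm_comp {u : Plane → F} {D : Fin 2 → Plane → F} (h : IsH1 u D) (L : F →L[ℝ] G) :
    IsH1 (fun x => L (u x)) (fun j x => L (D j x)) where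
  memLp := L.comp_memLp' h.memLp
  memLp_deriv j := L.comp_memLp' (h.memLp_deriv j)
  weakDeriv j φ hφ := by
    have h1 : Integrable fun x => partialDeriv j φ x • u x :=
      h.locallyIntegrable.integrable_smul_left_of_hasCompactSupport
        (contDiff_pd hφ.smooth j).continuous (hasCompactSupport_pd hφ.compact j)
    have h2 : Integrable fun x => φ x • D j x :=
      (h.locallyIntegrable_deriv j).integrable_smul_left_of_hasCompactSupport
        hφ.smooth.continuous hφ.compact
    simp_rw [← map_smul]
    rw [L.integral_comp_comm h1, L.integral_comp_comm h2, h.weakDeriv j φ hφ, map_neg]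

end components

theorem IsH1.apply {u : Plane → Spinor} {D : Fin 2 → Plane → Spinor} (h : IsH1 u D) (i : Fin 2) :
    IsH1 (fun x => u x i) (fun j x => D j x i) :=
  h.clm_comp ((EuclideanSpace.proj i : Spinor →L[ℂ] ℂ).restrictScalars ℝ)

theorem IsH1.conj {v : Plane → ℂ} {E : Fin 2 → Plane → ℂ} (h : IsH1 v E) :
    IsH1 (fun x => (starRingEnd ℂ) (v x)) (fun j x => (starRingEnd ℂ) (E j x)) :=
  h.clm_comp (Complex.conjCLE : ℂ →L[ℝ] ℂ)

/-- The conjugate of `iE + Av` is minus `i conj(E) - A conj(v)`, so charge conjugation exchanges the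
two spin components and reverses the field. -/
theorem scalarDensity_neg_one (A : Plane → Plane) (B : Plane → ℝ) (v : Plane → ℂ)
    (E : Fin 2 → Plane → ℂ) :
    scalarDensity (-1) A B v E = scalarDensity 1 (fun x => -A x) (fun x => -B x)
      (fun x => (starRingEnd ℂ) (v x)) (fun j x => (starRingEnd ℂ) (E j x)) := by
  funext x
  have h : ∀ j, ‖Complex.I * (starRingEnd ℂ) (E j x) + ((-A x) j : ℂ) * (starRingEnd ℂ) (v x)‖ =
      ‖Complex.I * E j x + (A x j : ℂ) * v x‖ := by
    intro j
    rw [← norm_neg, ← Complex.norm_conj]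
    congr 1
    simp
    ring
  simp only [scalarDensity, h, Complex.norm_conj]
  ring

theorem HasDistribCurl.neg {A : Plane → Plane} {B : Plane → ℝ} (h : HasDistribCurl A B) :
    HasDistribCurl (fun x => -A x) (fun x => -B x) := by
  intro φ hφ
  have h1 := congrArg Neg.neg (h φ hφ)
  rw [← integral_neg, ← integral_neg] at h1
  refine Eq.trans (integral_congr_ae (Eventually.of_forall fun x => ?_))
    (h1.trans (integral_congr_ae (Eventually.of_forall fun x => ?_)))
  · simp only [PiLp.neg_apply]; ring
  · simp only; ring

theorem flux_neg (B : Plane → ℝ) : flux (fun x => -B x) = -flux B := by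
  simp [flux, integral_neg]

theorem superpotential_neg (B : Plane → ℝ) (x : Plane) :
    superpotential (fun x => -B x) x = -superpotential B x := by
  simp [superpotential, integral_neg]

theorem gMinus_eq_gPlus_neg {ρ : ℝ} (hρ : 0 < ρ) (α r : ℝ) :
    gMinus α ρ r = gPlus (-α) ρ r := by
  rw [gMinus, gPlus_eq_exp hρ, gPlus_eq_exp hρ, one_div, ← Real.exp_neg, neg_mul]

theorem ratioMinus_eq_ratioPlus_neg {ρ : ℝ} (hρ : 0 < ρ) (B : Plane → ℝ) :
    ratioMinus B ρ = ratioPlus (fun x => -B x) ρ := by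
  funext x
  rw [ratioMinus, ratioPlus, gMinus_eq_gPlus_neg hρ, flux_neg, superpotential_neg, neg_neg]

theorem distToInt_neg (α : ℝ) : distToInt (-α) = distToInt α := by
  rw [distToInt, distToInt, ← (Equiv.neg ℤ).iInf_comp]
  refine iInf_congr fun m => ?_
  rw [← abs_neg]
  simp only [Equiv.neg_apply, Int.cast_neg]
  congr 1
  ring

theorem hardyProfile_neg (α ρ r : ℝ) : hardyProfile (-α) ρ r = hardyProfile α ρ r := by
  have h : (∃ m : ℤ, (m : ℝ) = -α) ↔ ∃ m : ℤ, (m : ℝ) = α :=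
    ⟨fun ⟨m, hm⟩ => ⟨-m, by push_cast; linarith⟩, fun ⟨m, hm⟩ => ⟨-m, by push_cast; linarith⟩⟩
  unfold hardyProfile
  by_cases hα : ∃ m : ℤ, (m : ℝ) = α
  · rw [if_pos hα, if_pos (h.2 hα), abs_neg]
  · rw [if_neg hα, if_neg (h.not.2 hα), distToInt_neg]

theorem wMinus_eq_wPlus_neg {ρ : ℝ} (hρ : 0 < ρ) (B : Plane → ℝ) :
    wMinus B ρ = wPlus (fun x => -B x) ρ := by
  funext x
  rw [wMinus, wPlus, flux_neg, hardyProfile_neg, betaMinus, betaPlus, kMinus, bigKMinus, kPlus,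
    bigKPlus, ratioMinus_eq_ratioPlus_neg hρ]

/-! ### The Hardy inequality for the components -/

variable {A : Plane → Plane} {B : Plane → ℝ} {v : Plane → ℂ} {E : Fin 2 → Plane → ℂ} {ρ : ℝ}

theorem IsAdmissibleField.bddAbove_range_ratioPlus (hB : IsAdmissibleField B) (hρ : 0 < ρ) :
    BddAbove (range (ratioPlus B ρ)) := by
  obtain ⟨c, C, -, h⟩ := hB.exists_ratioPlus_bounds hρ
  exact ⟨C, forall_mem_range.2 fun x => (h x).2⟩

theorem IsAdmissibleField.bddBelow_range_ratioPlus (hB : IsAdmissibleField B) (hρ : 0 < ρ) :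
    BddBelow (range (ratioPlus B ρ)) := by
  obtain ⟨c, C, -, h⟩ := hB.exists_ratioPlus_bounds hρ
  exact ⟨c, forall_mem_range.2 fun x => (h x).1⟩

theorem IsAdmissibleField.kPlus_pos (hB : IsAdmissibleField B) (hρ : 0 < ρ) : 0 < kPlus B ρ := by
  obtain ⟨c, C, hc, h⟩ := hB.exists_ratioPlus_bounds hρ
  exact hc.trans_le (le_ciInf fun x => (h x).1)

theorem IsAdmissibleField.bigKPlus_pos (hB : IsAdmissibleField B) (hρ : 0 < ρ) :
    0 < bigKPlus B ρ :=
  (hB.kPlus_pos hρ).trans_le ((ciInf_le (hB.bddBelow_range_ratioPlus hρ) 0).trans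
    (le_ciSup (hB.bddAbove_range_ratioPlus hρ) 0))

theorem abs_wPlus_le (B : Plane → ℝ) (hρ : 0 < ρ) (x : Plane) :
    |wPlus B ρ x| ≤ betaPlus B ρ * (1 / ρ ^ 2) := by
  rw [wPlus, betaPlus, abs_mul, abs_of_nonneg (sq_nonneg _), abs_of_nonneg (hardyProfile_nonneg ..)]
  gcongr
  exact hardyProfile_le hρ

theorem measurable_wPlus (B : Plane → ℝ) (ρ : ℝ) : Measurable (wPlus B ρ) :=
  ((hardyProfile_measurable _ ρ).comp measurable_norm).const_mul _

theorem integrable_wPlus_mul (B : Plane → ℝ) (hρ : 0 < ρ) (hv : MemLp v 2) :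
    Integrable fun x => wPlus B ρ x * ‖v x‖ ^ 2 :=
  (integrable_norm_sq_of_memLp hv).bdd_mul (c := betaPlus B ρ * (1 / ρ ^ 2))
    (measurable_wPlus B ρ).aestronglyMeasurable (Eventually.of_forall (abs_wPlus_le B hρ))

theorem exists_ae_norm_le_of_memLp_top {F : Type*} [NormedAddCommGroup F] {f : Plane → F}
    (hf : MemLp f ∞) : ∃ C, ∀ᵐ x, ‖f x‖ ≤ C := by
  refine ⟨(eLpNorm f ∞ volume).toReal, ?_⟩
  filter_upwards [ae_le_eLpNormEssSup (f := f) (μ := volume)] with x hx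
  have h := hf.2
  rw [eLpNorm_exponent_top] at h ⊢
  rw [← toReal_enorm]
  exact ENNReal.toReal_mono h.ne hx

theorem IsH1.integrable_scalarDensity_of_memLp_top (h : IsH1 v E) (hB : IsAdmissibleField B)
    (hA : MemLp A ∞) (s : ℝ) : Integrable (scalarDensity s A B v E) := by
  obtain ⟨CA, hCA⟩ := exists_ae_norm_le_of_memLp_top hA
  exact h.integrable_scalarDensity hA.1 hCA hB.memLp_two s

/-- The zero-weight case, where the perfect square alone suffices and the flux may have either sign.
It disposes of the component that carries no Hardy weight. -/
theorem IsH1.integral_scalarDensity_nonneg (h : IsH1 v E) (hB : IsAdmissibleField B)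
    (hA : MemLp A ∞) (hAB : HasDistribCurl A B) : 0 ≤ ∫ x, scalarDensity 1 A B v E x := by
  obtain ⟨CA, hCA⟩ := exists_ae_norm_le_of_memLp_top hA
  have := h.le_integral_scalarDensity hA.1 hCA hB.memLp_two hAB (V := fun _ => 0)
    aestronglyMeasurable_const (M := 0) (by simp) fun w hw hc => ?_
  · simpa using this
  · rw [integral_formDensity hA.1 hCA hw hc]
    simpa using integral_nonneg fun x => sq_nonneg _

/-- The Hardy inequality for the spin-up component. -/
theorem IsH1.integral_wPlus_le (h : IsH1 v E) (hB : IsAdmissibleField B) (hA : MemLp A ∞)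
    (hAB : HasDistribCurl A B) (hρ : 0 < ρ) (hα : 0 ≤ flux B) :
    ∫ x, wPlus B ρ x * ‖v x‖ ^ 2 ≤ ∫ x, scalarDensity 1 A B v E x := by
  obtain ⟨CA, hCA⟩ := exists_ae_norm_le_of_memLp_top hA
  refine h.le_integral_scalarDensity hA.1 hCA hB.memLp_two hAB
    (measurable_wPlus B ρ).aestronglyMeasurable (abs_wPlus_le B hρ) fun w hw hc => ?_
  have key := hardy_test hB (locallyIntegrable_of_memLp_top hA) hCA hAB hρ hα (hB.kPlus_pos hρ)
    (hB.bigKPlus_pos hρ)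
    (fun x => (le_div_iff₀ (gPlus_pos hρ)).1 (ciInf_le (hB.bddBelow_range_ratioPlus hρ) x))
    (fun x => (div_le_iff₀ (gPlus_pos hρ)).1 (le_ciSup (hB.bddAbove_range_ratioPlus hρ) x)) hw hc
  rw [← integral_const_mul] at key
  simpa only [wPlus, betaPlus, mul_assoc] using key

theorem weightDensity_up (f : Plane → ℝ) (u : Plane → Spinor) :
    weightDensity (fun x => !![f x, 0; 0, 0]) u = fun x => f x * ‖u x 0‖ ^ 2 := by
  funext x
  simp only [weightDensity, Fin.sum_univ_two]
  simp [← Complex.normSq_eq_norm_sq, Complex.normSq_apply]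
  ring

theorem weightDensity_down (f : Plane → ℝ) (u : Plane → Spinor) :
    weightDensity (fun x => !![0, 0; 0, f x]) u = fun x => f x * ‖u x 1‖ ^ 2 := by
  funext x
  simp only [weightDensity, Fin.sum_univ_two]
  simp [← Complex.normSq_eq_norm_sq, Complex.normSq_apply]
  ring

/-- The Hardy inequality for the Pauli operator with nonnegative flux. -/
theorem pauliGE_wPlus (hB : IsAdmissibleField B) (hA : MemLp A ∞) (hAB : HasDistribCurl A B)
    (hρ : 0 < ρ) (hα : 0 ≤ flux B) : PauliGE A B (fun x => !![wPlus B ρ x, 0; 0, 0]) := by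
  intro u D h
  have i0 := (h.apply 0).integrable_scalarDensity_of_memLp_top hB hA 1
  have i1 := (h.apply 1).integrable_scalarDensity_of_memLp_top hB hA (-1)
  rw [weightDensity_up]
  refine ⟨i0.add i1, integrable_wPlus_mul B hρ (h.apply 0).memLp, ?_⟩
  have h0 := (h.apply 0).integral_wPlus_le hB hA hAB hρ hα
  have h1 := (h.apply 1).conj.integral_scalarDensity_nonneg (A := fun x => -A x) hB.neg hA.neg hAB.neg
  rw [← scalarDensity_neg_one] at h1
  refine (le_add_of_le_of_nonneg h0 h1).trans_eq ?_
  exact (integral_add i0 i1).symm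

/-- The Hardy inequality for the Pauli operator with nonpositive flux. -/
theorem pauliGE_wMinus (hB : IsAdmissibleField B) (hA : MemLp A ∞) (hAB : HasDistribCurl A B)
    (hρ : 0 < ρ) (hα : flux B ≤ 0) : PauliGE A B (fun x => !![0, 0; 0, wMinus B ρ x]) := by
  intro u D h
  have i0 := (h.apply 0).integrable_scalarDensity_of_memLp_top hB hA 1
  have i1 := (h.apply 1).integrable_scalarDensity_of_memLp_top hB hA (-1)
  rw [weightDensity_down, wMinus_eq_wPlus_neg hρ]
  refine ⟨i0.add i1, integrable_wPlus_mul _ hρ (h.apply 1).memLp, ?_⟩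
  have h0 := (h.apply 0).integral_scalarDensity_nonneg hB hA hAB
  have h1 := (h.apply 1).conj.integral_wPlus_le (A := fun x => -A x) hB.neg hA.neg hAB.neg
    hρ (by rw [flux_neg]; exact neg_nonneg.2 hα)
  rw [← scalarDensity_neg_one] at h1
  simp_rw [Complex.norm_conj] at h1
  refine (le_add_of_nonneg_of_le h0 h1).trans_eq ?_
  exact (integral_add i0 i1).symm

end PauliHardy
end

theorem corollary2p6 (B : PauliHardy.Plane → ℝ) (hB : PauliHardy.IsAdmissibleField B)
    (A : PauliHardy.Plane → PauliHardy.Plane) (hA : MemLp A ∞ volume)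
    (hAB : PauliHardy.HasDistribCurl A B) :
    -- the flux and the superpotential are given by convergent integrals
    Integrable B ∧
    (∀ x, Integrable (fun y => B y * Real.log ‖x - y‖)) ∧
    ∀ ρ : ℝ, 0 < ρ →
      -- the constants entering the weights are positive and finite
      (0 < PauliHardy.kPlus B ρ ∧ BddAbove (range (PauliHardy.ratioPlus B ρ))) ∧
      (0 < PauliHardy.kMinus B ρ ∧ BddAbove (range (PauliHardy.ratioMinus B ρ))) ∧
      -- the Hardy inequality
      (0 ≤ PauliHardy.flux B →
        PauliHardy.PauliGE A B (fun x => !![PauliHardy.wPlus B ρ x, 0; 0, 0])) ∧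
      (PauliHardy.flux B ≤ 0 →
        PauliHardy.PauliGE A B (fun x => !![0, 0; 0, PauliHardy.wMinus B ρ x])) := by
  refine ⟨hB.integrable, hB.integrable_mul_log, fun ρ hρ => ⟨⟨hB.kPlus_pos hρ,
    hB.bddAbove_range_ratioPlus hρ⟩, ?_, PauliHardy.pauliGE_wPlus hB hA hAB hρ,
    PauliHardy.pauliGE_wMinus hB hA hAB hρ⟩⟩
  -- The minus constants of `B` are the plus constants of `-B`, which is again admissible.
  rw [PauliHardy.kMinus, PauliHardy.ratioMinus_eq_ratioPlus_neg hρ]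
  exact ⟨hB.neg.kPlus_pos hρ, hB.neg.bddAbove_range_ratioPlus hρ⟩
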